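/- Let $\mathbb K$ be a field of characteristic zero (for instance $\mathbb R$ or $\mathbb C$), let $V$ be a super vector space with a homogeneous basis $\{x^i\}_{i\in I}$ indexed by a (linearly ordered) set $I$, and let $\widetilde V=\mathbb K^{0|1}\oplus V$ with basis $\{x^a\}_{a\in\{0\}\cup I}$, where $x^0$ is odd. Write $|a|$ for the parity of $x^a$. Let $\mathbb K[[\widetilde V,\hbar]]$ be the completion of the free supercommutative algebra in the $x^a$ and $\hbar$ with respect to the degree $\deg x^a=1$, $\deg\hbar=2$ (so a series has finitely many monomials in each degree), and let $\widehat{\mathcal W_\hbar}(\widetilde V)$ be the completed algebra of differential operators on it generated by $x^a$, $\hbar\partial_a$, $\hbar$ (degrees $1,1,2$), with the topology of pointwise convergence. A super quantum Airy structure is an even, continuous linear map $L:V^*\to\widehat{\mathcal W_\hbar}(\widetilde V)$ such that the left ideal $\mathfrak L$ generated by $L(V^*)$ satisfies $[\mathfrak L,\mathfrak L]\subseteq\hbar\,\mathfrak L$ for the supercommutator, and such that $L(y_i)^{\le 1}=\hbar\partial_i$ for the dual elements $y_i\in V^*$ $(i\in I)$. Let $(V,L)$ be a super quantum Airy structure that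 is quadratic, i.e. $L(V^*)\subseteq\widehat{\mathcal W_\hbar}(\widetilde V)^{\le 2}$, with coefficients $A,B,C,D$: $$L(y_i)=\hbar\partial_i-\tfrac12\sum_{a,b}A_{iab}x^ax^b-\hbar\sum_{a,b}B_{ia}^b x^a\partial_b-\tfrac12\hbar^2\sum_{a,b}C_i^{ab}\partial_a\partial_b-\hbar D_i ,$$ where $A_{iab}=(-1)^{|a||b|}A_{iba}$, $C_i^{ab}=(-1)^{|a||b|}C_i^{ba}$. A free energy of $(V,L)$ is an even series $F\in\mathbb K[[\widetilde V,\hbar]]$ having no terms independent of the $x^a$ and no terms of degree less than $3$, such that $\psi_F(L(\phi))\cdot 1=0$ for all $\phi\in V^*$, where $\psi_F(T)=\sum_{n\ge0}\frac1{n!}\bigl(-\frac1\hbar[F,\cdot\,]\bigr)^n(T)$. **Theorem.** (1) There is exactly one free energy $F$ of $(V,L)$. (2) $F$ has a unique expansion $$F=\sum_{g\ge0}\sum_{n\ge1}\sum_{a_1,\dots,a_n}\frac{\hbar^g}{n!}F_{g,n}[a_1,\dots,a_n]\,x^{a_1}\cdots x^{a_n}$$ with $F_{g,n}[\ldots]\in\mathbb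 K$ graded-symmetric in the indices (an exchange of neighbours $a,b$ produces the sign $(-1)^{|a||b|}$). For each $g,n$ only finitely many $F_{g,n}[a_1,\dots,a_n]$ are non-zero, and $F_{g,n}=0$ if $2g+n<3$, $F_{g,1}[0]=0$. (Put $F_{g,0}=0$ and $F_{-1,n}=0$.) (3) For all $g,n\ge0$, $i\in I$ and $\Phi=(a_1,\dots,a_n)$ with $a_k\in\{0\}\cup I$, $$\begin{aligned}F_{g,n+1}[i,\Phi]={}&A_{ia_1a_2}\delta_{g,0}\delta_{n,2}+D_i\delta_{n,0}\delta_{g,1}+\sum_{k=1}^n\sigma_{a_k\subset\Phi}\sum_bB_{ia_k}^bF_{g,n}[b,\Phi\setminus a_k]+\frac12\sum_{b,c}C_i^{bc}F_{g-1,n+2}[c,b,\Phi]\\&+\frac12\sum_{b,c}\sum_{g_1+g_2=g}\sum_{\Phi_1\cup\Phi_2=\Phi}\sigma_{\Phi_1\subset\Phi}C_i^{bc}F_{g_1,n_1+1}[b,\Phi_1]F_{g_2,n_2+1}[c,\Phi_2],\end{aligned}$$ where $b,c$ run over $\{0\}\cup I$, the last sum is over all ordered decompositions of the ordered set $\Phi$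 into complementary ordered subsets with $n_1,n_2$ elements, and $\sigma_{\Phi_1\subset\Phi}$ is the Koszul sign of the permutation from $\Phi$ to $\Phi_1\cup(\Phi\setminus\Phi_1)$ (only exchanges of two odd indices count). Moreover, for all $g\ge 0$, $n\ge1$, $$F_{g,n+1}[0,a_1,a_2,\dots,a_n]=(-1)^{|a_1|}F_{g,n+1}[a_1,0,a_2,\dots,a_n].$$ (4) Conversely, every family $F'_{g,n}[a_1,\dots,a_n]\in\mathbb K$ that satisfies the two equations of (3) and $F'_{g,0}=0$, $F'_{g,n}=0$ for $2g+n<3$, $F'_{g,1}[0]=0$ is graded-symmetric and equal to the family $F_{g,n}$. -/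

import Mathlib

noncomputable section

namespace SuperAiry

open Finset

section Series

variable (K : Type*) [Field K] {A : Type*} [LinearOrder A] (p : A → ZMod 2)

/-- `(k, e)` stands for the monomial `ħ ^ k * ∏ a, (x ^ a) ^ (e a)`, the product being taken in
increasing order of the indices `a`. -/
abbrev Mono (A : Type*) := ℕ × (A →₀ ℕ)

/-- The `ℤ`-degree: `deg x ^ a = 1`, `deg ħ = 2`. -/
def deg (m : Mono A) : ℕ := 2 * m.1 + m.2.degree

/-- Odd variables square to zero. -/
def Admissible (e : A →₀ ℕ) : Prop := ∀ a, p a = 1 → e a ≤ 1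

/-- The `ℤ/2`-degree of a monomial. -/
def monoParity (e : A →₀ ℕ) : ZMod 2 := e.sum fun a n => n • p a

/-- The superalgebra `K[[V, ħ]]`, where `V` has the homogeneous basis `x ^ a` (`a : A`) with
`x ^ a` of parity `p a`: the completion of the free supercommutative algebra `K[V, ħ]` with respect
to the ideal of elements of positive degree. An element is a formal sum of monomials with only
finitely many monomials in each degree. -/
def Series : Submodule K (Mono A → K) where
  carrier := {f | (∀ m, f m ≠ 0 → Admissible p m.2) ∧
    ∀ d, {m : Mono A | deg m = d ∧ f m ≠ 0}.Finite}
  zero_mem' := by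
    constructor
    · intro m h
      simp at h
    · intro d
      simp
  add_mem' := by
    rintro f g ⟨hf, hf'⟩ ⟨hg, hg'⟩
    have key : ∀ m, (f + g) m ≠ 0 → f m ≠ 0 ∨ g m ≠ 0 := by
      intro m h
      by_contra! hc
      simp [hc.1, hc.2] at h
    constructor
    · intro m h
      rcases key m h with h | h
      · exact hf m h
      · exact hg m h
    · intro d
      refine ((hf' d).union (hg' d)).subset ?_
      rintro m ⟨h1, h2⟩
      rcases key m h2 with h | h
      · exact Or.inl ⟨h1, h⟩
      · exact Or.inr ⟨h1, h⟩
  smul_mem' := by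
    rintro c f ⟨hf, hf'⟩
    have key : ∀ m, (c • f) m ≠ 0 → f m ≠ 0 := by
      intro m h hc
      simp [hc] at h
    exact ⟨fun m h => hf m (key m h), fun d =>
      (hf' d).subset fun m h => ⟨h.1, key m h.2⟩⟩

variable {K} in
/-- Convergence of an unconditional sum in the adic topology of `K[[V, ħ]]`, in which the sets of
series without terms of degree `< N` form a neighbourhood basis of zero. -/
def SumsTo {ι : Type*} (t : ι → Series K p) (s : Series K p) : Prop :=
  ∀ N : ℕ, ∃ J : Finset ι, ∀ J' : Finset ι, J ⊆ J' →
    ∀ m, deg m < N → (∑ j ∈ J', t j).1 m = s.1 m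

variable {K} in
/-- `f` is homogeneous of parity `q`. -/
def HasParity (f : Series K p) (q : ZMod 2) : Prop := ∀ m, f.1 m ≠ 0 → monoParity p m.2 = q

variable {K} in
/-- `f` is homogeneous of degree `d`. -/
def HasDegree (f : Series K p) (d : ℕ) : Prop := ∀ m, f.1 m ≠ 0 → deg m = d

/-- A single monomial as a series. -/
def mono (m : Mono A) (hm : Admissible p m.2) : Series K p :=
  ⟨Pi.single m 1, by
    have key : ∀ n, (Pi.single m (1 : K) : Mono A → K) n ≠ 0 → n = m := by
      intro n h
      by_contra hc
      simp [Pi.single_eq_of_ne hc] at h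
    refine ⟨fun n h => ?_, fun d => ?_⟩
    · rw [key n h]
      exact hm
    · exact (Set.finite_singleton m).subset fun n h => key n h.2⟩

/-- The series `1`. -/
def one : Series K p := mono K p (0, 0) (by intro a _; simp)

/-- The series `ħ`. -/
def hbar : Series K p := mono K p (1, 0) (by intro a _; simp)

/-- The series `x ^ a`. -/
def X (a : A) : Series K p := mono K p (0, Finsupp.single a 1) (by
  intro b _
  by_cases h : a = b
  · simp [h]
  · simp [h])

/-- The number of pairs of odd variables that have to be interchanged in order to bring the product
of the (ordered) monomials with exponents `e` and `e'` into increasing order. -/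
def crossings (e e' : A →₀ ℕ) : ℕ :=
  ∑ a ∈ e.support, ∑ b ∈ e'.support, if p a = 1 ∧ p b = 1 ∧ b < a then 1 else 0

open Classical in
/-- The supercommutative product of formal sums of monomials. -/
def rawMul (f g : Mono A → K) : Mono A → K := fun m =>
  if Admissible p m.2 then
    ∑ k ∈ antidiagonal m.1, ∑ e ∈ antidiagonal m.2,
      (-1) ^ crossings p e.1 e.2 * f (k.1, e.1) * g (k.2, e.2)
  else 0

lemma rawMul_mem {f g : Mono A → K} (hf : f ∈ Series K p) (hg : g ∈ Series K p) :
    rawMul K p f g ∈ Series K p := by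
  classical
  refine ⟨fun m h => ?_, fun d => ?_⟩
  · by_contra hc
    simp [rawMul, hc] at h
  · have hF : ∀ h ∈ Series K p, {m : Mono A | deg m ≤ d ∧ h m ≠ 0}.Finite := by
      intro h hh
      have : {m : Mono A | deg m ≤ d ∧ h m ≠ 0} ⊆
          ⋃ j ∈ Set.Iic d, {m : Mono A | deg m = j ∧ h m ≠ 0} := by
        rintro m ⟨h1, h2⟩
        simp only [Set.mem_iUnion]
        exact ⟨deg m, h1, rfl, h2⟩
      exact ((Set.finite_Iic d).biUnion fun j _ => hh.2 j).subset this
    refine (Set.Finite.image2 (fun m n : Mono A => m + n) (hF f hf) (hF g hg)).subset ?_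
    rintro m ⟨h1, h2⟩
    have h3 : ∑ k ∈ antidiagonal m.1, ∑ e ∈ antidiagonal m.2,
      (-1) ^ crossings p e.1 e.2 * f (k.1, e.1) * g (k.2, e.2) ≠ 0 := by
      intro hc
      simp [rawMul, hc] at h2
    obtain ⟨k, hk, h4⟩ := Finset.exists_ne_zero_of_sum_ne_zero h3
    obtain ⟨e, he, h5⟩ := Finset.exists_ne_zero_of_sum_ne_zero h4
    have hk' := mem_antidiagonal.1 hk
    have he' := mem_antidiagonal.1 he
    have hd : deg m = deg (k.1, e.1) + deg (k.2, e.2) := by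
      simp only [deg, ← hk', ← he', map_add]
      ring
    refine ⟨(k.1, e.1), ⟨by omega, ?_⟩, (k.2, e.2), ⟨by omega, ?_⟩, ?_⟩
    · intro hc
      simp [hc] at h5
    · intro hc
      simp [hc] at h5
    · exact Prod.ext hk' he'

/-- The product of `K[[V, ħ]]`; `mul K p f` is the operator of multiplication by `f`. -/
def mul : Series K p →ₗ[K] Module.End K (Series K p) :=
  LinearMap.mk₂ K (fun f g => ⟨rawMul K p f.1 g.1, rawMul_mem K p f.2 g.2⟩)
    (by
      intro f f' g
      apply Subtype.ext
      funext m
      by_cases h : Admissible p m.2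
      · simp [rawMul, h, mul_add, add_mul, sum_add_distrib]
      · simp [rawMul, h])
    (by
      intro c f g
      apply Subtype.ext
      funext m
      by_cases h : Admissible p m.2
      · simp only [rawMul, h, if_true, SetLike.val_smul, Pi.smul_apply, smul_eq_mul, mul_sum]
        exact sum_congr rfl fun k _ => sum_congr rfl fun e _ => by ring
      · simp [rawMul, h])
    (by
      intro f g g'
      apply Subtype.ext
      funext m
      by_cases h : Admissible p m.2
      · simp [rawMul, h, mul_add, sum_add_distrib]
      · simp [rawMul, h])
    (by
      intro c f g
      apply Subtype.ext
      funext m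
      by_cases h : Admissible p m.2
      · simp only [rawMul, h, if_true, SetLike.val_smul, Pi.smul_apply, smul_eq_mul, mul_sum]
        exact sum_congr rfl fun k _ => sum_congr rfl fun e _ => by ring
      · simp [rawMul, h])

/-- The number of odd variables that stand to the left of the position of `x ^ a` in the monomial
with exponent `e`. -/
def oddBefore (a : A) (e : A →₀ ℕ) : ℕ := #{b ∈ e.support | p b = 1 ∧ b < a}

/-- The left (super)derivative `∂_a` with respect to `x ^ a`. -/
def partialD (a : A) : Module.End K (Series K p) where
  toFun f := ⟨fun m => (if p a = 1 then (-1) ^ oddBefore p a m.2 else 1) * (m.2 a + 1 : K) *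
      f.1 (m.1, m.2 + Finsupp.single a 1), by
    refine ⟨fun m h b hb => ?_, fun d => ?_⟩
    · have h1 := f.2.1 _ (right_ne_zero_of_mul h) b hb
      simp only [Finsupp.add_apply] at h1
      omega
    · refine Set.Finite.of_finite_image ((f.2.2 (d + 1)).subset ?_)
        (f := fun m : Mono A => (m.1, m.2 + Finsupp.single a 1)) ?_
      · rintro _ ⟨m, ⟨h1, h2⟩, rfl⟩
        refine ⟨?_, right_ne_zero_of_mul h2⟩
        simp only [deg, map_add, Finsupp.degree_single] at h1 ⊢
        omega
      · rintro m _ n _ h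
        simp only [Prod.mk.injEq, add_left_inj] at h
        exact Prod.ext h.1 h.2⟩
  map_add' f g := by
    apply Subtype.ext
    funext m
    simp [mul_add]
  map_smul' c f := by
    apply Subtype.ext
    funext m
    simp only [SetLike.val_smul, Pi.smul_apply, smul_eq_mul, RingHom.id_apply]
    ring

/-- Division by `ħ` (exact on the multiples of `ħ`, to which alone it will be applied). -/
def divHbar : Module.End K (Series K p) where
  toFun f := ⟨fun m => f.1 (m.1 + 1, m.2), by
    refine ⟨fun m h => f.2.1 (m.1 + 1, m.2) h, fun d => ?_⟩
    refine Set.Finite.of_finite_image ((f.2.2 (d + 2)).subset ?_)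
      (f := fun m : Mono A => (m.1 + 1, m.2)) ?_
    · rintro _ ⟨m, ⟨h1, h2⟩, rfl⟩
      refine ⟨?_, h2⟩
      simp only [deg] at h1 ⊢
      omega
    · rintro m _ n _ h
      simp only [Prod.mk.injEq, add_left_inj] at h
      exact Prod.ext h.1 h.2⟩
  map_add' f g := rfl
  map_smul' c f := rfl

/-- The polynomial part of the Weyl algebra: the operators generated by `x ^ a`, `ħ ∂_a` and
`ħ`. -/
def Weyl : Subalgebra K (Module.End K (Series K p)) :=
  Algebra.adjoin K
    (Set.range (fun a => mul K p (X K p a)) ∪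
      Set.range (fun a => mul K p (hbar K p) * partialD K p a) ∪ {mul K p (hbar K p)})

/-- The completed Weyl algebra: the closure of the algebra of differential operators in the space
of all operators on the complete space `K[[V, ħ]]`, for the topology of pointwise convergence. (A
term `ħ ^ (m + k) x ^ {i_1} ⋯ x ^ {i_n} c_{i_1 … i_n}^{j_1 … j_m} ∂_{j_1} ⋯ ∂_{j_m}` with
infinitely many non-zero coefficients, for each `j_1, …, j_m` only finitely many, is a pointwise
limit of finite sums, so allowing such terms before taking the closure gives the same space.) -/
def WeylHat : Set (Module.End K (Series K p)) :=
  {D | ∀ (S : Finset (Series K p)) (N : ℕ), ∃ D' ∈ Weyl K p,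
    ∀ f ∈ S, ∀ m, deg m < N → (D f).1 m = (D' f).1 m}

variable {K} in
/-- `D` is a homogeneous operator of parity `q`. -/
def OpParity (D : Module.End K (Series K p)) (q : ZMod 2) : Prop :=
  ∀ r f, HasParity p f r → HasParity p (D f) (r + q)

variable {K} in
/-- Equality `D^{≤ n} = E^{≤ n}` of the components of degree at most `n`. (The operators `x ^ a`,
`ħ ∂_a`, `ħ` have degree `1`, `1`, `2`; the degree of an operator is the amount by which it raises
the degree of series.) -/
def EqUpToDegree (n : ℕ) (D E : Module.End K (Series K p)) : Prop :=
  ∀ d f, HasDegree p f d → ∀ m, deg m ≤ d + n → (D f).1 m = (E f).1 m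

variable {K} in
/-- All components of `D` have degree at most `n`. -/
def DegreeLE (n : ℕ) (D : Module.End K (Series K p)) : Prop :=
  ∀ d f, HasDegree p f d → ∀ m, (D f).1 m ≠ 0 → deg m ≤ d + n

variable {K} in
/-- The derivation `D ↦ - (1 / ħ) [F, D]`, for even `F`. -/
def derF (F : Series K p) (D : Module.End K (Series K p)) : Module.End K (Series K p) :=
  -(divHbar K p * (mul K p F * D - D * mul K p F))

end Series

section Airy

variable {K : Type*} [Field K] {I : Type*} [LinearOrder I] (p : I → ZMod 2)

/-- The parities of the basis `x ^ a`, `a ∈ {0} ∪ I`, of `K^{0|1} ⊕ V`; here `V` has the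
homogeneous basis `x ^ i` (`i : I`), and the extra index `0`, which is odd, is `⊥ : WithBot I`. -/
def ext (p : I → ZMod 2) : WithBot I → ZMod 2 := WithBot.recBotCoe 1 p

/-- The left ideal of the completed Weyl algebra generated by the image of `L`. -/
def leftIdeal (L : (I → K) →ₗ[K] Module.End K (Series K (ext p))) :
    Submodule K (Module.End K (Series K (ext p))) :=
  Submodule.span K {D | ∃ G ∈ WeylHat K (ext p), ∃ φ, D = G * L φ}

/-- Super quantum Airy structures. The dual of `V` (with basis `x ^ i`, `i : I`) is `I → K`, and
`y_i` is `Pi.single i 1`. -/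
structure IsSuperQuantumAiry (L : (I → K) →ₗ[K] Module.End K (Series K (ext p))) : Prop where
  mem_weylHat : ∀ φ, L φ ∈ WeylHat K (ext p)
  /-- `L` preserves parity. -/
  even : ∀ q φ, (∀ i, φ i ≠ 0 → p i = q) → OpParity (ext p) (L φ) q
  /-- `L` is continuous, for the topologies of pointwise convergence on `V^*` (`K` being discrete)
  and on the completed Weyl algebra. -/
  continuous : ∀ (f : Series K (ext p)) (N : ℕ), ∃ J : Finset I, ∀ φ : I → K,
    (∀ j ∈ J, φ j = 0) → ∀ m, deg m < N → (L φ f).1 m = 0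
  /-- The left ideal generated by the image of `L` is involutive. -/
  involutive : ∀ D ∈ leftIdeal p L, ∀ E ∈ leftIdeal p L, ∀ q r : ZMod 2,
    OpParity (ext p) D q → OpParity (ext p) E r →
      ∃ G ∈ leftIdeal p L, D * E - (-1 : K) ^ (q * r).val • (E * D) =
        mul K (ext p) (hbar K (ext p)) * G
  linear_part : ∀ i, EqUpToDegree (ext p) 1 (L (Pi.single i 1))
    (mul K (ext p) (hbar K (ext p)) * partialD K (ext p) (i : WithBot I))

/-- `L` is of order at most two. -/
def IsQuadratic (L : (I → K) →ₗ[K] Module.End K (Series K (ext p))) : Prop :=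
  ∀ φ, DegreeLE (ext p) 2 (L φ)

/-- `A i a b`, `B i a b`, `C i a b`, `D i` are the coefficients `A_{iab}`, `B_{ia}^b`, `C_i^{ab}`,
`D_i` of `L`, that is, `A` and `C` are graded-symmetric in the last two indices and
`L_i = ħ ∂_i - 1/2 A_{iab} x ^ a x ^ b - ħ B_{ia}^b x ^ a ∂_b - 1/2 ħ² C_i^{ab} ∂_a ∂_b - ħ D_i`,
with (pointwise convergent) sums over `a, b ∈ {0} ∪ I`. -/
structure HasCoefficients (L : (I → K) →ₗ[K] Module.End K (Series K (ext p)))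
    (A B C : I → WithBot I → WithBot I → K) (D : I → K) : Prop where
  symm_A : ∀ i a b, A i a b = (-1) ^ (ext p a * ext p b).val * A i b a
  symm_C : ∀ i a b, C i a b = (-1) ^ (ext p a * ext p b).val * C i b a
  expansion : ∀ (i : I) (f : Series K (ext p)),
    SumsTo (ext p)
      (fun ab : WithBot I × WithBot I =>
        (1 / 2 * A i ab.1 ab.2) •
          (mul K (ext p) (X K (ext p) ab.1) * mul K (ext p) (X K (ext p) ab.2)) f +
        B i ab.1 ab.2 •
          (mul K (ext p) (hbar K (ext p)) *
            mul K (ext p) (X K (ext p) ab.1) * partialD K (ext p) ab.2) f +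
        (1 / 2 * C i ab.1 ab.2) •
          (mul K (ext p) (hbar K (ext p)) * mul K (ext p) (hbar K (ext p)) *
            partialD K (ext p) ab.1 * partialD K (ext p) ab.2) f)
      ((mul K (ext p) (hbar K (ext p)) * partialD K (ext p) (i : WithBot I)) f -
        D i • mul K (ext p) (hbar K (ext p)) f - L (Pi.single i 1) f)

/-- `F` is a free energy associated with `L`: it is an even series without terms that are
independent of the variables `x ^ a` and without terms of degree less than three, and
`ψ_F(L(φ)) · 1 = 0` for all `φ`, where `ψ_F(D) = ∑ₙ (1 / n!) (- (1 / ħ) [F, ·])ⁿ (D)`. -/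
structure IsFreeEnergy (L : (I → K) →ₗ[K] Module.End K (Series K (ext p)))
    (F : Series K (ext p)) : Prop where
  even : HasParity (ext p) F 0
  no_constant : ∀ k, F.1 (k, 0) = 0
  degree_ge : ∀ m, F.1 m ≠ 0 → 3 ≤ deg m
  annihilates : ∀ φ, SumsTo (ext p)
    (fun n : ℕ => (n.factorial : K)⁻¹ • ((derF (ext p) F)^[n] (L φ)) (one K (ext p))) 0

/-- The series `ħ ^ g x ^ {a_1} ⋯ x ^ {a_n}` for the list `l = [a_1, …, a_n]`. -/
def word (g : ℕ) (l : List (WithBot I)) : Series K (ext p) :=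
  (mul K (ext p) (hbar K (ext p)) ^ g)
    (l.foldr (fun a f => mul K (ext p) (X K (ext p) a) f) (one K (ext p)))

/-- Invariance (up to the Koszul sign) under all permutations of the indices; it is enough to
require it for the transpositions of neighbours. -/
def GradedSymmetric (G : ℕ → List (WithBot I) → K) : Prop :=
  ∀ g l a b l', G g (l ++ a :: b :: l') =
    (-1) ^ (ext p a * ext p b).val * G g (l ++ b :: a :: l')

/-- `G g [a_1, …, a_n]` are the coefficients `F_{g,n}[a_1, …, a_n]` (`n ≥ 1`, those for `n = 0`
being zero by convention) of
`F = ∑ ħ ^ g / n! F_{g,n}[a_1, …, a_n] x ^ {a_1} ⋯ x ^ {a_n}`. -/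
structure IsExpansion (F : Series K (ext p)) (G : ℕ → List (WithBot I) → K) : Prop where
  nil : ∀ g, G g [] = 0
  graded_symmetric : GradedSymmetric p G
  expansion : SumsTo (ext p)
    (fun gl : ℕ × List (WithBot I) =>
      ((gl.2.length.factorial : K)⁻¹ * G gl.1 gl.2) • word p gl.1 gl.2) F

/-- The entries of the list `Φ` at the positions in `S`, in the order in which they stand in
`Φ`. -/
def sub (Φ : List (WithBot I)) (S : Finset (Fin Φ.length)) : List (WithBot I) :=
  ((List.finRange Φ.length).filter (· ∈ S)).map Φ.get

/-- The (Koszul) sign `σ_{Φ₁ ⊂ Φ}` of the permutation from `Φ` to `Φ₁ ∪ (Φ \ Φ₁)`, where `Φ₁`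
consists of the entries of `Φ` at the positions in `S`. -/
def sigma (K : Type*) [Field K] (Φ : List (WithBot I)) (S : Finset (Fin Φ.length)) : K :=
  ∏ k ∈ Sᶜ, ∏ l ∈ S, if k < l then (-1) ^ (ext p (Φ.get k) * ext p (Φ.get l)).val else 1

/-- The term `A_{i a_1 a_2} δ_{g,0} δ_{n,2}`. -/
def termA (A : I → WithBot I → WithBot I → K) (i : I) : ℕ → List (WithBot I) → K
  | 0, [a, b] => A i a b
  | _, _ => 0

/-- The term `D_i δ_{g,1} δ_{n,0}`. -/
def termD (D : I → K) (i : I) : ℕ → List (WithBot I) → K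
  | 1, [] => D i
  | _, _ => 0

/-- The term `1/2 ∑_{b,c} C_i^{bc} F_{g-1,n+2}[c, b, Φ]`, which is zero for `g = 0`. -/
def termLoop (C : I → WithBot I → WithBot I → K) (G : ℕ → List (WithBot I) → K) (i : I) :
    ℕ → List (WithBot I) → K
  | 0, _ => 0
  | g + 1, Φ => 1 / 2 * ∑ᶠ bc : WithBot I × WithBot I,
      C i bc.1 bc.2 * G g (bc.2 :: bc.1 :: Φ)

/-- The supersymmetric topological recursion
`F_{g,n+1}[i, Φ] = A_{i a_1 a_2} δ_{g,0} δ_{n,2} + D_i δ_{g,1} δ_{n,0}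
  + ∑_k σ_{a_k ⊂ Φ} ∑_b B_{i a_k}^b F_{g,n}[b, Φ \ a_k]
  + 1/2 ∑_{b,c} C_i^{bc} F_{g-1,n+2}[c, b, Φ]
  + 1/2 ∑_{b,c} ∑_{g₁+g₂=g} ∑_{Φ₁∪Φ₂=Φ} σ_{Φ₁ ⊂ Φ} C_i^{bc} F_{g₁,n₁+1}[b, Φ₁] F_{g₂,n₂+1}[c, Φ₂]`
for `i ∈ I`, `Φ = [a_1, …, a_n]`, `a_k ∈ {0} ∪ I`. -/
def TopologicalRecursion (A B C : I → WithBot I → WithBot I → K) (D : I → K)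
    (G : ℕ → List (WithBot I) → K) : Prop :=
  ∀ (g : ℕ) (i : I) (Φ : List (WithBot I)),
    G g ((i : WithBot I) :: Φ) =
      termA A i g Φ + termD D i g Φ +
      ∑ k : Fin Φ.length, sigma p K Φ {k} *
        ∑ᶠ b : WithBot I, B i (Φ.get k) b * G g (b :: Φ.eraseIdx k) +
      termLoop C G i g Φ +
      1 / 2 * ∑ᶠ bc : WithBot I × WithBot I, ∑ gg ∈ antidiagonal g,
        ∑ S : Finset (Fin Φ.length), sigma p K Φ S * C i bc.1 bc.2 *
          G gg.1 (bc.1 :: sub Φ S) * G gg.2 (bc.2 :: sub Φ Sᶜ)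

/-- The auxiliary equation
`F_{g,n+1}[0, a_1, a_2, …, a_n] = (-1)^{|a_1|} F_{g,n+1}[a_1, 0, a_2, …, a_n]`. -/
def AuxiliaryEquation (G : ℕ → List (WithBot I) → K) : Prop :=
  ∀ (g : ℕ) (a : WithBot I) (Φ : List (WithBot I)),
    G g (⊥ :: a :: Φ) = (-1) ^ (ext p a).val * G g (a :: ⊥ :: Φ)

/-- The normalization that accompanies the recursive system: `F_{g,n} = 0` for `2 g + n < 3`, there
are no terms with `n = 0`, and `F_{g,1}[0] = 0`. -/
structure Normalized (G : ℕ → List (WithBot I) → K) : Prop where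
  nil : ∀ g, G g [] = 0
  unstable : ∀ g l, 2 * g + l.length < 3 → G g l = 0
  extra : ∀ g, G g [⊥] = 0

end Airy

end SuperAiry

end

/-!
The proof compares free energies with families of Taylor coefficients.

For an even series `F` without terms of degree less than three, conjugation `ψ_F` by `exp (F / ħ)`
is multiplicative on the completed Weyl algebra (`psi_mul`). The reason is that
`D ↦ - (1 / ħ) [F, D]` is a derivation there: commutators with `F` are divisible by `ħ`, a property
(`Good`) that holds for the generators and passes to products and to pointwise limits. Since `ψ_F`
fixes multiplication operators and sends `ħ ∂_a` to `ħ ∂_a + ∂_a F`, the equation `ψ_F(L_i) · 1 = 0`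
for the quadratic operator `L_i` becomes the differential equation (`IsFreeEnergy.riccati`)
`∂_i F = 1/2 A_{iab} x ^ a x ^ b + B_{ia}^b x ^ a ∂_b F`
`  + 1/2 C_i^{ab} (ħ ∂_a ∂_b F + ∂_a F ∂_b F) + ħ D_i`.

The coefficient `F_{g,n}[a_1, …, a_n]` is the Taylor coefficient of `ħ ^ g` in
`∂_{a_n} ⋯ ∂_{a_1} F` at `x = 0` (`taylor`); that these coefficients give an expansion is Taylor's
formula, which follows from Euler's identity (`isExpansion_taylor`), and the expansion is unique
because words and graded-symmetric families change by the same sign under permutations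
(`isExpansion_unique`). Taking Taylor coefficients in the differential equation, with the iterated
Leibniz rule for the product `∂_a F ∂_b F`, gives the topological recursion
(`topologicalRecursion_taylor`). The recursion together with the auxiliary equation determines each
coefficient from those with smaller `2 g + n` (`recursion_unique`), so the converse statement and
the uniqueness of the free energy follow.

The free energy is constructed degree by degree. If the series `R_i = ψ_F(L_i) · 1` vanish in
degrees below `d`, then applying `ψ_F` to `[L_i, L_j] ∈ ħ 𝔏` shows that their components in degree
`d` satisfy `∂_i R_j = (-1)^{|i||j|} ∂_j R_i` (`integrability`). By the super Poincaré lemma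
(`exists_primitive`) they are the derivatives `- ∂_i H` of an even homogeneous series `H` of degree
`d + 1`, and `F + H` solves the equations in degree `d` as well; continuity of `L` makes `H` a
finite sum.
-/

noncomputable section

set_option linter.unusedSectionVars false

namespace SuperAiry

open Finset

section Basics

variable {K : Type*} [Field K] {A : Type*} [LinearOrder A] {p : A → ZMod 2}

/-! ### Order of vanishing and continuous operators -/

/-- `f` has no terms of degree less than `N`. -/
def Ord (f : Series K p) (N : ℕ) : Prop := ∀ m, deg m < N → f.1 m = 0

lemma series_ext {f g : Series K p} (h : ∀ m, f.1 m = g.1 m) : f = g :=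
  Subtype.ext (funext h)

@[simp] lemma coe_add (f g : Series K p) (m : Mono A) : (f + g).1 m = f.1 m + g.1 m := rfl
@[simp] lemma coe_sub (f g : Series K p) (m : Mono A) : (f - g).1 m = f.1 m - g.1 m := rfl
@[simp] lemma coe_neg (f : Series K p) (m : Mono A) : (-f).1 m = -f.1 m := rfl
@[simp] lemma coe_smul (c : K) (f : Series K p) (m : Mono A) : (c • f).1 m = c * f.1 m := rfl
@[simp] lemma coe_zero (m : Mono A) : (0 : Series K p).1 m = 0 := rfl

/-- The coefficient of a monomial as a linear functional. -/
def coeff (m : Mono A) : Series K p →ₗ[K] K where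
  toFun f := f.1 m
  map_add' _ _ := rfl
  map_smul' _ _ := rfl

lemma coe_sum {ι : Type*} (s : Finset ι) (t : ι → Series K p) (m : Mono A) :
    (∑ j ∈ s, t j).1 m = ∑ j ∈ s, (t j).1 m :=
  map_sum (coeff m) t s

namespace Ord

lemma zero (N : ℕ) : Ord (0 : Series K p) N := fun _ _ => rfl

lemma mono {f : Series K p} {M N : ℕ} (h : Ord f N) (hMN : M ≤ N) : Ord f M :=
  fun m hm => h m (by omega)

lemma of_zero (f : Series K p) : Ord f 0 := fun m hm => by omega

lemma add {f g : Series K p} {N : ℕ} (hf : Ord f N) (hg : Ord g N) : Ord (f + g) N :=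
  fun m hm => by rw [coe_add, hf m hm, hg m hm, add_zero]

lemma sub {f g : Series K p} {N : ℕ} (hf : Ord f N) (hg : Ord g N) : Ord (f - g) N :=
  fun m hm => by rw [coe_sub, hf m hm, hg m hm, sub_zero]

lemma neg {f : Series K p} {N : ℕ} (hf : Ord f N) : Ord (-f) N :=
  fun m hm => by rw [coe_neg, hf m hm, neg_zero]

lemma smul {f : Series K p} {N : ℕ} (c : K) (hf : Ord f N) : Ord (c • f) N :=
  fun m hm => by rw [coe_smul, hf m hm, mul_zero]

lemma sum {ι : Type*} {s : Finset ι} {t : ι → Series K p} {N : ℕ} (h : ∀ j ∈ s, Ord (t j) N) :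
    Ord (∑ j ∈ s, t j) N :=
  fun m hm => by rw [coe_sum]; exact sum_eq_zero fun j hj => h j hj m hm

lemma eq_zero {f : Series K p} (h : ∀ N, Ord f N) : f = 0 :=
  series_ext fun m => h (deg m + 1) m (by omega)

end Ord

/-- `D` raises the order of vanishing by at least `r`. -/
def Raises (D : Module.End K (Series K p)) (r : ℕ) : Prop := ∀ f N, Ord f N → Ord (D f) (N + r)

/-- `D` lowers the order of vanishing by at most a constant. -/
def Cont (D : Module.End K (Series K p)) : Prop := ∃ c, ∀ f N, Ord f (N + c) → Ord (D f) N

lemma Raises.cont {D : Module.End K (Series K p)} {r : ℕ} (h : Raises D r) : Cont D :=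
  ⟨0, fun f N hf => (h f N hf).mono (by omega)⟩

lemma Raises.of_le {D : Module.End K (Series K p)} {r s : ℕ} (h : Raises D r) (hs : s ≤ r) :
    Raises D s := fun f N hf => (h f N hf).mono (by omega)

lemma Raises.mul {D E : Module.End K (Series K p)} {r s : ℕ} (hD : Raises D r) (hE : Raises E s) :
    Raises (D * E) (r + s) := fun f N hf => (hD _ _ (hE f N hf)).mono (by omega)

lemma Raises.add {D E : Module.End K (Series K p)} {r : ℕ} (hD : Raises D r) (hE : Raises E r) :
    Raises (D + E) r := fun f N hf => (hD f N hf).add (hE f N hf)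

lemma Raises.smul {D : Module.End K (Series K p)} {r : ℕ} (c : K) (hD : Raises D r) :
    Raises (c • D) r := fun f N hf => (hD f N hf).smul c

lemma Raises.one : Raises (1 : Module.End K (Series K p)) 0 := fun _ _ hf => hf

namespace Cont

lemma one : Cont (1 : Module.End K (Series K p)) := Raises.one.cont

lemma mul {D E : Module.End K (Series K p)} (hD : Cont D) (hE : Cont E) : Cont (D * E) := by
  obtain ⟨c, hc⟩ := hD
  obtain ⟨d, hd⟩ := hE
  exact ⟨c + d, fun f N hf => hc _ _ (hd f _ (hf.mono (by omega)))⟩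

lemma add {D E : Module.End K (Series K p)} (hD : Cont D) (hE : Cont E) : Cont (D + E) := by
  obtain ⟨c, hc⟩ := hD
  obtain ⟨d, hd⟩ := hE
  exact ⟨c + d, fun f N hf => (hc _ _ (hf.mono (by omega))).add (hd f _ (hf.mono (by omega)))⟩

lemma smul {D : Module.End K (Series K p)} (a : K) (hD : Cont D) : Cont (a • D) := by
  obtain ⟨c, hc⟩ := hD
  exact ⟨c, fun f N hf => (hc f N hf).smul a⟩

end Cont

/-! ### Monomials -/

open Classical in
/-- The monomial `ħ ^ k x ^ e`, which is zero if an odd variable occurs in it twice. -/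
def mon (K : Type*) [Field K] (p : A → ZMod 2) (k : ℕ) (e : A →₀ ℕ) : Series K p :=
  if h : Admissible p e then SuperAiry.mono K p (k, e) h else 0

lemma mon_of_not {k : ℕ} {e : A →₀ ℕ} (h : ¬ Admissible p e) : mon K p k e = 0 := dif_neg h

open Classical in
lemma coe_mon (k : ℕ) (e : A →₀ ℕ) (m : Mono A) :
    (mon K p k e).1 m = if Admissible p e ∧ m = (k, e) then 1 else 0 := by
  by_cases h : Admissible p e
  · simp [mon, h, SuperAiry.mono, Pi.single_apply]
  · simp [mon, h]

lemma admissible_zero : Admissible p 0 := by intro a _; simp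

lemma admissible_single (a : A) : Admissible p (Finsupp.single a 1) := by
  intro b _
  by_cases h : a = b
  · simp [h]
  · simp [h]

lemma Admissible.of_le {e e' : A →₀ ℕ} (h : Admissible p e) (hle : e' ≤ e) : Admissible p e' :=
  fun a ha => (hle a).trans (h a ha)

lemma one_eq : one K p = mon K p 0 0 := by
  rw [mon, dif_pos admissible_zero]; rfl

lemma hbar_eq : hbar K p = mon K p 1 0 := by
  rw [mon, dif_pos admissible_zero]; rfl

lemma X_eq (a : A) : X K p a = mon K p 0 (Finsupp.single a 1) := by
  rw [mon, dif_pos (admissible_single a)]; rfl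

lemma ord_mon (k : ℕ) (e : A →₀ ℕ) : Ord (mon K p k e) (deg (k, e)) := by
  classical
  intro m hm
  rw [coe_mon, if_neg]
  rintro ⟨-, rfl⟩
  omega

lemma finite_lt (f : Series K p) (N : ℕ) : {m | deg m < N ∧ f.1 m ≠ 0}.Finite := by
  have : {m | deg m < N ∧ f.1 m ≠ 0} ⊆ ⋃ j ∈ Set.Iio N, {m : Mono A | deg m = j ∧ f.1 m ≠ 0} := by
    rintro m ⟨h1, h2⟩
    simp only [Set.mem_iUnion]
    exact ⟨deg m, h1, rfl, h2⟩
  exact ((Set.finite_Iio N).biUnion fun j _ => f.2.2 j).subset this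

/-- The part of `f` of degree less than `N`, as a finite sum of monomials. -/
def trunc (f : Series K p) (N : ℕ) : Series K p :=
  ∑ m ∈ (finite_lt f N).toFinset, f.1 m • mon K p m.1 m.2

lemma ord_sub_trunc (f : Series K p) (N : ℕ) : Ord (f - trunc f N) N := by
  classical
  intro m hm
  rw [coe_sub, trunc, coe_sum, sub_eq_zero]
  by_cases h : f.1 m = 0
  · rw [h]
    symm
    refine sum_eq_zero fun n _ => ?_
    rw [coe_smul, coe_mon]
    split_ifs with hn
    · have : n = m := hn.2.symm
      rw [this, h, zero_mul]
    · rw [mul_zero]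
  · rw [sum_eq_single m]
    · rw [coe_smul, coe_mon, if_pos ⟨f.2.1 m h, rfl⟩, mul_one]
    · intro n _ hn
      rw [coe_smul, coe_mon, if_neg, mul_zero]
      rintro ⟨-, rfl⟩
      exact hn rfl
    · intro hn
      exact absurd ((finite_lt f N).mem_toFinset.2 ⟨hm, h⟩) hn

/-- Continuous operators that agree on monomials are equal. -/
lemma end_ext_mon {D E : Module.End K (Series K p)} (hD : Cont D) (hE : Cont E)
    (h : ∀ k e, Admissible p e → D (mon K p k e) = E (mon K p k e)) : D = E := by
  obtain ⟨c, hc⟩ := hD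
  obtain ⟨d, hd⟩ := hE
  ext1 f
  refine sub_eq_zero.1 (Ord.eq_zero fun N => ?_)
  have h1 : D (trunc f (N + c + d)) = E (trunc f (N + c + d)) := by
    simp only [trunc, map_sum, map_smul]
    refine sum_congr rfl fun m _ => ?_
    by_cases hm : Admissible p m.2
    · rw [h _ _ hm]
    · rw [mon_of_not hm, map_zero, map_zero]
  have h2 : D f - E f = D (f - trunc f (N + c + d)) - E (f - trunc f (N + c + d)) := by
    rw [map_sub, map_sub, h1]; abel
  rw [h2]
  exact (hc _ _ ((ord_sub_trunc f _).mono (by omega))).sub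
    (hd _ _ ((ord_sub_trunc f _).mono (by omega)))

/-! ### The product of monomials -/

variable (p) in
/-- A biadditive version of `crossings`. -/
def cr (e e' : A →₀ ℕ) : ℕ :=
  e.sum fun a n => e'.sum fun b k => if p a = 1 ∧ p b = 1 ∧ b < a then n * k else 0

lemma cr_add_left (e e' e'' : A →₀ ℕ) : cr p (e + e') e'' = cr p e e'' + cr p e' e'' := by
  classical
  refine Finsupp.sum_add_index' (by simp) fun a m n => ?_
  rw [← Finsupp.sum_add]
  refine Finsupp.sum_congr fun b _ => ?_
  split_ifs <;> ring

lemma cr_add_right (e e' e'' : A →₀ ℕ) : cr p e (e' + e'') = cr p e e' + cr p e e'' := by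
  classical
  rw [cr, cr, cr, ← Finsupp.sum_add]
  refine Finsupp.sum_congr fun a _ => ?_
  refine Finsupp.sum_add_index' (by simp) fun b m n => ?_
  split_ifs <;> ring

@[simp] lemma cr_zero_left (e : A →₀ ℕ) : cr p 0 e = 0 := by simp [cr]

@[simp] lemma cr_zero_right (e : A →₀ ℕ) : cr p e 0 = 0 := by simp [cr]

lemma cr_single (a b : A) : cr p (Finsupp.single a 1) (Finsupp.single b 1) =
    if p a = 1 ∧ p b = 1 ∧ b < a then 1 else 0 := by
  simp [cr]

lemma Admissible.eq_one {e : A →₀ ℕ} (he : Admissible p e) {a : A} (ha : p a = 1)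
    (h : a ∈ e.support) : e a = 1 := by
  have := he a ha
  have := Finsupp.mem_support_iff.1 h
  omega

lemma crossings_eq {e e' : A →₀ ℕ} (he : Admissible p e) (he' : Admissible p e') :
    crossings p e e' = cr p e e' := by
  refine sum_congr rfl fun a ha => sum_congr rfl fun b hb => ?_
  dsimp only
  by_cases h : p a = 1 ∧ p b = 1 ∧ b < a
  · rw [if_pos h, if_pos h, he.eq_one h.1 ha, he'.eq_one h.2.1 hb]
  · rw [if_neg h, if_neg h]

lemma oddBefore_eq {a : A} {e : A →₀ ℕ} (he : Admissible p e) :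
    (if p a = 1 then (-1) ^ oddBefore p a e else 1 : K) = (-1) ^ cr p (Finsupp.single a 1) e := by
  rw [← crossings_eq (admissible_single a) he, crossings,
    show (Finsupp.single a 1).support = {a} by ext; simp, sum_singleton]
  split_ifs with h
  · simp only [oddBefore, h, true_and, card_filter]
  · simp [h]

lemma mul_mon_mon (k k' : ℕ) {e e' : A →₀ ℕ} (he : Admissible p e) (he' : Admissible p e') :
    mul K p (mon K p k e) (mon K p k' e') =
      (-1 : K) ^ cr p e e' • mon K p (k + k') (e + e') := by
  classical
  refine series_ext fun m => ?_
  change rawMul K p _ _ m = _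
  rw [coe_smul, coe_mon, rawMul]
  by_cases hm : Admissible p m.2
  · rw [if_pos hm]
    by_cases h : m = (k + k', e + e')
    · subst h
      rw [if_pos ⟨hm, rfl⟩, sum_eq_single (k, k'), sum_eq_single (e, e')]
      · simp [coe_mon, he, he', crossings_eq he he']
      · rintro ⟨b, b'⟩ _ hb
        by_cases h : b = e
        · subst h
          have : b' ≠ e' := fun h => hb (by rw [h])
          simp [coe_mon, this]
        · simp [coe_mon, h]
      · intro h
        simp at h
      · rintro ⟨b, b'⟩ _ hb
        refine sum_eq_zero fun x _ => ?_
        by_cases h : b = k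
        · subst h
          have : b' ≠ k' := fun h => hb (by rw [h])
          simp [coe_mon, this]
        · simp [coe_mon, h]
      · intro h
        simp at h
    · rw [if_neg (fun h' => h h'.2), mul_zero]
      refine sum_eq_zero fun x hx => sum_eq_zero fun y hy => ?_
      by_contra hc
      have h1 : (mon K p k e).1 (x.1, y.1) ≠ 0 := fun h => hc (by rw [h]; ring)
      have h2 : (mon K p k' e').1 (x.2, y.2) ≠ 0 := fun h => hc (by rw [h]; ring)
      simp only [coe_mon, ne_eq, ite_eq_right_iff, one_ne_zero, imp_false, not_not,
        Prod.mk.injEq] at h1 h2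
      apply h
      rw [← h1.2.1, ← h1.2.2, ← h2.2.1, ← h2.2.2, mem_antidiagonal.1 hx, mem_antidiagonal.1 hy]
  · rw [if_neg hm, if_neg, mul_zero]
    rintro ⟨h1, rfl⟩
    exact hm h1

lemma deg_add (m n : Mono A) : deg (m + n) = deg m + deg n := by
  simp only [deg, Prod.fst_add, Prod.snd_add, map_add]
  ring

lemma Ord.mul {f g : Series K p} {M N : ℕ} (hf : Ord f M) (hg : Ord g N) :
    Ord (SuperAiry.mul K p f g) (M + N) := by
  classical
  intro m hm
  change rawMul K p _ _ m = _
  rw [rawMul]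
  split_ifs
  · refine sum_eq_zero fun x hx => sum_eq_zero fun y hy => ?_
    have h : deg m = deg (x.1, y.1) + deg (x.2, y.2) := by
      rw [← deg_add, Prod.mk_add_mk, mem_antidiagonal.1 hx, mem_antidiagonal.1 hy]
    by_cases h1 : deg (x.1, y.1) < M
    · rw [hf _ h1]; ring
    · rw [hg (x.2, y.2) (by omega)]; ring
  · rfl

lemma raises_mul {f : Series K p} {M : ℕ} (hf : Ord f M) : Raises (mul K p f) M :=
  fun g N hg => (hf.mul hg).mono (by omega)

lemma cont_mul (f : Series K p) : Cont (mul K p f) := (raises_mul (Ord.of_zero f)).cont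

lemma cont_mul_flip (g : Series K p) : Cont ((mul K p).flip g) :=
  ⟨0, fun f N hf => (Ord.mul hf (Ord.of_zero g)).mono (by omega)⟩

lemma ord_hbar : Ord (hbar K p) 2 := by
  rw [hbar_eq]; exact (ord_mon 1 0).mono (by simp [deg])

lemma ord_X (a : A) : Ord (X K p a) 1 := by
  rw [X_eq]; exact (ord_mon 0 _).mono (by simp [deg])

lemma Ord.partialD (a : A) {f : Series K p} {N : ℕ} (hf : Ord f N) :
    Ord (partialD K p a f) (N - 1) := by
  intro m hm
  change _ * f.1 _ = 0
  rw [hf, mul_zero]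
  simp only [deg, map_add, Finsupp.degree_single] at hm ⊢
  omega

lemma Ord.divHbar {f : Series K p} {N : ℕ} (hf : Ord f N) : Ord (divHbar K p f) (N - 2) := by
  intro m hm
  change f.1 _ = 0
  rw [hf]
  simp only [deg] at hm ⊢
  omega

lemma cont_partialD (a : A) : Cont (partialD K p a) :=
  ⟨1, fun f N hf => (hf.partialD a).mono (by omega)⟩

lemma cont_divHbar : Cont (divHbar K p) := ⟨2, fun f N hf => hf.divHbar.mono (by omega)⟩

lemma partialD_mon (a : A) (k : ℕ) {e : A →₀ ℕ} (he : Admissible p e) :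
    partialD K p a (mon K p k e) =
      ((-1 : K) ^ cr p (Finsupp.single a 1) e * e a) • mon K p k (e - Finsupp.single a 1) := by
  classical
  refine series_ext fun m => ?_
  change _ * _ * (mon K p k e).1 _ = _
  rw [coe_smul, coe_mon, coe_mon]
  have hadm : Admissible p (e - Finsupp.single a 1) := he.of_le tsub_le_self
  simp only [he, hadm, true_and]
  by_cases hea : e a = 0
  · have h : ¬ (m.1, m.2 + Finsupp.single a 1) = (k, e) := by
      intro h
      have := DFunLike.congr_fun (Prod.mk.inj h).2 a
      simp [hea] at this
    simp [h, hea]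
  · have h1 : Finsupp.single a 1 ≤ e := by
      rw [Finsupp.single_le_iff]; omega
    by_cases h : m = (k, e - Finsupp.single a 1)
    · subst h
      have hc : cr p (Finsupp.single a 1) e =
          cr p (Finsupp.single a 1) (e - Finsupp.single a 1) := by
        conv_lhs => rw [← tsub_add_cancel_of_le h1]
        rw [cr_add_right, cr_single]
        simp
      have h2 : ((e a - 1 : ℕ) : K) + 1 = e a := by
        rw [← Nat.cast_add_one]; congr 1; omega
      rw [oddBefore_eq hadm, hc, tsub_add_cancel_of_le h1, if_pos rfl, if_pos rfl]
      simp [h2]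
    · have h' : ¬ (m.1, m.2 + Finsupp.single a 1) = (k, e) := by
        intro h'
        apply h
        rw [Prod.mk.injEq] at h'
        rw [← h'.1, ← h'.2, add_tsub_cancel_right]
      rw [if_neg h', if_neg h, mul_zero, mul_zero]

/-! ### Relations between the generators -/

lemma hbar_mon (k : ℕ) (e : A →₀ ℕ) :
    mul K p (hbar K p) (mon K p k e) = mon K p (k + 1) e := by
  by_cases he : Admissible p e
  · rw [hbar_eq, mul_mon_mon _ _ admissible_zero he]
    simp [add_comm]
  · rw [mon_of_not he, mon_of_not he, map_zero]

lemma X_mon (a : A) (k : ℕ) (e : A →₀ ℕ) :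
    mul K p (X K p a) (mon K p k e) =
      (-1 : K) ^ cr p (Finsupp.single a 1) e • mon K p k (e + Finsupp.single a 1) := by
  by_cases he : Admissible p e
  · rw [X_eq, mul_mon_mon _ _ (admissible_single a) he, zero_add, add_comm]
  · rw [mon_of_not he, map_zero, mon_of_not (fun h => he (h.of_le le_self_add)), smul_zero]

lemma one_mul_series (f : Series K p) : mul K p (one K p) f = f := by
  have : mul K p (one K p) = 1 := by
    refine end_ext_mon (cont_mul _) Cont.one fun k e he => ?_
    rw [one_eq, mul_mon_mon _ _ admissible_zero he]
    simp
  rw [this]; rfl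

lemma sign_mul_self (n : ℕ) : (-1 : K) ^ n * (-1) ^ n = 1 := by
  rw [← mul_pow]; simp

/-- A property that is preserved by the generators holds for continuous operators. -/
lemma end_ext_gen {D E : Module.End K (Series K p)} (hD : Cont D) (hE : Cont E)
    (h1 : D (one K p) = E (one K p))
    (hh : ∀ f, D f = E f → D (mul K p (hbar K p) f) = E (mul K p (hbar K p) f))
    (hX : ∀ a f, D f = E f → D (mul K p (X K p a) f) = E (mul K p (X K p a) f)) : D = E := by
  refine end_ext_mon hD hE fun k e _ => ?_
  induction k with
  | zero =>
    induction hn : e.degree generalizing e with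
    | zero =>
      rw [Finsupp.degree_eq_zero_iff] at hn
      rwa [hn, ← one_eq]
    | succ n ih =>
      have he : e ≠ 0 := by
        rintro rfl
        simp at hn
      obtain ⟨a, ha⟩ := Finsupp.ne_iff.1 he
      have h2 : Finsupp.single a 1 ≤ e := by
        rw [Finsupp.single_le_iff]
        exact Nat.one_le_iff_ne_zero.2 ha
      set e' := e - Finsupp.single a 1 with he'
      have h3 : e = e' + Finsupp.single a 1 := (tsub_add_cancel_of_le h2).symm
      have h4 : mon K p 0 e = (-1 : K) ^ cr p (Finsupp.single a 1) e' •
          mul K p (X K p a) (mon K p 0 e') := by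
        rw [X_mon, smul_smul, sign_mul_self, one_smul, ← h3]
      have h5 : e'.degree = n := by
        rw [h3] at hn
        simpa using hn
      by_cases hadm : Admissible p e'
      · rw [h4, map_smul, map_smul, hX _ _ (ih e' hadm h5)]
      · rw [mon_of_not (fun h => hadm (h.of_le (h3 ▸ le_self_add))), map_zero, map_zero]
  | succ k ih => rw [← hbar_mon, hh _ ih]

/-- The sign character of `ℤ/2`. -/
def chi (K : Type*) [Field K] (q : ZMod 2) : K := (-1) ^ q.val

lemma chi_eq (q : ZMod 2) : (-1 : K) ^ q.val = chi K q := rfl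

lemma zmod_cases (q : ZMod 2) : q = 0 ∨ q = 1 := by
  revert q; decide

@[simp] lemma chi_zero : chi K 0 = 1 := by simp [chi]

@[simp] lemma chi_one : chi K 1 = -1 := by simp [chi, ZMod.val_one]

lemma chi_add (q r : ZMod 2) : chi K (q + r) = chi K q * chi K r := by
  have h2 : (1 : ZMod 2) + 1 = 0 := by decide
  rcases zmod_cases q with rfl | rfl <;> rcases zmod_cases r with rfl | rfl <;> simp [h2]

lemma chi_mul_self (q : ZMod 2) : chi K q * chi K q = 1 := by
  rcases zmod_cases q with rfl | rfl <;> simp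

lemma sign_single (a b : A) (h : a ≠ b) :
    (-1 : K) ^ cr p (Finsupp.single a 1) (Finsupp.single b 1) = chi K (p a * p b) *
      (-1) ^ cr p (Finsupp.single b 1) (Finsupp.single a 1) := by
  rw [cr_single, cr_single]
  rcases zmod_cases (p a) with ha | ha <;> rcases zmod_cases (p b) with hb | hb
  · simp [ha, hb]
  · simp [ha, hb]
  · simp [ha, hb]
  · rcases lt_or_gt_of_ne h with h | h
    · simp [ha, hb, h, h.not_gt]
    · simp [ha, hb, h, h.not_gt]

lemma hbar_X (a : A) (f : Series K p) : mul K p (hbar K p) (mul K p (X K p a) f) =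
    mul K p (X K p a) (mul K p (hbar K p) f) := by
  refine LinearMap.congr_fun (f := mul K p (hbar K p) * mul K p (X K p a))
    (g := mul K p (X K p a) * mul K p (hbar K p)) ?_ f
  refine end_ext_mon ((cont_mul _).mul (cont_mul _)) ((cont_mul _).mul (cont_mul _))
    fun k e _ => ?_
  simp only [Module.End.mul_apply, X_mon, hbar_mon, map_smul]

lemma X_X (a b : A) (f : Series K p) : mul K p (X K p a) (mul K p (X K p b) f) =
    chi K (p a * p b) • mul K p (X K p b) (mul K p (X K p a) f) := by
  refine LinearMap.congr_fun (f := mul K p (X K p a) * mul K p (X K p b))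
    (g := chi K (p a * p b) • (mul K p (X K p b) * mul K p (X K p a))) ?_ f
  refine end_ext_mon ((cont_mul _).mul (cont_mul _)) (((cont_mul _).mul (cont_mul _)).smul _)
    fun k e _ => ?_
  simp only [Module.End.mul_apply, X_mon, map_smul, LinearMap.smul_apply, smul_smul, cr_add_right,
    pow_add]
  rw [add_right_comm]
  by_cases hab : a = b
  · subst hab
    rcases zmod_cases (p a) with ha | ha
    · simp [ha]
    · rw [mon_of_not, smul_zero, smul_zero]
      intro h
      have := h a ha
      simp at this
  · congr 1
    rw [sign_single a b hab]
    ring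

lemma partialD_one (a : A) : partialD K p a (one K p) = 0 := by
  rw [one_eq, partialD_mon _ _ admissible_zero]
  simp

lemma partialD_hbar (a : A) (f : Series K p) : partialD K p a (mul K p (hbar K p) f) =
    mul K p (hbar K p) (partialD K p a f) := by
  refine LinearMap.congr_fun (f := partialD K p a * mul K p (hbar K p))
    (g := mul K p (hbar K p) * partialD K p a) ?_ f
  refine end_ext_mon ((cont_partialD a).mul (cont_mul _)) ((cont_mul _).mul (cont_partialD a))
    fun k e he => ?_
  simp only [Module.End.mul_apply, hbar_mon, map_smul, partialD_mon _ _ he]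

lemma partialD_X (a b : A) (f : Series K p) : partialD K p a (mul K p (X K p b) f) =
    (if a = b then (1 : K) else 0) • f +
      chi K (p a * p b) • mul K p (X K p b) (partialD K p a f) := by
  refine LinearMap.congr_fun (f := partialD K p a * mul K p (X K p b))
    (g := (if a = b then (1 : K) else 0) • 1 +
      chi K (p a * p b) • (mul K p (X K p b) * partialD K p a)) ?_ f
  refine end_ext_mon ((cont_partialD a).mul (cont_mul _))
    ((Cont.one.smul _).add (((cont_mul _).mul (cont_partialD a)).smul _)) fun k e he => ?_
  simp only [Module.End.mul_apply, LinearMap.add_apply, LinearMap.smul_apply, Module.End.one_apply,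
    partialD_mon _ _ he, X_mon, map_smul, smul_smul]
  by_cases hab : a = b
  · subst hab
    rw [if_pos rfl, one_smul]
    by_cases hea : e a = 0
    · have hadm : Admissible p (e + Finsupp.single a 1) := by
        intro b hb
        by_cases h : a = b
        · subst h; simp [hea]
        · simpa [h] using he b hb
      rw [partialD_mon _ _ hadm, smul_smul, cr_add_right, cr_single]
      simp only [lt_irrefl, and_false, if_false, add_zero, Finsupp.add_apply, hea,
        Finsupp.single_eq_same, Nat.cast_zero, mul_zero, zero_mul, zero_smul,
        add_tsub_cancel_right, zero_add, Nat.cast_one, mul_one, sign_mul_self, one_smul]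
    · have h1 : Finsupp.single a 1 ≤ e := by
        rw [Finsupp.single_le_iff]; omega
      have hc : cr p (Finsupp.single a 1) e =
          cr p (Finsupp.single a 1) (e - Finsupp.single a 1) := by
        conv_lhs => rw [← tsub_add_cancel_of_le h1]
        rw [cr_add_right, cr_single]
        simp
      rw [tsub_add_cancel_of_le h1, ← hc]
      rcases zmod_cases (p a) with ha | ha
      · have hadm : Admissible p (e + Finsupp.single a 1) := by
          intro b hb
          by_cases h : a = b
          · subst h; rw [ha] at hb; exact absurd hb (by decide)
          · simpa [h] using he b hb
        rw [partialD_mon _ _ hadm, smul_smul, cr_add_right, cr_single, ← mul_assoc]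
        simp only [lt_irrefl, and_false, if_false, add_zero, Finsupp.add_apply,
          Finsupp.single_eq_same, add_tsub_cancel_right, sign_mul_self, ha, zero_mul, chi_zero,
          one_mul, Nat.cast_add, Nat.cast_one, mul_assoc]
        rw [mul_comm ((e a : ℕ) : K), ← mul_assoc, sign_mul_self, one_mul, add_smul, one_smul,
          add_comm]
      · have h2 : e a = 1 := he.eq_one ha (Finsupp.mem_support_iff.2 hea)
        rw [mon_of_not, map_zero, smul_zero, ha, h2]
        · simp [sign_mul_self]
        · intro h
          have := h a ha
          simp [h2] at this
  · rw [if_neg hab, zero_smul, zero_add]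
    by_cases hea : e a = 0
    · by_cases hadm : Admissible p (e + Finsupp.single b 1)
      · rw [partialD_mon _ _ hadm]
        simp [hea, Ne.symm hab]
      · rw [mon_of_not hadm]
        simp [hea]
    · have h1 : Finsupp.single a 1 ≤ e := by
        rw [Finsupp.single_le_iff]; omega
      have h2 : e - Finsupp.single a 1 + Finsupp.single b 1 =
          e + Finsupp.single b 1 - Finsupp.single a 1 := tsub_add_eq_add_tsub h1
      have hc : cr p (Finsupp.single b 1) e =
          cr p (Finsupp.single b 1) (e - Finsupp.single a 1) +
            cr p (Finsupp.single b 1) (Finsupp.single a 1) := by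
        conv_lhs => rw [← tsub_add_cancel_of_le h1]
        rw [cr_add_right]
      by_cases hadm : Admissible p (e + Finsupp.single b 1)
      · rw [partialD_mon _ _ hadm, smul_smul, h2]
        congr 1
        rw [hc, cr_add_right, pow_add, pow_add, sign_single a b hab]
        have := sign_mul_self (K := K) (cr p (Finsupp.single b 1) (Finsupp.single a 1))
        simp only [Finsupp.add_apply, Finsupp.single_eq_of_ne hab, add_zero]
        linear_combination (norm := ring) ((-1) ^ cr p (Finsupp.single b 1)
          (e - Finsupp.single a 1)) * chi K (p a * p b) *
          ((-1) ^ cr p (Finsupp.single a 1) e) * (e a : K) * this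
      · rw [mon_of_not hadm, map_zero, smul_zero, mon_of_not, smul_zero]
        intro h
        apply hadm
        intro c hc
        have := h c hc
        by_cases hac : a = c
        · subst hac
          have := he a hc
          simp [hab]
          omega
        · simpa [hac] using this

lemma partialD_partialD (a b : A) (f : Series K p) : partialD K p a (partialD K p b f) =
    chi K (p a * p b) • partialD K p b (partialD K p a f) := by
  refine LinearMap.congr_fun (f := partialD K p a * partialD K p b)
    (g := chi K (p a * p b) • (partialD K p b * partialD K p a)) ?_ f
  refine end_ext_gen ((cont_partialD a).mul (cont_partialD b))
    (((cont_partialD b).mul (cont_partialD a)).smul _) ?_ ?_ ?_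
  · simp [partialD_one]
  · intro f hf
    simp only [Module.End.mul_apply, LinearMap.smul_apply, partialD_hbar] at hf ⊢
    rw [hf, map_smul]
  · intro c f hf
    simp only [Module.End.mul_apply, LinearMap.smul_apply, partialD_X, map_add, map_smul] at hf ⊢
    rw [hf, map_smul]
    by_cases h1 : a = c <;> by_cases h2 : b = c
    · subst h1; subst h2
      rcases zmod_cases (p b) with h | h
      · simp [h]
      · simp only [h, mul_one, chi_one, if_true]
        module
    · subst h1
      simp only [smul_add, smul_smul, h2, if_false, if_true, zero_smul, one_smul, zero_add,
        mul_comm (p b) (p a)]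
    · subst h2
      simp only [smul_add, smul_smul, h1, if_false, if_true, zero_smul, one_smul, zero_add,
        chi_mul_self]
      congr 2
      linear_combination (-chi K (p b * p b)) * chi_mul_self (K := K) (p a * p b)
    · simp only [h1, h2, if_false, zero_smul, zero_add, smul_smul]
      congr 1
      ring

end Basics

section Algebra

variable {K : Type*} [Field K] {A : Type*} [LinearOrder A] {p : A → ZMod 2}

/-! ### Associativity, supercommutativity and the Leibniz rule -/

lemma X_mul (a : A) (f g : Series K p) : mul K p (mul K p (X K p a) f) g =
    mul K p (X K p a) (mul K p f g) := by
  have key : ∀ k e, Admissible p e → ∀ g, mul K p (mul K p (X K p a) (mon K p k e)) g =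
      mul K p (X K p a) (mul K p (mon K p k e) g) := by
    intro k e he g
    refine LinearMap.congr_fun (f := mul K p (mul K p (X K p a) (mon K p k e)))
      (g := mul K p (X K p a) * mul K p (mon K p k e)) ?_ g
    refine end_ext_mon (cont_mul _) ((cont_mul _).mul (cont_mul _)) fun k' e' he' => ?_
    rw [Module.End.mul_apply, mul_mon_mon _ _ he he', X_mon, map_smul, map_smul,
      LinearMap.smul_apply, X_mon, smul_smul]
    by_cases h : Admissible p (e + Finsupp.single a 1)
    · rw [mul_mon_mon _ _ h he', smul_smul, add_right_comm]
      congr 1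
      rw [cr_add_left, cr_add_right]
      ring
    · rw [mon_of_not h, map_zero, LinearMap.zero_apply, smul_zero, mon_of_not, smul_zero]
      intro h'
      rw [add_right_comm] at h'
      exact h (h'.of_le le_self_add)
  refine LinearMap.congr_fun (f := (mul K p).flip g * mul K p (X K p a))
    (g := mul K p (X K p a) * (mul K p).flip g) ?_ f
  exact end_ext_mon ((cont_mul_flip g).mul (cont_mul _)) ((cont_mul _).mul (cont_mul_flip g))
    fun k e he => key k e he g

lemma hbar_mul (f g : Series K p) : mul K p (mul K p (hbar K p) f) g =
    mul K p (hbar K p) (mul K p f g) := by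
  have key : ∀ k e, Admissible p e → ∀ g, mul K p (mul K p (hbar K p) (mon K p k e)) g =
      mul K p (hbar K p) (mul K p (mon K p k e) g) := by
    intro k e he g
    refine LinearMap.congr_fun (f := mul K p (mul K p (hbar K p) (mon K p k e)))
      (g := mul K p (hbar K p) * mul K p (mon K p k e)) ?_ g
    refine end_ext_mon (cont_mul _) ((cont_mul _).mul (cont_mul _)) fun k' e' he' => ?_
    rw [Module.End.mul_apply, mul_mon_mon _ _ he he', hbar_mon, map_smul, hbar_mon,
      mul_mon_mon _ _ he he', add_right_comm]
  refine LinearMap.congr_fun (f := (mul K p).flip g * mul K p (hbar K p))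
    (g := mul K p (hbar K p) * (mul K p).flip g) ?_ f
  exact end_ext_mon ((cont_mul_flip g).mul (cont_mul _)) ((cont_mul _).mul (cont_mul_flip g))
    fun k e he => key k e he g

lemma mul_hbar (f g : Series K p) : mul K p f (mul K p (hbar K p) g) =
    mul K p (hbar K p) (mul K p f g) := by
  refine LinearMap.congr_fun (f := mul K p f * mul K p (hbar K p))
    (g := mul K p (hbar K p) * mul K p f) ?_ g
  refine end_ext_mon ((cont_mul _).mul (cont_mul _)) ((cont_mul _).mul (cont_mul _))
    fun k' e' he' => ?_
  rw [Module.End.mul_apply, Module.End.mul_apply, hbar_mon]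
  refine LinearMap.congr_fun (f := (mul K p).flip (mon K p (k' + 1) e'))
    (g := mul K p (hbar K p) * (mul K p).flip (mon K p k' e')) ?_ f
  refine end_ext_mon (cont_mul_flip _) ((cont_mul _).mul (cont_mul_flip _)) fun k e he => ?_
  simp only [Module.End.mul_apply, LinearMap.flip_apply, mul_mon_mon _ _ he he', map_smul,
    hbar_mon, add_assoc]

lemma monoParity_add (e e' : A →₀ ℕ) :
    monoParity p (e + e') = monoParity p e + monoParity p e' := by
  classical
  exact Finsupp.sum_add_index' (by simp) fun a m n => by rw [add_smul]

@[simp] lemma monoParity_zero : monoParity p 0 = 0 := by simp [monoParity]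

@[simp] lemma monoParity_single (a : A) : monoParity p (Finsupp.single a 1) = p a := by
  simp [monoParity]

/-- The automorphism of `K[[V, ħ]]` that multiplies the elements of parity `r` by
`(-1) ^ (q * r)`: the sign that arises when an operator of parity `q` is moved past `f`. -/
def tau (K : Type*) [Field K] (p : A → ZMod 2) (q : ZMod 2) : Module.End K (Series K p) where
  toFun f := ⟨fun m => chi K (q * monoParity p m.2) * f.1 m,
    fun m h => f.2.1 m (right_ne_zero_of_mul h),
    fun d => (f.2.2 d).subset fun _ h => ⟨h.1, right_ne_zero_of_mul h.2⟩⟩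
  map_add' f g := series_ext fun m => mul_add _ _ _
  map_smul' c f := series_ext fun m => by
    simp only [coe_smul, RingHom.id_apply]
    ring

lemma coe_tau (q : ZMod 2) (f : Series K p) (m : Mono A) :
    (tau K p q f).1 m = chi K (q * monoParity p m.2) * f.1 m := rfl

lemma raises_tau (q : ZMod 2) : Raises (tau K p q) 0 := fun f N hf m hm => by
  rw [coe_tau, hf m hm, mul_zero]

lemma tau_mon (q : ZMod 2) (k : ℕ) (e : A →₀ ℕ) :
    tau K p q (mon K p k e) = chi K (q * monoParity p e) • mon K p k e := by
  classical
  refine series_ext fun m => ?_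
  rw [coe_tau, coe_smul, coe_mon]
  split_ifs with h
  · rw [h.2]
  · simp

lemma tau_of_parity {q r : ZMod 2} {f : Series K p} (hf : HasParity p f r) :
    tau K p q f = chi K (q * r) • f := by
  refine series_ext fun m => ?_
  rw [coe_tau, coe_smul]
  by_cases h : f.1 m = 0
  · rw [h, mul_zero, mul_zero]
  · rw [hf m h]

lemma tau_of_even {q : ZMod 2} {f : Series K p} (hf : HasParity p f 0) : tau K p q f = f := by
  rw [tau_of_parity hf, mul_zero, chi_zero, one_smul]

lemma tau_one (q : ZMod 2) : tau K p q (one K p) = one K p := by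
  rw [one_eq, tau_mon]; simp

lemma tau_hbar (q : ZMod 2) (f : Series K p) : tau K p q (mul K p (hbar K p) f) =
    mul K p (hbar K p) (tau K p q f) := by
  refine LinearMap.congr_fun (f := tau K p q * mul K p (hbar K p))
    (g := mul K p (hbar K p) * tau K p q) ?_ f
  refine end_ext_mon ((raises_tau q).cont.mul (cont_mul _)) ((cont_mul _).mul (raises_tau q).cont)
    fun k e he => ?_
  simp only [Module.End.mul_apply, hbar_mon, tau_mon, map_smul]

lemma tau_X (q : ZMod 2) (a : A) (f : Series K p) : tau K p q (mul K p (X K p a) f) =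
    chi K (q * p a) • mul K p (X K p a) (tau K p q f) := by
  refine LinearMap.congr_fun (f := tau K p q * mul K p (X K p a))
    (g := chi K (q * p a) • (mul K p (X K p a) * tau K p q)) ?_ f
  refine end_ext_mon ((raises_tau q).cont.mul (cont_mul _))
    (((cont_mul _).mul (raises_tau q).cont).smul _) fun k e he => ?_
  simp only [Module.End.mul_apply, X_mon, tau_mon, map_smul, LinearMap.smul_apply, smul_smul,
    monoParity_add, monoParity_single, mul_add, chi_add]
  congr 1
  ring

/-- Supercommutativity. -/
lemma mul_X (a : A) (f g : Series K p) : mul K p f (mul K p (X K p a) g) =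
    mul K p (X K p a) (mul K p (tau K p (p a) f) g) := by
  refine LinearMap.congr_fun (f := (mul K p).flip (mul K p (X K p a) g))
    (g := mul K p (X K p a) * ((mul K p).flip g * tau K p (p a))) ?_ f
  refine end_ext_gen (cont_mul_flip _)
    ((cont_mul _).mul ((cont_mul_flip _).mul (raises_tau _).cont)) ?_ ?_ ?_
  · simp [one_mul_series, tau_one]
  · intro f hf
    simp only [Module.End.mul_apply, LinearMap.flip_apply, hbar_mul, tau_hbar] at hf ⊢
    rw [hf, hbar_X]
  · intro b f hf
    simp only [Module.End.mul_apply, LinearMap.flip_apply, X_mul, tau_X, map_smul] at hf ⊢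
    rw [hf, X_X, mul_comm (p b)]

/-- Even series are central. -/
lemma mul_comm_of_even {F : Series K p} (hF : HasParity p F 0) (f g : Series K p) :
    mul K p F (mul K p f g) = mul K p f (mul K p F g) := by
  refine LinearMap.congr_fun (f := mul K p F * (mul K p).flip g)
    (g := (mul K p).flip (mul K p F g)) ?_ f
  refine end_ext_gen ((cont_mul _).mul (cont_mul_flip _)) (cont_mul_flip _) ?_ ?_ ?_
  · simp [one_mul_series]
  · intro f hf
    simp only [Module.End.mul_apply, LinearMap.flip_apply, hbar_mul, mul_hbar] at hf ⊢
    rw [hf]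
  · intro b f hf
    simp only [Module.End.mul_apply, LinearMap.flip_apply, X_mul, mul_X] at hf ⊢
    rw [tau_of_even hF, hf]

lemma mul_one_series (f : Series K p) : mul K p f (one K p) = f := by
  refine LinearMap.congr_fun (f := (mul K p).flip (one K p)) (g := 1) ?_ f
  refine end_ext_gen (cont_mul_flip _) Cont.one ?_ ?_ ?_
  · simp [one_mul_series]
  · intro f hf
    simp only [Module.End.one_apply, LinearMap.flip_apply, hbar_mul] at hf ⊢
    rw [hf]
  · intro b f hf
    simp only [Module.End.one_apply, LinearMap.flip_apply, X_mul] at hf ⊢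
    rw [hf]

/-- The super Leibniz rule. -/
lemma partialD_mul (a : A) (f g : Series K p) : partialD K p a (mul K p f g) =
    mul K p (partialD K p a f) g + mul K p (tau K p (p a) f) (partialD K p a g) := by
  refine LinearMap.congr_fun (f := partialD K p a * (mul K p).flip g)
    (g := (mul K p).flip g * partialD K p a +
      (mul K p).flip (partialD K p a g) * tau K p (p a)) ?_ f
  refine end_ext_gen ((cont_partialD a).mul (cont_mul_flip _))
    (((cont_mul_flip _).mul (cont_partialD a)).add
      ((cont_mul_flip _).mul (raises_tau _).cont)) ?_ ?_ ?_
  · simp [one_mul_series, partialD_one, tau_one]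
  · intro f hf
    simp only [Module.End.mul_apply, LinearMap.add_apply, LinearMap.flip_apply, hbar_mul,
      partialD_hbar, tau_hbar] at hf ⊢
    rw [hf, map_add]
  · intro b f hf
    simp only [Module.End.mul_apply, LinearMap.add_apply, LinearMap.flip_apply, X_mul,
      partialD_X, tau_X, map_add, map_smul] at hf ⊢
    rw [hf, map_add, smul_add, add_assoc]

lemma divHbar_hbar (f : Series K p) : divHbar K p (mul K p (hbar K p) f) = f := by
  refine LinearMap.congr_fun (f := divHbar K p * mul K p (hbar K p)) (g := 1) ?_ f
  refine end_ext_mon (cont_divHbar.mul (cont_mul _)) Cont.one fun k e he => ?_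
  classical
  rw [Module.End.mul_apply, hbar_mon]
  refine series_ext fun m => ?_
  change (mon K p (k + 1) e).1 (m.1 + 1, m.2) = (mon K p k e).1 m
  rw [coe_mon, coe_mon]
  congr 1
  simp [Prod.ext_iff]

lemma coe_hbar_mul (f : Series K p) (m : Mono A) : (mul K p (hbar K p) f).1 m =
    if m.1 = 0 then 0 else f.1 (m.1 - 1, m.2) := by
  classical
  change rawMul K p _ _ m = _
  rw [rawMul]
  by_cases hadm : Admissible p m.2
  · rw [if_pos hadm]
    have h0 : ∀ x ∈ antidiagonal m.1, ∀ e ∈ antidiagonal m.2, ¬ (x = (1, m.1 - 1) ∧ e = (0, m.2)) →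
        (-1) ^ crossings p e.1 e.2 * (hbar K p).1 (x.1, e.1) * f.1 (x.2, e.2) = 0 := by
      intro x hx e he h
      rw [hbar_eq, coe_mon, if_neg, mul_zero, zero_mul]
      rintro ⟨-, h'⟩
      rw [Prod.mk.injEq] at h'
      apply h
      rw [HasAntidiagonal.mem_antidiagonal] at hx he
      refine ⟨Prod.ext h'.1 ?_, Prod.ext h'.2 ?_⟩
      · simp only; omega
      · simpa [h'.2] using he
    split_ifs with hm
    · refine sum_eq_zero fun x hx => sum_eq_zero fun e he => h0 x hx e he ?_
      rintro ⟨rfl, -⟩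
      rw [HasAntidiagonal.mem_antidiagonal] at hx
      simp only at hx
      omega
    · rw [sum_eq_single (1, m.1 - 1), sum_eq_single (0, m.2)]
      · rw [hbar_eq, coe_mon, if_pos ⟨admissible_zero, rfl⟩]
        simp [crossings]
      · intro e he h
        exact h0 _ (by rw [HasAntidiagonal.mem_antidiagonal]; simp only; omega) e he
          fun h' => h h'.2
      · intro h
        simp at h
      · intro x hx h
        exact sum_eq_zero fun e he => h0 x hx e he fun h' => h h'.1
      · intro h
        rw [HasAntidiagonal.mem_antidiagonal] at h
        simp only at h
        omega
  · rw [if_neg hadm]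
    split_ifs
    · rfl
    · by_contra h
      exact hadm (f.2.1 (m.1 - 1, m.2) (Ne.symm h))

/-! ### Parity -/

namespace HasParity

lemma zero (q : ZMod 2) : HasParity p (0 : Series K p) q := fun _ hm => absurd rfl hm

lemma add {f g : Series K p} {q : ZMod 2} (hf : HasParity p f q) (hg : HasParity p g q) :
    HasParity p (f + g) q := fun m hm => by
  by_cases h : f.1 m = 0
  · exact hg m fun h' => hm (by rw [coe_add, h, h', add_zero])
  · exact hf m h

lemma smul {f : Series K p} {q : ZMod 2} (c : K) (hf : HasParity p f q) :
    HasParity p (c • f) q := fun m hm => hf m (right_ne_zero_of_mul hm)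

lemma neg {f : Series K p} {q : ZMod 2} (hf : HasParity p f q) :
    HasParity p (-f) q := fun m hm => hf m (neg_ne_zero.1 hm)

lemma sub {f g : Series K p} {q : ZMod 2} (hf : HasParity p f q) (hg : HasParity p g q) :
    HasParity p (f - g) q := by
  rw [sub_eq_add_neg]; exact hf.add hg.neg

lemma sum {ι : Type*} {s : Finset ι} {t : ι → Series K p} {q : ZMod 2}
    (h : ∀ j ∈ s, HasParity p (t j) q) : HasParity p (∑ j ∈ s, t j) q := fun m hm => by
  rw [coe_sum] at hm
  obtain ⟨j, hj, hne⟩ := exists_ne_zero_of_sum_ne_zero hm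
  exact h j hj m hne

lemma mul {f g : Series K p} {q r : ZMod 2} (hf : HasParity p f q) (hg : HasParity p g r) :
    HasParity p (SuperAiry.mul K p f g) (q + r) := fun m hm => by
  classical
  change rawMul K p _ _ m ≠ 0 at hm
  rw [rawMul] at hm
  split_ifs at hm with h
  · obtain ⟨x, hx, hm⟩ := exists_ne_zero_of_sum_ne_zero hm
    obtain ⟨e, he, hm⟩ := exists_ne_zero_of_sum_ne_zero hm
    rw [← HasAntidiagonal.mem_antidiagonal.1 he, monoParity_add, hf _ (right_ne_zero_of_mul
      (left_ne_zero_of_mul hm)), hg _ (right_ne_zero_of_mul hm)]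
  · exact absurd rfl hm

lemma divHbar {f : Series K p} {q : ZMod 2} (hf : HasParity p f q) :
    HasParity p (divHbar K p f) q := fun m hm => hf (m.1 + 1, m.2) hm

end HasParity

lemma hasParity_mon (k : ℕ) (e : A →₀ ℕ) : HasParity p (mon K p k e) (monoParity p e) := by
  classical
  intro m hm
  simp only [coe_mon, ne_eq, ite_eq_right_iff, one_ne_zero, imp_false, not_not] at hm
  rw [hm.2]

lemma hasParity_one : HasParity p (one K p) 0 := by
  rw [one_eq]; simpa using hasParity_mon (K := K) (p := p) 0 0

lemma hasParity_X (a : A) : HasParity p (X K p a) (p a) := by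
  rw [X_eq]; simpa using hasParity_mon (K := K) (p := p) 0 (Finsupp.single a 1)

/-! ### Unconditional sums -/

namespace SumsTo

variable {ι : Type*} {t u : ι → Series K p} {s v : Series K p}

lemma unique (h : SumsTo p t s) (h' : SumsTo p t v) : s = v := by
  classical
  refine series_ext fun m => ?_
  obtain ⟨J, hJ⟩ := h (deg m + 1)
  obtain ⟨J', hJ'⟩ := h' (deg m + 1)
  rw [← hJ (J ∪ J') subset_union_left m (by omega), hJ' (J ∪ J') subset_union_right m (by omega)]

lemma add (h : SumsTo p t s) (h' : SumsTo p u v) : SumsTo p (fun j => t j + u j) (s + v) := by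
  classical
  intro N
  obtain ⟨J, hJ⟩ := h N
  obtain ⟨J', hJ'⟩ := h' N
  refine ⟨J ∪ J', fun J'' hs m hm => ?_⟩
  rw [sum_add_distrib, coe_add, hJ _ (subset_union_left.trans hs) m hm,
    hJ' _ (subset_union_right.trans hs) m hm, coe_add]

lemma map {D : Module.End K (Series K p)} (hD : Cont D) (h : SumsTo p t s) :
    SumsTo p (fun j => D (t j)) (D s) := by
  obtain ⟨c, hc⟩ := hD
  intro N
  obtain ⟨J, hJ⟩ := h (N + c)
  refine ⟨J, fun J' hs m hm => ?_⟩
  rw [← map_sum, ← sub_eq_zero, ← coe_sub, ← map_sub]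
  refine hc _ N (fun n hn => ?_) m hm
  rw [coe_sub, hJ J' hs n hn, sub_self]

lemma sub (h : SumsTo p t s) (h' : SumsTo p u v) : SumsTo p (fun j => t j - u j) (s - v) := by
  have := h.add (h'.map (D := (-1 : K) • 1) (Cont.one.smul _))
  simpa [sub_eq_add_neg] using this

lemma neg (h : SumsTo p t s) : SumsTo p (fun j => - t j) (- s) := by
  have := h.map (D := (-1 : K) • 1) (Cont.one.smul _)
  simpa using this

lemma ord {N : ℕ} (h : SumsTo p t s) (ht : ∀ j, Ord (t j) N) : Ord s N := by
  intro m hm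
  obtain ⟨J, hJ⟩ := h N
  rw [← hJ J subset_rfl m hm]
  exact Ord.sum (fun j _ => ht j) m hm

/-- A linear functional that is continuous for the adic topology may be applied termwise. -/
lemma map_functional {l : Series K p →ₗ[K] K} {N : ℕ} (hl : ∀ f, Ord f N → l f = 0)
    (h : SumsTo p t s) (hfin : (Function.support fun j => l (t j)).Finite) :
    l s = ∑ᶠ j, l (t j) := by
  classical
  obtain ⟨J, hJ⟩ := h N
  have h1 : l s = l (∑ j ∈ J ∪ hfin.toFinset, t j) := by
    rw [← sub_eq_zero, ← map_sub]
    refine hl _ fun m hm => ?_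
    rw [coe_sub, hJ _ subset_union_left m hm, sub_self]
  rw [h1, map_sum, finsum_eq_sum_of_support_subset _ (s := J ∪ hfin.toFinset)]
  intro j hj
  simp only [coe_union, Set.Finite.coe_toFinset]
  exact Or.inr hj

end SumsTo

end Algebra

section Conjugation

variable {K : Type*} [Field K] {A : Type*} [LinearOrder A] {p : A → ZMod 2}

/-! ### The derivation `- (1 / ħ) [F, ·]` -/

lemma derF_apply (F : Series K p) (D : Module.End K (Series K p)) (f : Series K p) :
    derF p F D f = -divHbar K p (mul K p F (D f) - D (mul K p F f)) := rfl

/-- `derF` as a linear map. -/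
def derLin (F : Series K p) : Module.End K (Module.End K (Series K p)) where
  toFun D := derF p F D
  map_add' D E := by
    ext1 f
    simp only [derF_apply, LinearMap.add_apply, map_add, map_sub]
    abel
  map_smul' c D := by
    ext1 f
    simp only [derF_apply, LinearMap.smul_apply, map_smul, map_sub, RingHom.id_apply, smul_sub,
      smul_neg]

lemma derLin_apply (F : Series K p) (D : Module.End K (Series K p)) :
    derLin F D = derF p F D := rfl

lemma derF_sub (F : Series K p) (D E : Module.End K (Series K p)) :
    derF p F (D - E) = derF p F D - derF p F E := map_sub (derLin F) D E

lemma derLin_pow_apply (F : Series K p) (n : ℕ) (D : Module.End K (Series K p)) :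
    (derLin F ^ n) D = (derF p F)^[n] D := by
  rw [Module.End.pow_apply]; rfl

lemma derLin_pow_succ (F : Series K p) (n : ℕ) (D : Module.End K (Series K p)) :
    (derLin F ^ (n + 1)) D = derF p F ((derLin F ^ n) D) := by
  rw [pow_succ']; rfl

lemma Raises.derF {F : Series K p} (hF : Ord F 3) {D : Module.End K (Series K p)} {r : ℕ}
    (hD : Raises D r) : Raises (derF p F D) (r + 1) := by
  intro f N hf
  rw [derF_apply]
  refine (Ord.divHbar (N := N + r + 3) (Ord.sub ?_ ?_)).neg.mono (by omega)
  · exact (hF.mul (hD f N hf)).mono (by omega)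
  · exact (hD _ _ (hF.mul hf)).mono (by omega)

lemma Raises.derLin_pow {F : Series K p} (hF : Ord F 3) {D : Module.End K (Series K p)} {r : ℕ}
    (hD : Raises D r) (n : ℕ) : Raises ((derLin F ^ n) D) (r + n) := by
  induction n with
  | zero => exact hD
  | succ n ih => rw [derLin_pow_succ]; exact ih.derF hF

/-- The operator `D` commutes with `ħ`, does not lower degrees, and the analogue holds for its
first `n` iterated commutators with `F`, each of which is required to be divisible by `ħ`. -/
def Good (F : Series K p) : ℕ → Module.End K (Series K p) → Prop
  | 0, D => (∀ f, D (mul K p (hbar K p) f) = mul K p (hbar K p) (D f)) ∧ Raises D 0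
  | n + 1, D => ((∀ f, D (mul K p (hbar K p) f) = mul K p (hbar K p) (D f)) ∧ Raises D 0) ∧
      (∀ f, mul K p (hbar K p) (derF p F D f) = -(mul K p F (D f) - D (mul K p F f))) ∧
      Good F n (derF p F D)

namespace Good

variable {F : Series K p}

lemma base {n : ℕ} {D : Module.End K (Series K p)} (h : Good F n D) :
    (∀ f, D (mul K p (hbar K p) f) = mul K p (hbar K p) (D f)) ∧ Raises D 0 := by
  cases n with
  | zero => exact h
  | succ n => exact h.1

lemma pred {n : ℕ} {D : Module.End K (Series K p)} (h : Good F (n + 1) D) : Good F n D := by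
  induction n generalizing D with
  | zero => exact h.1
  | succ n ih => exact ⟨h.1, h.2.1, ih h.2.2⟩

lemma add {n : ℕ} {D E : Module.End K (Series K p)} (hD : Good F n D) (hE : Good F n E) :
    Good F n (D + E) := by
  induction n generalizing D E with
  | zero =>
    refine ⟨fun f => ?_, hD.2.add hE.2⟩
    rw [LinearMap.add_apply, LinearMap.add_apply, hD.1, hE.1, map_add]
  | succ n ih =>
    refine ⟨⟨fun f => ?_, hD.1.2.add hE.1.2⟩, fun f => ?_, ?_⟩
    · rw [LinearMap.add_apply, LinearMap.add_apply, hD.1.1, hE.1.1, map_add]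
    · rw [← derLin_apply, map_add, LinearMap.add_apply, map_add, derLin_apply, derLin_apply,
        hD.2.1, hE.2.1]
      simp only [LinearMap.add_apply, map_add]
      abel
    · rw [← derLin_apply, map_add]
      exact ih hD.2.2 hE.2.2

lemma smul {n : ℕ} {D : Module.End K (Series K p)} (c : K) (hD : Good F n D) :
    Good F n (c • D) := by
  induction n generalizing D with
  | zero =>
    refine ⟨fun f => ?_, hD.2.smul c⟩
    rw [LinearMap.smul_apply, LinearMap.smul_apply, hD.1, map_smul]
  | succ n ih =>
    refine ⟨⟨fun f => ?_, hD.1.2.smul c⟩, fun f => ?_, ?_⟩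
    · rw [LinearMap.smul_apply, LinearMap.smul_apply, hD.1.1, map_smul]
    · rw [← derLin_apply, map_smul, LinearMap.smul_apply, map_smul, derLin_apply, hD.2.1]
      simp only [LinearMap.smul_apply, map_smul, smul_sub, smul_neg]
    · rw [← derLin_apply, map_smul]
      exact ih hD.2.2

end Good

/-- The Leibniz rule for `- (1 / ħ) [F, ·]`, for operators whose commutator with `F` is divisible
by `ħ`. -/
lemma derF_mul {F : Series K p} {D E : Module.End K (Series K p)} (hD : Good F 1 D)
    (hE : Good F 1 E) : derF p F (D * E) = derF p F D * E + D * derF p F E := by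
  ext1 f
  have h : -(mul K p F (D (E f)) - D (E (mul K p F f))) =
      mul K p (hbar K p) ((derF p F D * E + D * derF p F E) f) := by
    rw [LinearMap.add_apply, Module.End.mul_apply, Module.End.mul_apply, map_add, hD.2.1,
      ← hD.1.1, hE.2.1, map_neg, map_sub]
    abel
  rw [derF_apply, Module.End.mul_apply, Module.End.mul_apply, ← map_neg, h, divHbar_hbar]

namespace Good

variable {F : Series K p}

lemma one_of_succ {n : ℕ} {D : Module.End K (Series K p)} (h : Good F (n + 1) D) :
    Good F 1 D := ⟨h.1, h.2.1, h.2.2.base⟩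

lemma mul {n : ℕ} {D E : Module.End K (Series K p)} (hD : Good F n D) (hE : Good F n E) :
    Good F n (D * E) := by
  have hbase : (∀ f, (D * E) (SuperAiry.mul K p (hbar K p) f) =
      SuperAiry.mul K p (hbar K p) ((D * E) f)) ∧ Raises (D * E) 0 := by
    refine ⟨fun f => ?_, hD.base.2.mul hE.base.2⟩
    rw [Module.End.mul_apply, hE.base.1, hD.base.1, Module.End.mul_apply]
  induction n generalizing D E with
  | zero => exact hbase
  | succ n ih =>
    have h := derF_mul hD.one_of_succ hE.one_of_succ
    refine ⟨hbase, fun f => ?_, ?_⟩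
    · rw [h, LinearMap.add_apply, Module.End.mul_apply, Module.End.mul_apply, map_add, hD.2.1,
        ← hD.1.1, hE.2.1, map_neg, map_sub, Module.End.mul_apply, Module.End.mul_apply]
      abel
    · rw [h]
      refine (ih hD.2.2 hE.pred ?_).add (ih hD.pred hE.2.2 ?_)
      · refine ⟨fun f => ?_, hD.2.2.base.2.mul hE.base.2⟩
        rw [Module.End.mul_apply, hE.base.1, hD.2.2.base.1, Module.End.mul_apply]
      · refine ⟨fun f => ?_, hD.base.2.mul hE.2.2.base.2⟩
        rw [Module.End.mul_apply, hE.2.2.base.1, hD.base.1, Module.End.mul_apply]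

lemma of_derF_eq_zero {D : Module.End K (Series K p)}
    (h : ∀ f, D (SuperAiry.mul K p (hbar K p) f) = SuperAiry.mul K p (hbar K p) (D f))
    (hr : Raises D 0) (h0 : ∀ f, SuperAiry.mul K p F (D f) = D (SuperAiry.mul K p F f)) (n : ℕ) :
    Good F n D ∧ derF p F D = 0 := by
  have h1 : derF p F D = 0 := by
    ext1 f
    rw [derF_apply, h0, sub_self, map_zero, neg_zero]; rfl
  refine ⟨?_, h1⟩
  have hz : ∀ n, Good F n 0 := by
    intro n
    induction n with
    | zero => exact ⟨fun f => by simp, fun f N _ => Ord.zero _⟩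
    | succ n ih =>
      have h2 : derF p F (0 : Module.End K (Series K p)) = 0 := map_zero (derLin F)
      refine ⟨⟨fun f => by simp, fun f N _ => Ord.zero _⟩, fun f => ?_, ?_⟩
      · rw [h2]; simp
      · rw [h2]; exact ih
  cases n with
  | zero => exact ⟨h, hr⟩
  | succ n =>
    refine ⟨⟨h, hr⟩, fun f => ?_, ?_⟩
    · rw [h1, h0]; simp
    · rw [h1]; exact hz n

lemma mulLeft (hF : HasParity p F 0) (f : Series K p) (n : ℕ) :
    Good F n (SuperAiry.mul K p f) ∧ derF p F (SuperAiry.mul K p f) = 0 :=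
  of_derF_eq_zero (fun g => mul_hbar f g) (raises_mul (Ord.of_zero f))
    (fun g => mul_comm_of_even hF f g) n

lemma raises_hbar_partialD (a : A) :
    Raises (SuperAiry.mul K p (hbar K p) * partialD K p a) 1 :=
  fun f N hf => (ord_hbar.mul (hf.partialD a)).mono (by omega)

lemma derF_hbar_partialD (hF : HasParity p F 0) (a : A) :
    derF p F (SuperAiry.mul K p (hbar K p) * partialD K p a) =
      SuperAiry.mul K p (partialD K p a F) := by
  ext1 f
  rw [derF_apply, Module.End.mul_apply, Module.End.mul_apply, partialD_mul, tau_of_even hF,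
    mul_hbar, ← map_sub, divHbar_hbar]
  abel

lemma hbar_partialD (hF : HasParity p F 0) (a : A) (n : ℕ) :
    Good F n (SuperAiry.mul K p (hbar K p) * partialD K p a) := by
  have hbase : (∀ f, (SuperAiry.mul K p (hbar K p) * partialD K p a)
      (SuperAiry.mul K p (hbar K p) f) = SuperAiry.mul K p (hbar K p)
        ((SuperAiry.mul K p (hbar K p) * partialD K p a) f)) ∧
      Raises (SuperAiry.mul K p (hbar K p) * partialD K p a) 0 := by
    refine ⟨fun f => ?_, (raises_hbar_partialD a).of_le (by omega)⟩
    rw [Module.End.mul_apply, partialD_hbar, Module.End.mul_apply]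
  cases n with
  | zero => exact hbase
  | succ n =>
    refine ⟨hbase, fun f => ?_, ?_⟩
    · rw [derF_hbar_partialD hF, Module.End.mul_apply, Module.End.mul_apply, partialD_mul,
        tau_of_even hF, mul_hbar, map_add]
      abel
    · rw [derF_hbar_partialD hF]
      exact (mulLeft hF _ n).1

lemma of_mem_weyl (hF : HasParity p F 0) {D : Module.End K (Series K p)} (hD : D ∈ Weyl K p)
    (n : ℕ) : Good F n D := by
  induction hD using Algebra.adjoin_induction with
  | mem D h =>
    rcases h with (⟨a, rfl⟩ | ⟨a, rfl⟩) | h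
    · exact (mulLeft hF _ n).1
    · exact hbar_partialD hF a n
    · rw [Set.mem_singleton_iff.1 h]
      exact (mulLeft hF _ n).1
  | algebraMap c =>
    rw [Algebra.algebraMap_eq_smul_one]
    exact smul c (of_derF_eq_zero (D := (1 : Module.End K (Series K p))) (fun _ => rfl)
      Raises.one (fun _ => rfl) n).1
  | add D E _ _ hD hE => exact hD.add hE
  | mul D E _ _ hD hE => exact hD.mul hE

/-- The defining conditions of `Good` are closed under pointwise limits. -/
lemma of_limit (hF : Ord F 3) {n : ℕ} {D : Module.End K (Series K p)}
    (h : ∀ (S : Finset (Series K p)) (N : ℕ), ∃ D', Good F n D' ∧ ∀ f ∈ S, Ord (D f - D' f) N) :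
    Good F n D := by
  classical
  have hbase : (∀ f, D (SuperAiry.mul K p (hbar K p) f) = SuperAiry.mul K p (hbar K p) (D f)) ∧
      Raises D 0 := by
    refine ⟨fun f => sub_eq_zero.1 (Ord.eq_zero fun N => ?_), fun f N hf => ?_⟩
    · obtain ⟨D', hD', hS⟩ := h {f, SuperAiry.mul K p (hbar K p) f} N
      have e : D (SuperAiry.mul K p (hbar K p) f) - SuperAiry.mul K p (hbar K p) (D f) =
          (D (SuperAiry.mul K p (hbar K p) f) - D' (SuperAiry.mul K p (hbar K p) f)) -
            SuperAiry.mul K p (hbar K p) (D f - D' f) := by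
        rw [hD'.base.1, map_sub]; abel
      rw [e]
      exact (hS _ (by simp)).sub (((Ord.of_zero _).mul (hS f (by simp))).mono (by omega))
    · obtain ⟨D', hD', hS⟩ := h {f} N
      have e : D f = (D f - D' f) + D' f := by abel
      rw [e]
      exact (hS f (by simp)).add (hD'.base.2 f N hf)
  induction n generalizing D with
  | zero => exact hbase
  | succ n ih =>
    have h2 : ∀ (S : Finset (Series K p)) (N : ℕ), ∃ D', Good F n D' ∧
        ∀ f ∈ S, Ord (derF p F D f - D' f) N := by
      intro S N
      obtain ⟨D', hD', hS⟩ := h (S ∪ S.image (SuperAiry.mul K p F)) (N + 2)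
      refine ⟨derF p F D', hD'.2.2, fun f hf => ?_⟩
      have e : derF p F D f - derF p F D' f = derF p F (D - D') f := by
        rw [derF_sub, LinearMap.sub_apply]
      rw [e, derF_apply]
      refine (Ord.divHbar (N := N + 2) (Ord.sub ?_ ?_)).neg.mono (by omega)
      · exact (hF.mul (hS f (mem_union_left _ hf))).mono (by omega)
      · exact hS _ (mem_union_right _ (mem_image_of_mem _ hf))
    refine ⟨hbase, fun f => sub_eq_zero.1 (Ord.eq_zero fun N => ?_), ih h2 ?_⟩
    · obtain ⟨D', hD', hS⟩ := h {f, SuperAiry.mul K p F f} (N + 2)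
      have e : SuperAiry.mul K p (hbar K p) (derF p F D f) -
          -(SuperAiry.mul K p F (D f) - D (SuperAiry.mul K p F f)) =
          SuperAiry.mul K p (hbar K p) (derF p F (D - D') f) +
          (SuperAiry.mul K p F ((D - D') f) - (D - D') (SuperAiry.mul K p F f)) := by
        rw [derF_sub, LinearMap.sub_apply, map_sub, hD'.2.1, LinearMap.sub_apply,
            LinearMap.sub_apply, map_sub]
        abel
      have h3 : Ord (SuperAiry.mul K p F ((D - D') f) - (D - D') (SuperAiry.mul K p F f))
          (N + 2) :=
        Ord.sub ((hF.mul (hS f (by simp))).mono (by omega)) (hS _ (by simp))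
      rw [e]
      refine Ord.add ?_ (h3.mono (by omega))
      rw [derF_apply]
      exact (ord_hbar.mul h3.divHbar.neg).mono (by omega)
    · refine ⟨fun f => sub_eq_zero.1 (Ord.eq_zero fun N => ?_), (hbase.2.derF hF).of_le (by omega)⟩
      obtain ⟨D', hD', hS⟩ := h2 {f, SuperAiry.mul K p (hbar K p) f} N
      have e : derF p F D (SuperAiry.mul K p (hbar K p) f) -
          SuperAiry.mul K p (hbar K p) (derF p F D f) =
          (derF p F D (SuperAiry.mul K p (hbar K p) f) - D' (SuperAiry.mul K p (hbar K p) f)) -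
            SuperAiry.mul K p (hbar K p) (derF p F D f - D' f) := by
        rw [hD'.base.1, map_sub]; abel
      rw [e]
      exact (hS _ (by simp)).sub (((Ord.of_zero _).mul (hS f (by simp))).mono (by omega))

lemma of_mem_weylHat (hF : HasParity p F 0) (hF3 : Ord F 3) {D : Module.End K (Series K p)}
    (hD : D ∈ WeylHat K p) (n : ℕ) : Good F n D := by
  refine of_limit hF3 fun S N => ?_
  obtain ⟨D', hD', h⟩ := hD S N
  exact ⟨D', of_mem_weyl hF hD' n, fun f hf m hm => by rw [coe_sub, h f hf m hm, sub_self]⟩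

end Good

/-! ### Conjugation by `exp (F / ħ)` -/

/-- The `n`-th term of the series `ψ_F(D)`. -/
def psiTerm (F : Series K p) (n : ℕ) (D : Module.End K (Series K p)) :
    Module.End K (Series K p) := (n.factorial : K)⁻¹ • (derLin F ^ n) D

/-- The conjugation `ψ_F(D) = ∑ₙ (1 / n!) (- (1 / ħ) [F, ·])ⁿ (D)`. For `F` without terms of degree
less than three, the terms with `n > d` do not contribute to the coefficients in degree `d`, and
these terms are left out. -/
def psi (F : Series K p) : Module.End K (Series K p) →ₗ[K] Module.End K (Series K p) where
  toFun D :=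
    { toFun f := ⟨fun m => (∑ n ∈ range (deg m + 1), psiTerm F n D f).1 m,
        fun m hm => (∑ n ∈ range (deg m + 1), psiTerm F n D f).2.1 m hm, fun d =>
          ((∑ n ∈ range (d + 1), psiTerm F n D f).2.2 d).subset (by
            rintro m ⟨rfl, hm⟩
            exact ⟨rfl, hm⟩)⟩
      map_add' f g := series_ext fun m => by
        simp only [map_add, sum_add_distrib, coe_add]
      map_smul' c f := series_ext fun m => by
        simp only [map_smul, ← smul_sum, coe_smul, RingHom.id_apply] }
  map_add' D E := LinearMap.ext fun f => series_ext fun m => by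
    simp [psiTerm, map_add, smul_add, sum_add_distrib]
  map_smul' c D := LinearMap.ext fun f => series_ext fun m => by
    have h : ∀ n, psiTerm F n (c • D) f = c • psiTerm F n D f := fun n => by
      simp only [psiTerm, map_smul, LinearMap.smul_apply, smul_comm c]
    change (∑ n ∈ range (deg m + 1), psiTerm F n (c • D) f).1 m =
      c * (∑ n ∈ range (deg m + 1), psiTerm F n D f).1 m
    simp only [h, ← smul_sum, coe_smul]

lemma psi_sub (F : Series K p) (D E : Module.End K (Series K p)) :
    psi F (D - E) = psi F D - psi F E := map_sub (psi F) D E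

lemma coe_psi (F : Series K p) (D : Module.End K (Series K p)) (f : Series K p) (m : Mono A) :
    (psi F D f).1 m = (∑ n ∈ range (deg m + 1), psiTerm F n D f).1 m := rfl

lemma raises_psiTerm {F : Series K p} (hF : Ord F 3) {D : Module.End K (Series K p)} {r : ℕ}
    (hD : Raises D r) (n : ℕ) : Raises (psiTerm F n D) (r + n) :=
  (hD.derLin_pow hF n).smul _

lemma raises_psi {F : Series K p} (hF : Ord F 3) {D : Module.End K (Series K p)} {r : ℕ}
    (hD : Raises D r) : Raises (psi F D) r := by
  intro f N hf m hm
  rw [coe_psi]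
  exact Ord.sum (fun n _ => ((raises_psiTerm hF hD n) f N hf).mono (by omega)) m hm

lemma ord_psi_sub {F : Series K p} (hF : Ord F 3) {D : Module.End K (Series K p)}
    (hD : Raises D 0) (f : Series K p) {N M : ℕ} (hM : N ≤ M) :
    Ord (psi F D f - ∑ n ∈ range M, psiTerm F n D f) N := by
  intro m hm
  rw [coe_sub, coe_psi, sub_eq_zero, coe_sum, coe_sum]
  refine sum_subset (fun n hn => ?_) fun n _ hn => ?_
  · rw [mem_range] at hn ⊢; omega
  · rw [mem_range] at hn
    exact (raises_psiTerm hF hD n f 0 (Ord.of_zero f)) m (by omega)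

lemma sumsTo_psi {F : Series K p} (hF : Ord F 3) {D : Module.End K (Series K p)}
    (hD : Raises D 0) (f : Series K p) :
    SumsTo p (fun n : ℕ => (n.factorial : K)⁻¹ • ((derF p F)^[n] D) f) (psi F D f) := by
  intro N
  refine ⟨range N, fun J hJ m hm => ?_⟩
  have h1 : ∀ n, (n.factorial : K)⁻¹ • ((derF p F)^[n] D) f = psiTerm F n D f := fun n => by
    rw [psiTerm, derLin_pow_apply]; rfl
  simp only [h1]
  have h2 := ord_psi_sub hF hD f (le_refl N) m hm
  rw [coe_sub, sub_eq_zero] at h2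
  rw [h2, coe_sum, coe_sum]
  symm
  refine sum_subset hJ fun n _ hn => ?_
  rw [mem_range] at hn
  exact (raises_psiTerm hF hD n f 0 (Ord.of_zero f)) m (by omega)

lemma derF_psiTerm [CharZero K] (F : Series K p) (n : ℕ) (D : Module.End K (Series K p)) :
    derF p F (psiTerm F n D) = ((n + 1 : ℕ) : K) • psiTerm F (n + 1) D := by
  rw [psiTerm, ← derLin_apply, map_smul, derLin_apply, ← derLin_pow_succ, psiTerm, smul_smul]
  congr 1
  have h1 : ((n + 1 : ℕ) : K) ≠ 0 := Nat.cast_ne_zero.2 (by omega)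
  have h2 : (n.factorial : K) ≠ 0 := Nat.cast_ne_zero.2 n.factorial_ne_zero
  rw [Nat.factorial_succ, Nat.cast_mul]
  field_simp

lemma Good.psiTerm {F : Series K p} {D : Module.End K (Series K p)} (hD : ∀ n, Good F n D)
    (k n : ℕ) : Good F n (psiTerm F k D) := by
  refine Good.smul _ ?_
  induction k generalizing n with
  | zero => exact hD n
  | succ k ih => rw [derLin_pow_succ]; exact (ih (n + 1)).2.2

lemma psiTerm_mul [CharZero K] {F : Series K p} {D E : Module.End K (Series K p)}
    (hD : ∀ n, Good F n D) (hE : ∀ n, Good F n E) (n : ℕ) :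
    psiTerm F n (D * E) = ∑ x ∈ antidiagonal n, psiTerm F x.1 D * psiTerm F x.2 E := by
  induction n with
  | zero => simp [psiTerm]
  | succ n ih =>
    have h1 : ((n + 1 : ℕ) : K) ≠ 0 := Nat.cast_ne_zero.2 (by omega)
    have h2 : ((n + 1 : ℕ) : K) • psiTerm F (n + 1) (D * E) =
        ((n + 1 : ℕ) : K) • ∑ x ∈ antidiagonal (n + 1), psiTerm F x.1 D * psiTerm F x.2 E := by
      rw [← derF_psiTerm, ih, ← derLin_apply, map_sum, smul_sum]
      have h3 : ∀ x ∈ antidiagonal (n + 1),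
          ((n + 1 : ℕ) : K) • (psiTerm F x.1 D * psiTerm F x.2 E) =
            (x.1 : K) • (psiTerm F x.1 D * psiTerm F x.2 E) +
              (x.2 : K) • (psiTerm F x.1 D * psiTerm F x.2 E) := by
        intro x hx
        rw [← add_smul, ← Nat.cast_add, HasAntidiagonal.mem_antidiagonal.1 hx]
      rw [sum_congr rfl h3, sum_add_distrib, Finset.Nat.sum_antidiagonal_succ,
        Finset.Nat.sum_antidiagonal_succ', Nat.cast_zero, zero_smul, zero_smul, zero_add, zero_add,
        ← sum_add_distrib]
      refine sum_congr rfl fun x _ => ?_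
      rw [derLin_apply, derF_mul (Good.psiTerm hD _ 1) (Good.psiTerm hE _ 1), derF_psiTerm,
        derF_psiTerm, smul_mul_assoc, mul_smul_comm]
    exact smul_right_injective _ h1 h2

/-- `ψ_F` is multiplicative. -/
lemma psi_mul [CharZero K] {F : Series K p} (hF : Ord F 3) {D E : Module.End K (Series K p)}
    (hD : ∀ n, Good F n D) (hE : ∀ n, Good F n E) : psi F (D * E) = psi F D * psi F E := by
  ext1 f
  refine sub_eq_zero.1 (Ord.eq_zero fun N => ?_)
  have hD0 := (hD 0).base.2
  have hE0 := (hE 0).base.2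
  have e : psi F (D * E) f - (psi F D * psi F E) f =
      (psi F (D * E) f - ∑ n ∈ range N, psiTerm F n (D * E) f) -
      (psi F D (psi F E f) - ∑ n ∈ range N, psiTerm F n D (psi F E f)) -
      (∑ i ∈ range N, psiTerm F i D (psi F E f - ∑ n ∈ range N, psiTerm F n E f)) +
      (∑ n ∈ range N, psiTerm F n (D * E) f -
        ∑ i ∈ range N, ∑ j ∈ range N, psiTerm F i D (psiTerm F j E f)) := by
    simp only [map_sub, map_sum, sum_sub_distrib, Module.End.mul_apply]
    abel
  rw [e]
  refine (((ord_psi_sub hF (hD0.mul hE0) f le_rfl).sub (ord_psi_sub hF hD0 _ le_rfl)).sub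
    (Ord.sum fun i _ => ?_)).add ?_
  · exact (raises_psiTerm hF hD0 i _ N (ord_psi_sub hF hE0 f le_rfl)).mono (by omega)
  · intro m hm
    have hz : ∀ i j, N ≤ i + j → (psiTerm F i D (psiTerm F j E f)).1 m = 0 := fun i j hij =>
      (raises_psiTerm hF hD0 i _ _ (raises_psiTerm hF hE0 j f 0 (Ord.of_zero f))) m (by omega)
    rw [coe_sub, sub_eq_zero, coe_sum, coe_sum]
    simp only [psiTerm_mul hD hE, LinearMap.sum_apply, Module.End.mul_apply, coe_sum]
    symm
    rw [← sum_product', ← sum_filter_of_ne (p := fun x : ℕ × ℕ => x.1 + x.2 < N)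
      (fun x _ hx => by by_contra h; exact hx (hz _ _ (by omega))),
      ← sum_fiberwise_of_maps_to (t := range N) (g := fun x : ℕ × ℕ => x.1 + x.2)
        (fun x hx => mem_range.2 (mem_filter.1 hx).2)]
    refine sum_congr rfl fun n hn => sum_congr ?_ fun _ _ => rfl
    ext ⟨i, j⟩
    simp only [HasAntidiagonal.mem_antidiagonal, mem_filter, mem_product, mem_range] at hn ⊢
    omega

lemma psi_mulLeft {F : Series K p} (hF : HasParity p F 0) (f : Series K p) :
    psi F (mul K p f) = mul K p f := by
  ext1 g
  refine series_ext fun m => ?_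
  rw [coe_psi, sum_range_succ', sum_eq_zero]
  · simp [psiTerm]
  · intro n _
    rw [psiTerm, pow_succ, Module.End.mul_apply, derLin_apply, (Good.mulLeft hF f 0).2, map_zero,
      smul_zero, LinearMap.zero_apply]

lemma psi_hbar_partialD {F : Series K p} (hF : HasParity p F 0) (hF3 : Ord F 3) (a : A) :
    psi F (mul K p (hbar K p) * partialD K p a) =
      mul K p (hbar K p) * partialD K p a + mul K p (partialD K p a F) := by
  ext1 g
  refine sub_eq_zero.1 (Ord.eq_zero fun N => ?_)
  have h := ord_psi_sub hF3 ((Good.raises_hbar_partialD (K := K) (p := p) a).of_le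
    (Nat.zero_le _)) g (show N ≤ N + 2 by omega)
  rw [sum_range_succ', sum_range_succ', sum_eq_zero] at h
  · simpa [psiTerm, derLin_apply, Good.derF_hbar_partialD hF, add_comm] using h
  · intro n _
    rw [psiTerm, add_assoc, pow_add, Module.End.mul_apply, derLin_pow_succ, pow_one,
      derLin_apply, Good.derF_hbar_partialD hF, (Good.mulLeft hF _ 0).2, map_zero, smul_zero,
      LinearMap.zero_apply]

/-- `ψ_F` is continuous for the topology of pointwise convergence. -/
lemma SumsTo.psi {F : Series K p} (hF : Ord F 3) {ι : Type*} {T : ι → Module.End K (Series K p)}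
    {S : Module.End K (Series K p)} (hT : ∀ j, Raises (T j) 0) (hS : Raises S 0)
    (h : ∀ f, SumsTo p (fun j => T j f) (S f)) (f : Series K p) :
    SumsTo p (fun j => psi F (T j) f) (psi F S f) := by
  have h1 : ∀ n f, SumsTo p (fun j => (derLin F ^ n) (T j) f) ((derLin F ^ n) S f) := by
    intro n
    induction n with
    | zero => exact h
    | succ n ih =>
      intro f
      simp only [derLin_pow_succ, derF_apply]
      exact (((ih f).map (cont_mul F)).sub (ih (mul K p F f))).map cont_divHbar |>.neg
  have h2 : ∀ N, SumsTo p (fun j => ∑ n ∈ range N, psiTerm F n (T j) f)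
      (∑ n ∈ range N, psiTerm F n S f) := by
    intro N
    induction N with
    | zero => exact fun N => ⟨∅, fun J _ m _ => by simp⟩
    | succ N ih =>
      simp only [sum_range_succ]
      refine ih.add ?_
      exact (h1 N f).map (D := (N.factorial : K)⁻¹ • 1) (Cont.one.smul _)
  intro N
  obtain ⟨J, hJ⟩ := h2 N N
  refine ⟨J, fun J' hs m hm => ?_⟩
  have h3 := ord_psi_sub hF hS f (le_refl N) m hm
  rw [coe_sub, sub_eq_zero] at h3
  rw [h3, ← hJ J' hs m hm, coe_sum, coe_sum]
  refine sum_congr rfl fun j _ => ?_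
  have h4 := ord_psi_sub hF (hT j) f (le_refl N) m hm
  rwa [coe_sub, sub_eq_zero] at h4

lemma OpParity.psi {F : Series K p} (hF : HasParity p F 0) {D : Module.End K (Series K p)}
    {q : ZMod 2} (hD : OpParity p D q) : OpParity p (psi F D) q := by
  have h : ∀ n, OpParity p ((derLin F ^ n) D) q := by
    intro n
    induction n with
    | zero => exact hD
    | succ n ih =>
      intro r f hf
      rw [derLin_pow_succ, derF_apply]
      refine (HasParity.divHbar (HasParity.sub ?_ ?_)).neg
      · simpa using hF.mul (ih r f hf)
      · simpa using ih _ _ (hF.mul hf)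
  intro r f hf m hm
  rw [coe_psi] at hm
  exact HasParity.sum (fun n _ => (h n r f hf).smul _) m hm

end Conjugation

section Existence

variable {K : Type*} [Field K] {I : Type*} [LinearOrder I] {p : I → ZMod 2}

/-! ### The quadratic equations for a free energy -/

/-- The terms of order two of the operator `L_i`, up to sign. -/
def quadOp (p : I → ZMod 2) (A B C : I → WithBot I → WithBot I → K) (i : I)
    (ab : WithBot I × WithBot I) : Module.End K (Series K (ext p)) :=
  (1 / 2 * A i ab.1 ab.2) •
      (mul K (ext p) (X K (ext p) ab.1) * mul K (ext p) (X K (ext p) ab.2)) +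
    B i ab.1 ab.2 •
      (mul K (ext p) (X K (ext p) ab.1) *
        (mul K (ext p) (hbar K (ext p)) * partialD K (ext p) ab.2)) +
    (1 / 2 * C i ab.1 ab.2) •
      ((mul K (ext p) (hbar K (ext p)) * partialD K (ext p) ab.1) *
        (mul K (ext p) (hbar K (ext p)) * partialD K (ext p) ab.2))

/-- The terms of order two of `ψ_F(L_i) · 1`, up to sign. -/
def ricTerm (A B C : I → WithBot I → WithBot I → K) (F : Series K (ext p)) (i : I)
    (ab : WithBot I × WithBot I) : Series K (ext p) :=
  (1 / 2 * A i ab.1 ab.2) • mul K (ext p) (X K (ext p) ab.1) (X K (ext p) ab.2) +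
    B i ab.1 ab.2 • mul K (ext p) (X K (ext p) ab.1) (partialD K (ext p) ab.2 F) +
    (1 / 2 * C i ab.1 ab.2) •
      (mul K (ext p) (hbar K (ext p)) (partialD K (ext p) ab.1 (partialD K (ext p) ab.2 F)) +
        mul K (ext p) (partialD K (ext p) ab.1 F) (partialD K (ext p) ab.2 F))

variable {L : (I → K) →ₗ[K] Module.End K (Series K (ext p))}
  {A B C : I → WithBot I → WithBot I → K} {D : I → K}

lemma raises_quadOp (i : I) (ab : WithBot I × WithBot I) : Raises (quadOp p A B C i ab) 2 :=
  ((((raises_mul (ord_X _)).mul (raises_mul (ord_X _))).smul _).add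
    (((raises_mul (ord_X _)).mul (Good.raises_hbar_partialD _)).smul _)).add
    (((Good.raises_hbar_partialD _).mul (Good.raises_hbar_partialD _)).smul _)

lemma psi_quadOp [CharZero K] {F : Series K (ext p)} (hF : HasParity (ext p) F 0) (hF3 : Ord F 3)
    (i : I) (ab : WithBot I × WithBot I) :
    psi F (quadOp p A B C i ab) (one K (ext p)) = ricTerm A B C F i ab := by
  have hX : ∀ a n, Good F n (mul K (ext p) (X K (ext p) a)) := fun a n =>
    (Good.mulLeft hF _ n).1
  have hd : ∀ a n, Good F n (mul K (ext p) (hbar K (ext p)) * partialD K (ext p) a) := fun a n =>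
    Good.hbar_partialD hF a n
  rw [quadOp, map_add, map_add, map_smul, map_smul, map_smul, psi_mul hF3 (hX _) (hX _),
    psi_mul hF3 (hX _) (hd _), psi_mul hF3 (hd _) (hd _)]
  simp only [psi_mulLeft hF, psi_hbar_partialD hF hF3, LinearMap.add_apply, LinearMap.smul_apply,
    Module.End.mul_apply, partialD_one, map_zero, zero_add, mul_one_series, ricTerm]

/-- The part of order two of `L_i`, up to sign. -/
def quadPart (L : (I → K) →ₗ[K] Module.End K (Series K (ext p))) (D : I → K) (i : I) :
    Module.End K (Series K (ext p)) :=
  mul K (ext p) (hbar K (ext p)) * partialD K (ext p) (i : WithBot I) -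
    D i • mul K (ext p) (hbar K (ext p)) - L (Pi.single i 1)

lemma sumsTo_quadPart (hcoeff : HasCoefficients p L A B C D) (i : I) (f : Series K (ext p)) :
    SumsTo (ext p) (fun ab => quadOp p A B C i ab f) (quadPart L D i f) := by
  have h := hcoeff.expansion i f
  refine Eq.mp (congrArg (fun t => SumsTo (ext p) t (quadPart L D i f)) (funext fun ab => ?_)) h
  simp only [quadOp, LinearMap.add_apply, LinearMap.smul_apply, Module.End.mul_apply, hbar_X,
    partialD_hbar]

lemma raises_quadPart (hcoeff : HasCoefficients p L A B C D) (i : I) :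
    Raises (quadPart L D i) 2 := fun f N hf =>
  (sumsTo_quadPart hcoeff i f).ord fun ab => raises_quadOp i ab f N hf

/-- The equation `ψ_F(L_i) · 1 = ∂_i F - ħ D_i - ∑ (…)`, in which the sum runs over the terms of
order two. -/
lemma riccati [CharZero K] (hcoeff : HasCoefficients p L A B C D) {F : Series K (ext p)}
    (hF : HasParity (ext p) F 0) (hF3 : Ord F 3) (i : I) :
    SumsTo (ext p) (ricTerm A B C F i)
      (partialD K (ext p) (i : WithBot I) F - D i • hbar K (ext p) -
        psi F (L (Pi.single i 1)) (one K (ext p))) := by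
  have h := SumsTo.psi hF3 (fun ab => (raises_quadOp (A := A) (B := B) (C := C) i ab).of_le
    (Nat.zero_le 2)) ((raises_quadPart hcoeff i).of_le (Nat.zero_le 2))
    (sumsTo_quadPart hcoeff i) (one K (ext p))
  simp only [psi_quadOp hF hF3] at h
  have e : psi F (quadPart L D i) (one K (ext p)) =
      partialD K (ext p) (i : WithBot I) F - D i • hbar K (ext p) -
        psi F (L (Pi.single i 1)) (one K (ext p)) := by
    rw [quadPart, psi_sub, psi_sub, map_smul, psi_mulLeft hF, psi_hbar_partialD hF hF3]
    simp only [LinearMap.sub_apply, LinearMap.add_apply, LinearMap.smul_apply,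
      Module.End.mul_apply, partialD_one, map_zero, zero_add, mul_one_series]
  rwa [e] at h

lemma psi_airy_apply [CharZero K] {F : Series K (ext p)} (hF : HasParity (ext p) F 0)
    (hF3 : Ord F 3) (hcoeff : HasCoefficients p L A B C D) (i : I) {f : Series K (ext p)} {N : ℕ}
    (hf : Ord f N) : Ord (psi F (L (Pi.single i 1)) f -
      mul K (ext p) (hbar K (ext p)) (partialD K (ext p) (i : WithBot I) f)) (N + 2) := by
  have e : L (Pi.single i 1) = mul K (ext p) (hbar K (ext p)) *
      partialD K (ext p) (i : WithBot I) - D i • mul K (ext p) (hbar K (ext p)) -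
      quadPart L D i := by
    rw [quadPart]; abel
  have e2 : psi F (L (Pi.single i 1)) f -
      mul K (ext p) (hbar K (ext p)) (partialD K (ext p) (i : WithBot I) f) =
      mul K (ext p) (partialD K (ext p) (i : WithBot I) F) f -
        D i • mul K (ext p) (hbar K (ext p)) f - psi F (quadPart L D i) f := by
    rw [e, psi_sub, psi_sub, map_smul, psi_mulLeft hF, psi_hbar_partialD hF hF3]
    simp only [LinearMap.sub_apply, LinearMap.add_apply, LinearMap.smul_apply,
      Module.End.mul_apply]
    abel
  rw [e2]
  refine (Ord.sub ?_ (Ord.smul _ ?_)).sub (raises_psi hF3 (raises_quadPart hcoeff i) f N hf)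
  · exact ((hF3.partialD _).mul hf).mono (by omega)
  · exact (ord_hbar.mul hf).mono (by omega)

/-! ### Consequences of continuity and involutivity -/

/-- A continuous `L` is determined by the operators `L(y_i)`. -/
lemma sumsTo_airy (hL : IsSuperQuantumAiry p L) (φ : I → K) (f : Series K (ext p)) :
    SumsTo (ext p) (fun i => (φ i • L (Pi.single i 1)) f) (L φ f) := by
  classical
  intro N
  obtain ⟨J, hJ⟩ := hL.continuous f N
  refine ⟨J, fun J' hs m hm => ?_⟩
  have e : ∑ i ∈ J', (φ i • L (Pi.single i 1)) f = L (∑ i ∈ J', φ i • Pi.single i 1) f := by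
    rw [map_sum, LinearMap.sum_apply]
    exact sum_congr rfl fun i _ => by rw [map_smul]
  have e2 : L (∑ i ∈ J', φ i • Pi.single i 1) - L φ =
      L (∑ i ∈ J', φ i • Pi.single i 1 - φ) := (map_sub L _ _).symm
  rw [e, ← sub_eq_zero, ← coe_sub, ← LinearMap.sub_apply, e2]
  refine hJ _ (fun j hj => ?_) m hm
  rw [Pi.sub_apply, Finset.sum_apply, sum_eq_single j]
  · simp
  · intro i _ hij
    simp [Ne.symm hij]
  · intro h
    exact absurd (hs hj) h

lemma good_airy (hL : IsSuperQuantumAiry p L) {F : Series K (ext p)}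
    (hF : HasParity (ext p) F 0) (hF3 : Ord F 3) (φ : I → K) (n : ℕ) : Good F n (L φ) :=
  Good.of_mem_weylHat hF hF3 (hL.mem_weylHat φ) n

lemma sumsTo_psi_airy (hL : IsSuperQuantumAiry p L) {F : Series K (ext p)}
    (hF : HasParity (ext p) F 0) (hF3 : Ord F 3) (φ : I → K) (f : Series K (ext p)) :
    SumsTo (ext p) (fun i => φ i • psi F (L (Pi.single i 1)) f) (psi F (L φ) f) := by
  have h := SumsTo.psi hF3 (fun i => ((good_airy hL hF hF3 (Pi.single i 1) 0).base.2.smul (φ i)))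
    (good_airy hL hF hF3 φ 0).base.2 (sumsTo_airy hL φ) f
  simpa only [map_smul, LinearMap.smul_apply] using h

lemma ord_psi_leftIdeal [CharZero K] (hL : IsSuperQuantumAiry p L) {F : Series K (ext p)}
    (hF : HasParity (ext p) F 0) (hF3 : Ord F 3) {d : ℕ}
    (hd : ∀ i, Ord (psi F (L (Pi.single i 1)) (one K (ext p))) d)
    {G : Module.End K (Series K (ext p))} (hG : G ∈ leftIdeal p L) :
    (∀ n, Good F n G) ∧ Ord (psi F G (one K (ext p))) d := by
  have hφ : ∀ φ, Ord (psi F (L φ) (one K (ext p))) d := fun φ =>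
    (sumsTo_psi_airy hL hF hF3 φ _).ord fun i => (hd i).smul _
  induction hG using Submodule.span_induction with
  | mem G h =>
    obtain ⟨G', hG', φ, rfl⟩ := h
    have h1 := Good.of_mem_weylHat hF hF3 hG'
    refine ⟨fun n => (h1 n).mul (good_airy hL hF hF3 φ n), ?_⟩
    rw [psi_mul hF3 h1 (good_airy hL hF hF3 φ)]
    exact raises_psi hF3 (h1 0).base.2 _ _ (hφ φ)
  | zero =>
    refine ⟨fun n => (Good.of_derF_eq_zero (fun f => by simp) (fun f N _ => Ord.zero _)
      (fun f => by simp) n).1, ?_⟩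
    rw [map_zero]
    exact Ord.zero _
  | add G G' _ _ h h' =>
    refine ⟨fun n => (h.1 n).add (h'.1 n), ?_⟩
    rw [map_add]
    exact h.2.add h'.2
  | smul c G _ h =>
    refine ⟨fun n => (h.1 n).smul c, ?_⟩
    rw [map_smul]
    exact h.2.smul c

lemma opParity_airy (hL : IsSuperQuantumAiry p L) (i : I) :
    OpParity (ext p) (L (Pi.single i 1)) (p i) := by
  classical
  refine hL.even _ _ fun j hj => ?_
  by_cases h : j = i
  · rw [h]
  · simp [h] at hj

/-- If the series `ψ_F(L_i) · 1` vanish in degrees below `d`, then involutivity shows that their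
components of degree `d` satisfy the integrability condition of the super Poincaré lemma. -/
lemma integrability [CharZero K] (hL : IsSuperQuantumAiry p L)
    (hcoeff : HasCoefficients p L A B C D) {F : Series K (ext p)}
    (hF : HasParity (ext p) F 0) (hF3 : Ord F 3) {d : ℕ}
    (hd : ∀ i, Ord (psi F (L (Pi.single i 1)) (one K (ext p))) d) (i j : I) :
    Ord (partialD K (ext p) (i : WithBot I) (psi F (L (Pi.single j 1)) (one K (ext p))) -
      chi K (p i * p j) • partialD K (ext p) (j : WithBot I)
        (psi F (L (Pi.single i 1)) (one K (ext p)))) d := by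
  classical
  have hone : (1 : Module.End K (Series K (ext p))) ∈ WeylHat K (ext p) := fun S N =>
    ⟨1, one_mem _, fun _ _ _ _ => rfl⟩
  have hmem : ∀ i, L (Pi.single i 1) ∈ leftIdeal p L := fun i =>
    Submodule.subset_span ⟨1, hone, _, (one_mul _).symm⟩
  obtain ⟨G, hG, h⟩ := hL.involutive _ (hmem i) _ (hmem j) _ _ (opParity_airy hL i)
    (opParity_airy hL j)
  obtain ⟨hG1, hG2⟩ := ord_psi_leftIdeal hL hF hF3 hd hG
  have h1 := congrArg (fun T => psi F T (one K (ext p))) h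
  simp only [chi_eq, psi_sub, map_smul, LinearMap.sub_apply, LinearMap.smul_apply] at h1
  rw [psi_mul hF3 (good_airy hL hF hF3 _) (good_airy hL hF hF3 _),
    psi_mul hF3 (good_airy hL hF hF3 _) (good_airy hL hF hF3 _),
    psi_mul hF3 (fun n => (Good.mulLeft hF _ n).1) hG1, psi_mulLeft hF] at h1
  simp only [Module.End.mul_apply] at h1
  set R := fun i => psi F (L (Pi.single i 1)) (one K (ext p)) with hR
  have h2 : Ord (mul K (ext p) (hbar K (ext p)) (partialD K (ext p) (i : WithBot I) (R j) -
      chi K (p i * p j) • partialD K (ext p) (j : WithBot I) (R i))) (d + 2) := by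
    have e : mul K (ext p) (hbar K (ext p)) (partialD K (ext p) (i : WithBot I) (R j) -
      chi K (p i * p j) • partialD K (ext p) (j : WithBot I) (R i)) =
      mul K (ext p) (hbar K (ext p)) (psi F G (one K (ext p))) -
      ((psi F (L (Pi.single i 1)) (R j) -
        mul K (ext p) (hbar K (ext p)) (partialD K (ext p) (i : WithBot I) (R j))) -
      chi K (p i * p j) • (psi F (L (Pi.single j 1)) (R i) -
        mul K (ext p) (hbar K (ext p)) (partialD K (ext p) (j : WithBot I) (R i)))) := by
      rw [← h1, map_sub, map_smul, smul_sub]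
      abel
    rw [e]
    exact ((ord_hbar.mul hG2).mono (by omega)).sub ((psi_airy_apply hF hF3 hcoeff i (hd j)).sub
      ((psi_airy_apply hF hF3 hcoeff j (hd i)).smul _))
  have h3 := h2.divHbar
  rwa [divHbar_hbar, Nat.add_sub_cancel] at h3

/-! ### The super Poincaré lemma -/

/-- The homogeneous component of degree `d`. -/
def homPart (d : ℕ) (f : Series K (ext p)) : Series K (ext p) :=
  ⟨fun m => if deg m = d then f.1 m else 0, fun m h => f.2.1 m fun h' => h (by simp [h']),
    fun d' => (f.2.2 d').subset fun m h => ⟨h.1, fun h' => h.2 (by simp [h'])⟩⟩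

lemma coe_homPart (d : ℕ) (f : Series K (ext p)) (m : Mono (WithBot I)) :
    (homPart d f).1 m = if deg m = d then f.1 m else 0 := rfl

lemma ord_sub_homPart {d : ℕ} {f : Series K (ext p)} (hf : Ord f d) :
    Ord (f - homPart d f) (d + 1) := by
  intro m hm
  rw [coe_sub, coe_homPart]
  split_ifs with h
  · exact sub_self _
  · rw [hf m (by omega), sub_zero]

lemma coe_partialD (a : WithBot I) (f : Series K (ext p)) (m : Mono (WithBot I)) :
    (partialD K (ext p) a f).1 m =
      (if ext p a = 1 then (-1) ^ oddBefore (ext p) a m.2 else 1) * (m.2 a + 1 : K) *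
      f.1 (m.1, m.2 + Finsupp.single a 1) := rfl

lemma deg_add_single (m : Mono (WithBot I)) (a : WithBot I) :
    deg (m.1, m.2 + Finsupp.single a 1) = deg m + 1 := by
  simp only [deg, map_add, Finsupp.degree_single]; ring

/-- The Euler operator of a single variable. -/
lemma coe_X_partialD (a : WithBot I) (f : Series K (ext p)) (m : Mono (WithBot I)) :
    (mul K (ext p) (X K (ext p) a) (partialD K (ext p) a f)).1 m = (m.2 a : K) * f.1 m := by
  classical
  let E : Module.End K (Series K (ext p)) :=
    { toFun f := ⟨fun m => (m.2 a : K) * f.1 m, fun m h => f.2.1 m (right_ne_zero_of_mul h),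
        fun d => (f.2.2 d).subset fun m h => ⟨h.1, right_ne_zero_of_mul h.2⟩⟩
      map_add' f g := series_ext fun m => mul_add _ _ _
      map_smul' c f := series_ext fun m => by
        change (m.2 a : K) * (c * f.1 m) = c * ((m.2 a : K) * f.1 m)
        ring }
  have hE : Raises E 0 := fun f N hf m hm => by
    change (m.2 a : K) * f.1 m = 0
    rw [hf m hm, mul_zero]
  have key : mul K (ext p) (X K (ext p) a) * partialD K (ext p) a = E := by
    refine end_ext_mon ((cont_mul _).mul (cont_partialD a)) hE.cont fun k e he => ?_
    have hEm : E (mon K (ext p) k e) = (e a : K) • mon K (ext p) k e := by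
      refine series_ext fun m => ?_
      change (m.2 a : K) * (mon K (ext p) k e).1 m = (e a : K) * (mon K (ext p) k e).1 m
      rw [coe_mon]
      split_ifs with h
      · rw [h.2]
      · simp
    rw [hEm, Module.End.mul_apply, partialD_mon _ _ he, map_smul, X_mon, smul_smul]
    by_cases hea : e a = 0
    · simp [hea]
    · have h1 : Finsupp.single a 1 ≤ e := by
        rw [Finsupp.single_le_iff]; omega
      have hc : cr (ext p) (Finsupp.single a 1) e =
          cr (ext p) (Finsupp.single a 1) (e - Finsupp.single a 1) := by
        conv_lhs => rw [← tsub_add_cancel_of_le h1]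
        rw [cr_add_right, cr_single]
        simp
      rw [tsub_add_cancel_of_le h1, ← hc, mul_right_comm, sign_mul_self, one_mul]
  exact congrArg (fun g : Series K (ext p) => g.1 m) (LinearMap.congr_fun key f)

/-- The degree of a monomial in the variables `x ^ i` with `i : I`. -/
def evDeg (e : WithBot I →₀ ℕ) : ℕ := e.sum fun a n => if a = ⊥ then 0 else n

lemma evDeg_add_single (e : WithBot I →₀ ℕ) (i : I) :
    evDeg (e + Finsupp.single (i : WithBot I) 1) = evDeg e + 1 := by
  classical
  rw [evDeg, Finsupp.sum_add_index' (by simp) (by intros; split_ifs <;> simp),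
    Finsupp.sum_single_index (by simp), if_neg WithBot.coe_ne_bot]
  rfl

lemma evDeg_eq_sum {e : WithBot I →₀ ℕ} {J : Finset I} (h : ∀ j ∉ J, e (j : WithBot I) = 0) :
    evDeg e = ∑ j ∈ J, e (j : WithBot I) := by
  classical
  rw [evDeg, Finsupp.sum_of_support_subset e (s := insert ⊥ (J.image WithBot.some)),
    sum_insert (by simp), if_pos rfl, zero_add,
      sum_image (fun _ _ _ _ h => WithBot.coe_injective h)]
  · exact sum_congr rfl fun j _ => if_neg WithBot.coe_ne_bot
  · intro a ha
    induction a using WithBot.recBotCoe with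
    | bot => simp
    | coe j =>
      refine mem_insert_of_mem (mem_image_of_mem _ ?_)
      by_contra hj
      exact Finsupp.mem_support_iff.1 ha (h j hj)
  · simp

/-- Division of each monomial by its degree in the variables `x ^ i` with `i : I`. -/
def divEuler (f : Series K (ext p)) : Series K (ext p) :=
  ⟨fun m => (evDeg m.2 : K)⁻¹ * f.1 m, fun m h => f.2.1 m (right_ne_zero_of_mul h),
    fun d => (f.2.2 d).subset fun _ h => ⟨h.1, right_ne_zero_of_mul h.2⟩⟩

/-- The super Poincaré lemma, with the variable `x ^ 0` as a parameter: a closed system of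
homogeneous series, of which only finitely many are non-zero, has a primitive. -/
lemma exists_primitive [CharZero K] {d : ℕ} {S : I → Series K (ext p)} {J : Finset I}
    (hJ : ∀ j ∉ J, S j = 0) (hord : ∀ i, Ord (S i) d) (hpar : ∀ i, HasParity (ext p) (S i) (p i))
    (hclosed : ∀ i j : I, partialD K (ext p) (i : WithBot I) (S j) =
      chi K (p i * p j) • partialD K (ext p) (j : WithBot I) (S i)) :
    ∃ H : Series K (ext p), HasParity (ext p) H 0 ∧ (∀ k, H.1 (k, 0) = 0) ∧ Ord H (d + 1) ∧
      ∀ i : I, partialD K (ext p) (i : WithBot I) H = S i := by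
  classical
  set H₀ : Series K (ext p) := ∑ j ∈ J, mul K (ext p) (X K (ext p) (j : WithBot I)) (S j) with hH₀
  refine ⟨divEuler H₀, ?_, ?_, ?_, fun i => ?_⟩
  · intro m hm
    refine HasParity.sum (fun j _ => ?_) m (right_ne_zero_of_mul hm)
    have h := (hasParity_X (K := K) (p := ext p) (j : WithBot I)).mul (hpar j)
    have e : ext p (j : WithBot I) + p j = 0 := CharTwo.add_self_eq_zero (p j)
    rwa [e] at h
  · intro k
    change (evDeg 0 : K)⁻¹ * _ = 0
    simp [evDeg]
  · intro m hm
    change _ * H₀.1 m = 0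
    rw [(Ord.sum fun j _ => ((ord_X _).mul (hord j)).mono (by omega) : Ord H₀ (d + 1)) m hm,
      mul_zero]
  · -- Euler's identity gives `∂ᵢ H₀ = (1 + ν) Sᵢ`, where `ν` is the degree `evDeg`.
    have key : ∀ m, (partialD K (ext p) (i : WithBot I) H₀).1 m =
        ((evDeg m.2 + 1 : ℕ) : K) * (S i).1 m := by
      intro m
      have h1 : partialD K (ext p) (i : WithBot I) H₀ = S i +
          ∑ j ∈ J, mul K (ext p) (X K (ext p) (j : WithBot I))
            (partialD K (ext p) (j : WithBot I) (S i)) := by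
        rw [hH₀, map_sum]
        simp only [partialD_X, sum_add_distrib]
        congr 1
        · by_cases hi : i ∈ J
          · rw [sum_eq_single i]
            · simp
            · intro j _ hji
              simp [Ne.symm hji]
            · exact fun h => absurd hi h
          · rw [hJ i hi]
            refine sum_eq_zero fun j hj => ?_
            have : i ≠ j := fun h => hi (h ▸ hj)
            simp [this]
        · refine sum_congr rfl fun j _ => ?_
          rw [hclosed i j, map_smul, smul_smul]
          change (chi K (p i * p j) * chi K (p i * p j)) • _ = _
          rw [chi_mul_self, one_smul]
      have h2 : ∀ j ∉ J, (m.2 (j : WithBot I) : K) * (S i).1 m = 0 := by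
        intro j hj
        rw [← coe_X_partialD, hclosed j i, hJ j hj]
        simp
      rw [h1, coe_add, coe_sum]
      simp only [coe_X_partialD]
      rw [← sum_mul]
      by_cases h : (S i).1 m = 0
      · simp [h]
      · rw [evDeg_eq_sum (J := J) fun j hj => by
          simpa [h] using h2 j hj]
        push_cast
        ring
    refine series_ext fun m => ?_
    have h3 : ((evDeg m.2 + 1 : ℕ) : K) ≠ 0 := Nat.cast_ne_zero.2 (by omega)
    have h4 : (partialD K (ext p) (i : WithBot I) (divEuler H₀)).1 m =
        ((evDeg m.2 + 1 : ℕ) : K)⁻¹ * (partialD K (ext p) (i : WithBot I) H₀).1 m := by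
      rw [coe_partialD, coe_partialD]
      change _ * ((evDeg (m.2 + Finsupp.single (i : WithBot I) 1) : K)⁻¹ * H₀.1 _) = _
      rw [evDeg_add_single]
      ring
    rw [h4, key, inv_mul_cancel_left₀ h3]

/-! ### Existence of the free energy -/

lemma ord_psi_sub_psi [CharZero K] (hcoeff : HasCoefficients p L A B C D)
    {F F' : Series K (ext p)} (hF : HasParity (ext p) F 0) (hF3 : Ord F 3)
    (hF' : HasParity (ext p) F' 0) (hF3' : Ord F' 3) {d : ℕ} (h : Ord (F' - F) (d + 1)) (i : I) :
    Ord (partialD K (ext p) (i : WithBot I) (F' - F) -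
      (psi F' (L (Pi.single i 1)) (one K (ext p)) - psi F (L (Pi.single i 1)) (one K (ext p))))
      (d + 1) := by
  have h1 := (riccati hcoeff hF' hF3' i).sub (riccati hcoeff hF hF3 i)
  have e : partialD K (ext p) (i : WithBot I) (F' - F) -
      (psi F' (L (Pi.single i 1)) (one K (ext p)) - psi F (L (Pi.single i 1)) (one K (ext p))) =
      partialD K (ext p) (i : WithBot I) F' - D i • hbar K (ext p) -
        psi F' (L (Pi.single i 1)) (one K (ext p)) -
      (partialD K (ext p) (i : WithBot I) F - D i • hbar K (ext p) -
        psi F (L (Pi.single i 1)) (one K (ext p))) := by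
    rw [map_sub]; abel
  rw [e]
  refine h1.ord fun ⟨a, b⟩ => ?_
  have e2 : ricTerm A B C F' i (a, b) - ricTerm A B C F i (a, b) =
      B i a b • mul K (ext p) (X K (ext p) a) (partialD K (ext p) b (F' - F)) +
      (1 / 2 * C i a b) •
        (mul K (ext p) (hbar K (ext p)) (partialD K (ext p) a (partialD K (ext p) b (F' - F))) +
        (mul K (ext p) (partialD K (ext p) a (F' - F)) (partialD K (ext p) b F') +
          mul K (ext p) (partialD K (ext p) a F) (partialD K (ext p) b (F' - F)))) := by
    simp only [ricTerm, map_sub, LinearMap.sub_apply]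
    module
  rw [e2]
  refine Ord.add (Ord.smul _ ?_) (Ord.smul _ (Ord.add ?_ (Ord.add ?_ ?_)))
  · exact ((ord_X a).mul (h.partialD b)).mono (by omega)
  · exact (ord_hbar.mul ((h.partialD b).partialD a)).mono (by omega)
  · exact ((h.partialD a).mul (hF3'.partialD b)).mono (by omega)
  · exact ((hF3.partialD a).mul (h.partialD b)).mono (by omega)

variable (L) in
/-- `F` solves the equations for a free energy in degrees less than `d`. -/
structure ApproxFreeEnergy (d : ℕ) (F : Series K (ext p)) : Prop where
  even : HasParity (ext p) F 0
  no_constant : ∀ k, F.1 (k, 0) = 0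
  ord : Ord F 3
  annihilates : ∀ i, Ord (psi F (L (Pi.single i 1)) (one K (ext p))) d

lemma approxFreeEnergy_zero [CharZero K] (hcoeff : HasCoefficients p L A B C D) :
    ApproxFreeEnergy L 2 (0 : Series K (ext p)) where
  even := HasParity.zero _
  no_constant _ := rfl
  ord := Ord.zero _
  annihilates i := by
    have h := psi_airy_apply (HasParity.zero _) (Ord.zero 3) hcoeff i
      (Ord.of_zero (one K (ext p)))
    simpa [partialD_one] using h

/-- The inductive step of the construction of the free energy. -/
lemma ApproxFreeEnergy.succ [CharZero K] (hL : IsSuperQuantumAiry p L)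
    (hcoeff : HasCoefficients p L A B C D) {d : ℕ} (hd2 : 2 ≤ d) {F : Series K (ext p)}
    (hF : ApproxFreeEnergy L d F) :
    ∃ F' : Series K (ext p), ApproxFreeEnergy L (d + 1) F' ∧ Ord (F' - F) (d + 1) := by
  classical
  set R := fun i => psi F (L (Pi.single i 1)) (one K (ext p)) with hR
  have hRpar : ∀ i, HasParity (ext p) (R i) (p i) := fun i => by
    simpa using (opParity_airy hL i).psi hF.even 0 _ hasParity_one
  -- By continuity of `L`, only finitely many equations matter in a given degree.
  obtain ⟨J, hJ⟩ : ∃ J : Finset I, ∀ j ∉ J, Ord (R j) (d + 1) := by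
    obtain ⟨J, hJ⟩ := sumsTo_psi_airy hL hF.even hF.ord (fun _ => 1) (one K (ext p)) (d + 1)
    refine ⟨J, fun j hj m hm => ?_⟩
    have h1 := hJ J subset_rfl m hm
    have h2 := hJ (insert j J) (subset_insert j J) m hm
    rw [sum_insert hj, coe_add, h1, add_eq_right] at h2
    simpa using h2
  have hfin : ∀ j ∉ J, -homPart d (R j) = 0 := by
    intro j hj
    refine series_ext fun m => ?_
    rw [coe_neg, coe_homPart]
    split_ifs with h
    · rw [hJ j hj m (by omega)]; simp
    · simp
  have hordS : ∀ j, Ord (-homPart d (R j)) d := by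
    intro i
    refine Ord.neg fun m hm => ?_
    rw [coe_homPart, if_neg (by omega)]
  have hparS : ∀ j, HasParity (ext p) (-homPart d (R j)) (p j) := by
    intro i
    refine HasParity.neg fun m hm => hRpar i m fun h => hm ?_
    rw [coe_homPart, h, ite_self]
  have hclosed : ∀ i j : I, partialD K (ext p) (i : WithBot I) (-homPart d (R j)) =
      chi K (p i * p j) • partialD K (ext p) (j : WithBot I) (-homPart d (R i)) := by
    intro i j
    have h := integrability hL hcoeff hF.even hF.ord hF.annihilates i j
    refine series_ext fun m => ?_
    rw [map_neg, map_neg, coe_smul, coe_neg, coe_neg, coe_partialD, coe_partialD, coe_homPart,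
      coe_homPart, deg_add_single, deg_add_single]
    by_cases hm : deg m + 1 = d
    · have h' := h m (by omega)
      rw [coe_sub, coe_smul, coe_partialD, coe_partialD] at h'
      rw [if_pos hm, if_pos hm]
      linear_combination -h'
    · rw [if_neg hm, if_neg hm]
      ring
  obtain ⟨H, hH1, hH2, hH3, hH4⟩ := exists_primitive hfin hordS hparS hclosed
  have hsub : F + H - F = H := by abel
  have hord : Ord (F + H) 3 := hF.ord.add (hH3.mono (by omega))
  refine ⟨F + H, ⟨hF.even.add hH1, fun k => ?_, hord, fun i => ?_⟩, by rwa [hsub]⟩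
  · rw [coe_add, hF.no_constant, hH2, add_zero]
  · have h1 := ord_psi_sub_psi hcoeff hF.even hF.ord (hF.even.add hH1) hord
      (by rwa [hsub]) i (d := d)
    rw [hsub, hH4] at h1
    have h2 := (ord_sub_homPart (hF.annihilates i)).sub h1
    convert h2 using 1
    simp only [hR]
    abel

lemma exists_freeEnergy [CharZero K] (hL : IsSuperQuantumAiry p L)
    (hcoeff : HasCoefficients p L A B C D) : ∃ F, IsFreeEnergy p L F := by
  classical
  have step : ∀ (n : ℕ) (F : {F : Series K (ext p) // ApproxFreeEnergy L (n + 2) F}),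
      ∃ F' : {F : Series K (ext p) // ApproxFreeEnergy L (n + 1 + 2) F},
        Ord (F'.1 - F.1) (n + 3) := fun n F => by
    obtain ⟨F', h, h'⟩ := F.2.succ hL hcoeff (by omega)
    exact ⟨⟨F', h⟩, h'⟩
  choose next hnext using step
  let seq : ∀ n, {F : Series K (ext p) // ApproxFreeEnergy L (n + 2) F} := fun n =>
    Nat.rec ⟨0, approxFreeEnergy_zero hcoeff⟩ next n
  have hseq : ∀ n k, Ord ((seq (n + k)).1 - (seq n).1) (n + 3) := by
    intro n k
    induction k with
    | zero => simpa using Ord.zero _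
    | succ k ih =>
      have h := (hnext (n + k) (seq (n + k))).mono (show n + 3 ≤ n + k + 3 by omega)
      convert ih.add h using 1
      change (next (n + k) (seq (n + k))).1 - _ = _
      abel
  let F : Series K (ext p) := ⟨fun m => (seq (deg m)).1.1 m, fun m hm => (seq (deg m)).1.2.1 m hm,
    fun d => ((seq d).1.2.2 d).subset (by
      rintro m ⟨rfl, hm⟩
      exact ⟨rfl, hm⟩)⟩
  have hlim : ∀ n, Ord (F - (seq n).1) (n + 3) := by
    intro n m hm
    change (seq (deg m)).1.1 m - (seq n).1.1 m = 0
    rcases le_total n (deg m) with h | h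
    · obtain ⟨k, hk⟩ := Nat.exists_eq_add_of_le h
      rw [hk]
      exact hseq n k m hm
    · obtain ⟨k, hk⟩ := Nat.exists_eq_add_of_le h
      have h1 := hseq (deg m) k m (by omega)
      rw [coe_sub, ← hk] at h1
      rw [← neg_eq_zero, neg_sub]
      exact h1
  have heven : HasParity (ext p) F 0 := fun m hm => (seq (deg m)).2.even m hm
  have hord : Ord F 3 := fun m hm => (seq (deg m)).2.ord m hm
  have hann : ∀ i, psi F (L (Pi.single i 1)) (one K (ext p)) = 0 := by
    intro i
    refine Ord.eq_zero fun n => ?_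
    have h1 := ord_psi_sub_psi hcoeff (seq n).2.even (seq n).2.ord heven hord (d := n + 2)
      (hlim n) i
    have h2 := (hlim n).partialD (i : WithBot I)
    have h3 := (seq n).2.annihilates i
    have h4 := ((h2.mono (show n ≤ n + 3 - 1 by omega)).sub (h1.mono (show n ≤ _ by omega))).add
      (h3.mono (show n ≤ n + 2 by omega))
    convert h4 using 1
    abel
  refine ⟨F, heven, fun k => (seq (deg (k, 0))).2.no_constant k, fun m hm => ?_, fun φ => ?_⟩
  · by_contra h
    exact hm (hord m (by omega))
  · have h1 := sumsTo_psi hord (good_airy hL heven hord φ 0).base.2 (one K (ext p))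
    have h2 : psi F (L φ) (one K (ext p)) = 0 :=
      Ord.eq_zero fun N => (sumsTo_psi_airy hL heven hord φ (one K (ext p))).ord fun i => by
        rw [hann, smul_zero]; exact Ord.zero _
    rwa [h2] at h1

lemma IsFreeEnergy.ord {F : Series K (ext p)} (hF : IsFreeEnergy p L F) : Ord F 3 := by
  intro m hm
  by_contra h
  have := hF.degree_ge m h
  omega

/-- The system of quadratic differential equations satisfied by a free energy. -/
lemma IsFreeEnergy.riccati [CharZero K] (hL : IsSuperQuantumAiry p L)
    (hcoeff : HasCoefficients p L A B C D) {F : Series K (ext p)} (hF : IsFreeEnergy p L F)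
    (i : I) : SumsTo (ext p) (ricTerm A B C F i)
      (partialD K (ext p) (i : WithBot I) F - D i • hbar K (ext p)) := by
  have h := SuperAiry.riccati hcoeff hF.even hF.ord i
  have h1 := sumsTo_psi hF.ord (good_airy hL hF.even hF.ord (Pi.single i 1) 0).base.2
    (one K (ext p))
  rwa [h1.unique (hF.annihilates _), sub_zero] at h

end Existence

section Taylor

variable {K : Type*} [Field K] {I : Type*} [LinearOrder I] {p : I → ZMod 2}

/-! ### Taylor coefficients -/

variable (p) in
/-- The Taylor coefficient of `ħ ^ g` in `∂_{a_n} ⋯ ∂_{a_1} f` at `x = 0`, for the list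
`[a_1, …, a_n]`. -/
def taylor (K : Type*) [Field K] (g : ℕ) : List (WithBot I) → (Series K (ext p) →ₗ[K] K)
  | [] => coeff (g, 0)
  | a :: l => taylor K g l ∘ₗ partialD K (ext p) a

@[simp] lemma taylor_nil (g : ℕ) (f : Series K (ext p)) : taylor p K g [] f = f.1 (g, 0) := rfl

@[simp] lemma taylor_cons (g : ℕ) (a : WithBot I) (l : List (WithBot I)) (f : Series K (ext p)) :
    taylor p K g (a :: l) f = taylor p K g l (partialD K (ext p) a f) := rfl

lemma taylor_of_ord {g : ℕ} {l : List (WithBot I)} {f : Series K (ext p)}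
    (h : Ord f (2 * g + l.length + 1)) : taylor p K g l f = 0 := by
  induction l generalizing f with
  | nil => exact h _ (by simp [deg])
  | cons a l ih =>
    rw [taylor_cons]
    refine ih ((h.partialD a).mono ?_)
    rw [List.length_cons]
    omega

lemma gradedSymmetric_taylor (f : Series K (ext p)) :
    GradedSymmetric p fun g l => taylor p K g l f := by
  intro g l a b l'
  induction l generalizing f with
  | nil =>
    simp only [List.nil_append, taylor_cons]
    rw [partialD_partialD, map_smul, smul_eq_mul, mul_comm (ext p b), chi_eq]
  | cons c l ih => exact ih (partialD K (ext p) c f)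

/-- Only finitely many first derivatives of a series matter in a given degree. -/
lemma exists_finset_partialD (f : Series K (ext p)) (N : ℕ) :
    ∃ T : Finset (WithBot I), ∀ a ∉ T, Ord (partialD K (ext p) a f) N := by
  classical
  refine ⟨(finite_lt f (N + 1)).toFinset.biUnion fun m => m.2.support, fun a ha m hm => ?_⟩
  rw [coe_partialD]
  by_contra h
  apply ha
  rw [mem_biUnion]
  refine ⟨_, (finite_lt f (N + 1)).mem_toFinset.2 ⟨?_, right_ne_zero_of_mul h⟩, ?_⟩
  · rw [deg_add_single]; omega
  · simp

lemma finite_taylor (f : Series K (ext p)) (g n : ℕ) :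
    {l : List (WithBot I) | l.length = n ∧ taylor p K g l f ≠ 0}.Finite := by
  classical
  induction n generalizing f with
  | zero =>
    refine (Set.finite_singleton []).subset fun l hl => ?_
    exact List.length_eq_zero_iff.1 hl.1
  | succ n ih =>
    obtain ⟨T, hT⟩ := exists_finset_partialD f (2 * g + n + 1)
    refine (T.finite_toSet.biUnion fun a _ =>
      (ih (partialD K (ext p) a f)).image (List.cons a)).subset ?_
    rintro l ⟨h1, h2⟩
    cases l with
    | nil => simp at h1
    | cons a l =>
      simp only [List.length_cons, Nat.add_right_cancel_iff] at h1
      simp only [Set.mem_iUnion]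
      refine ⟨a, ?_, ⟨l, ⟨h1, h2⟩, rfl⟩⟩
      by_contra ha
      exact h2 (taylor_of_ord (f := partialD K (ext p) a f) (by rw [h1]; exact hT a ha))

lemma taylor_hbar_succ (g : ℕ) (l : List (WithBot I)) (f : Series K (ext p)) :
    taylor p K (g + 1) l (mul K (ext p) (hbar K (ext p)) f) = taylor p K g l f := by
  induction l generalizing f with
  | nil => simp [coe_hbar_mul]
  | cons a l ih => rw [taylor_cons, taylor_cons, partialD_hbar, ih]

lemma taylor_hbar_zero (l : List (WithBot I)) (f : Series K (ext p)) :
    taylor p K 0 l (mul K (ext p) (hbar K (ext p)) f) = 0 := by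
  induction l generalizing f with
  | nil => simp [coe_hbar_mul]
  | cons a l ih => rw [taylor_cons, partialD_hbar, ih]

lemma coe_one (m : Mono (WithBot I)) : (one K (ext p)).1 m = if m = (0, 0) then 1 else 0 := by
  classical
  rw [one_eq, coe_mon]
  simp [admissible_zero]

lemma taylor_one (g : ℕ) (l : List (WithBot I)) :
    taylor p K g l (one K (ext p)) = if g = 0 ∧ l = [] then 1 else 0 := by
  cases l with
  | nil => simp [coe_one]
  | cons a l => simp [partialD_one]

lemma taylor_hbar (g : ℕ) (i : I) (D : I → K) (l : List (WithBot I)) :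
    D i * taylor p K g l (hbar K (ext p)) = termD D i g l := by
  rw [← mul_one_series (hbar K (ext p))]
  cases g with
  | zero => rw [taylor_hbar_zero, mul_zero]; rfl
  | succ g =>
    rw [taylor_hbar_succ, taylor_one]
    cases g with
    | zero => cases l <;> simp [termD]
    | succ g => simp [termD]

/-- A coefficient of `x ^ a f` depends only on the coefficient of the quotient monomial in `f`. -/
lemma coe_X_mul_eq_zero {a : WithBot I} {f : Series K (ext p)} {k : ℕ} {e : WithBot I →₀ ℕ}
    (h : ∀ e', Finsupp.single a 1 + e' = e → f.1 (k, e') = 0) :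
    (mul K (ext p) (X K (ext p) a) f).1 (k, e) = 0 := by
  classical
  change rawMul K (ext p) _ _ (k, e) = 0
  rw [rawMul]
  split_ifs
  · refine sum_eq_zero fun x hx => sum_eq_zero fun y hy => ?_
    rw [HasAntidiagonal.mem_antidiagonal] at hx hy
    rw [X_eq, coe_mon]
    split_ifs with h1
    · simp only [Prod.mk.injEq] at h1
      have h2 : x.2 = k := by
        rw [h1.2.1, zero_add] at hx
        exact hx
      rw [h2, h _ (h1.2.2 ▸ hy), mul_zero]
    · rw [mul_zero, zero_mul]
  · rfl

lemma coe_X_mul_zero (a : WithBot I) (f : Series K (ext p)) (k : ℕ) :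
    (mul K (ext p) (X K (ext p) a) f).1 (k, 0) = 0 := by
  refine coe_X_mul_eq_zero fun e' h => ?_
  have := DFunLike.congr_fun h a
  simp at this

lemma taylor_X (g : ℕ) (a : WithBot I) (l : List (WithBot I)) :
    taylor p K g l (X K (ext p) a) = if g = 0 ∧ l = [a] then 1 else 0 := by
  rw [← mul_one_series (X K (ext p) a)]
  cases l with
  | nil => simp [coe_X_mul_zero]
  | cons b l =>
    rw [taylor_cons, partialD_X, partialD_one]
    simp only [map_zero, smul_zero, add_zero, map_smul, taylor_one, smul_eq_mul, List.cons.injEq]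
    split_ifs <;> simp_all

/-! ### Splitting ordered sets of indices -/

lemma sum_finset_fin_succ {M : Type*} [AddCommMonoid M] {n : ℕ} (F : Finset (Fin (n + 1)) → M) :
    ∑ S, F S = ∑ S : Finset (Fin n), F (S.map (Fin.succEmb n)) +
      ∑ S : Finset (Fin n), F (insert 0 (S.map (Fin.succEmb n))) := by
  classical
  have h0 : (0 : Fin (n + 1)) ∉ univ.map (Fin.succEmb n) := by
    simp [Fin.succ_ne_zero]
  have h1 : (univ : Finset (Fin (n + 1))) = insert 0 (univ.map (Fin.succEmb n)) := by
    ext i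
    refine Fin.cases ?_ (fun i => ?_) i <;> simp
  have h2 : (univ.map (Fin.succEmb n)).powerset =
      univ.map (mapEmbedding (Fin.succEmb n)).toEmbedding := by
    ext t
    simp only [mem_powerset, subset_map_iff, mem_map, mem_univ, true_and, subset_univ,
      RelEmbedding.coe_toEmbedding, mapEmbedding_apply]
    exact exists_congr fun u => eq_comm
  rw [← powerset_univ, h1, sum_powerset_insert h0, h2, sum_map, sum_map]
  rfl

lemma compl_map_succ {n : ℕ} (S : Finset (Fin n)) :
    (S.map (Fin.succEmb n))ᶜ = insert 0 (Sᶜ.map (Fin.succEmb n)) := by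
  ext i
  refine Fin.cases ?_ (fun i => ?_) i <;> simp [Fin.succ_ne_zero]

lemma compl_insert_map_succ {n : ℕ} (S : Finset (Fin n)) :
    (insert 0 (S.map (Fin.succEmb n)))ᶜ = Sᶜ.map (Fin.succEmb n) := by
  ext i
  refine Fin.cases ?_ (fun i => ?_) i <;> simp [Fin.succ_ne_zero]

lemma sub_map_succ (a : WithBot I) (Φ : List (WithBot I)) (S : Finset (Fin Φ.length)) :
    sub (a :: Φ) (S.map (Fin.succEmb Φ.length)) = sub Φ S := by
  change ((List.finRange (Φ.length + 1)).filter _).map _ = _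
  rw [List.finRange_succ, List.filter_cons_of_neg (by simp [Fin.succ_ne_zero]), List.filter_map,
    List.map_map, sub]
  congr 1
  refine List.filter_congr fun i _ => ?_
  simp

lemma sub_insert_map_succ (a : WithBot I) (Φ : List (WithBot I)) (S : Finset (Fin Φ.length)) :
    sub (a :: Φ) (insert 0 (S.map (Fin.succEmb Φ.length))) = a :: sub Φ S := by
  change ((List.finRange (Φ.length + 1)).filter _).map _ = _
  rw [List.finRange_succ, List.filter_cons_of_pos (by simp), List.filter_map, List.map_cons,
    List.map_map, sub]
  congr 2
  refine List.filter_congr fun i _ => ?_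
  simp [Fin.succ_ne_zero]

lemma sigma_map_succ (a : WithBot I) (Φ : List (WithBot I)) (S : Finset (Fin Φ.length)) :
    sigma p K (a :: Φ) (S.map (Fin.succEmb Φ.length)) =
      (∏ l ∈ S, chi K (ext p a * ext p (Φ.get l))) * sigma p K Φ S := by
  have h0 : (0 : Fin (Φ.length + 1)) ∉ Sᶜ.map (Fin.succEmb Φ.length) := by
    simp [Fin.succ_ne_zero]
  have h := compl_map_succ S
  change ∏ k ∈ (S.map (Fin.succEmb Φ.length))ᶜ, _ = _
  rw [h, prod_insert h0, prod_map, prod_map]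
  congr 1
  · refine prod_congr rfl fun k _ => ?_
    rw [prod_map]
    refine prod_congr rfl fun l _ => ?_
    simp

lemma sigma_insert_map_succ (a : WithBot I) (Φ : List (WithBot I)) (S : Finset (Fin Φ.length)) :
    sigma p K (a :: Φ) (insert 0 (S.map (Fin.succEmb Φ.length))) = sigma p K Φ S := by
  have h0 : (0 : Fin (Φ.length + 1)) ∉ S.map (Fin.succEmb Φ.length) := by
    simp [Fin.succ_ne_zero]
  have h := compl_insert_map_succ S
  change ∏ k ∈ (insert 0 (S.map (Fin.succEmb Φ.length)))ᶜ, _ = _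
  rw [h, prod_map]
  refine prod_congr rfl fun k _ => ?_
  refine (prod_insert h0).trans ?_
  rw [prod_map, if_neg (by simp), one_mul]
  refine prod_congr rfl fun l _ => ?_
  simp

lemma toFinset_filter_finRange {n : ℕ} (S : Finset (Fin n)) :
    ((List.finRange n).filter (· ∈ S)).toFinset = S := by
  ext; simp

lemma length_sub (Φ : List (WithBot I)) (S : Finset (Fin Φ.length)) :
    (sub Φ S).length = #S := by
  rw [sub, List.length_map, ← List.toFinset_card_of_nodup ((List.nodup_finRange _).filter _),
    toFinset_filter_finRange]

lemma prod_chi_sub (q : ZMod 2) (Φ : List (WithBot I)) (S : Finset (Fin Φ.length)) :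
    ∏ l ∈ S, chi K (q * ext p (Φ.get l)) = chi K (q * ((sub Φ S).map (ext p)).sum) := by
  have h1 : ((sub Φ S).map (ext p)).sum = ∑ l ∈ S, ext p (Φ.get l) := by
    conv_rhs => rw [← toFinset_filter_finRange S]
    rw [List.sum_toFinset _ ((List.nodup_finRange _).filter _), sub, List.map_map]
    rfl
  rw [h1, mul_sum]
  induction S using Finset.induction_on with
  | empty => simp
  | insert l S hl ih =>
    rw [prod_insert hl, sum_insert hl, chi_add, ih]
    rw [← toFinset_filter_finRange S, List.sum_toFinset _ ((List.nodup_finRange _).filter _),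
      toFinset_filter_finRange, sub, List.map_map]
    rfl

/-! ### Taylor coefficients of products -/

lemma partialD_tau (a : WithBot I) (q : ZMod 2) (f : Series K (ext p)) :
    partialD K (ext p) a (tau K (ext p) q f) =
      chi K (q * ext p a) • tau K (ext p) q (partialD K (ext p) a f) := by
  refine series_ext fun m => ?_
  rw [coe_smul, coe_tau, coe_partialD, coe_partialD, coe_tau, monoParity_add, monoParity_single,
    mul_add q, chi_add]
  ring

lemma taylor_tau (g : ℕ) (q : ZMod 2) (l : List (WithBot I)) (f : Series K (ext p)) :
    taylor p K g l (tau K (ext p) q f) = chi K (q * (l.map (ext p)).sum) * taylor p K g l f := by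
  induction l generalizing f with
  | nil => simp [coe_tau]
  | cons a l ih =>
    rw [taylor_cons, taylor_cons, partialD_tau, map_smul, ih, List.map_cons, List.sum_cons, mul_add,
      chi_add, smul_eq_mul, mul_assoc]

/-- The iterated Leibniz rule. -/
lemma taylor_mul (g : ℕ) (Φ : List (WithBot I)) (f h : Series K (ext p)) :
    taylor p K g Φ (mul K (ext p) f h) = ∑ gg ∈ antidiagonal g, ∑ S : Finset (Fin Φ.length),
      sigma p K Φ S * taylor p K gg.1 (sub Φ S) f * taylor p K gg.2 (sub Φ Sᶜ) h := by
  induction Φ generalizing f h with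
  | nil =>
    change rawMul K (ext p) _ _ (g, 0) = _
    rw [rawMul, if_pos admissible_zero]
    refine sum_congr rfl fun gg _ => ?_
    have h1 : (univ : Finset (Finset (Fin ([] : List (WithBot I)).length))) = {∅} := by
      rfl
    rw [h1, sum_singleton, HasAntidiagonal.antidiagonal_zero, sum_singleton]
    simp [crossings, sigma, sub]
  | cons a Φ ih =>
    rw [taylor_cons, partialD_mul, map_add, ih, ih, ← sum_add_distrib]
    refine sum_congr rfl fun gg _ => ?_
    refine Eq.trans ?_ (sum_finset_fin_succ (n := Φ.length) (fun S => sigma p K (a :: Φ) S *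
      taylor p K gg.1 (sub (a :: Φ) S) f * taylor p K gg.2 (sub (a :: Φ) Sᶜ) h)).symm
    rw [add_comm]
    congr 1
    · refine sum_congr rfl fun S _ => ?_
      have h1 := compl_map_succ S
      have h2 : sub (a :: Φ) (S.map (Fin.succEmb Φ.length))ᶜ = a :: sub Φ Sᶜ :=
        (congrArg (sub (a :: Φ)) h1).trans (sub_insert_map_succ a Φ Sᶜ)
      rw [h2, sub_map_succ, sigma_map_succ, prod_chi_sub, taylor_tau, taylor_cons]
      ring
    · refine sum_congr rfl fun S _ => ?_
      have h1 := compl_insert_map_succ S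
      have h2 : sub (a :: Φ) (insert 0 (S.map (Fin.succEmb Φ.length)))ᶜ = sub Φ Sᶜ :=
        (congrArg (sub (a :: Φ)) h1).trans (sub_map_succ a Φ Sᶜ)
      rw [h2, sub_insert_map_succ, sigma_insert_map_succ, taylor_cons]

lemma taylor_X_mul (g : ℕ) (a : WithBot I) (Φ : List (WithBot I)) (f : Series K (ext p)) :
    taylor p K g Φ (mul K (ext p) (X K (ext p) a) f) = ∑ k : Fin Φ.length, sigma p K Φ {k} *
      if a = Φ.get k then taylor p K g (Φ.eraseIdx k) f else 0 := by
  induction Φ generalizing f with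
  | nil => simp [coe_X_mul_zero]
  | cons c Φ ih =>
    rw [taylor_cons, partialD_X, map_add, map_smul, map_smul, ih]
    refine Eq.trans ?_ (Fin.sum_univ_succ (n := Φ.length) (fun k => sigma p K (c :: Φ) {k} *
      if a = (c :: Φ).get k then taylor p K g ((c :: Φ).eraseIdx k) f else 0)).symm
    congr 1
    · have h1 := sigma_insert_map_succ (p := p) (K := K) c Φ ∅
      rw [map_empty, insert_empty_eq] at h1
      rw [h1]
      by_cases hca : c = a
      · simp [hca, sigma]
      · simp [hca, Ne.symm hca]
    · rw [smul_eq_mul, mul_sum]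
      refine sum_congr rfl fun k _ => ?_
      have h1 := sigma_map_succ (p := p) (K := K) c Φ {k}
      rw [map_singleton, prod_singleton] at h1
      change _ = sigma p K (c :: Φ) {k.succ} *
        if a = Φ.get k then taylor p K g (c :: Φ.eraseIdx k) f else 0
      change sigma p K (c :: Φ) {k.succ} = _ at h1
      rw [h1]
      by_cases hak : a = Φ.get k
      · rw [if_pos hak, if_pos hak, ← hak, taylor_cons]
        ring
      · rw [if_neg hak, if_neg hak]
        ring

end Taylor

section Recursion

variable {K : Type*} [Field K] {I : Type*} [LinearOrder I] {p : I → ZMod 2}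
  {L : (I → K) →ₗ[K] Module.End K (Series K (ext p))}
  {A B C : I → WithBot I → WithBot I → K} {D : I → K}

/-! ### The topological recursion -/

lemma X_mul_X (a b : WithBot I) : mul K (ext p) (X K (ext p) a) (X K (ext p) b) =
    chi K (ext p a * ext p b) • mul K (ext p) (X K (ext p) b) (X K (ext p) a) := by
  rw [← mul_one_series (X K (ext p) b), X_X, mul_one_series, mul_one_series]

lemma taylor_X_mul_of_notMem {g : ℕ} {a : WithBot I} {Φ : List (WithBot I)} (ha : a ∉ Φ)
    (f : Series K (ext p)) : taylor p K g Φ (mul K (ext p) (X K (ext p) a) f) = 0 := by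
  rw [taylor_X_mul]
  refine sum_eq_zero fun k _ => ?_
  rw [if_neg, mul_zero]
  rintro rfl
  exact ha (List.get_mem Φ k)

lemma taylor_X_mul_X (g : ℕ) (a b : WithBot I) (Φ : List (WithBot I)) :
    taylor p K g Φ (mul K (ext p) (X K (ext p) a) (X K (ext p) b)) =
      (if g = 0 ∧ Φ = [a, b] then 1 else 0) +
        chi K (ext p a * ext p b) * (if g = 0 ∧ Φ = [b, a] then 1 else 0) := by
  cases Φ with
  | nil => simp [coe_X_mul_zero]
  | cons c Φ =>
    have h : partialD K (ext p) c (X K (ext p) b) =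
        (if c = b then (1 : K) else 0) • one K (ext p) := by
      rw [← mul_one_series (X K (ext p) b), partialD_X, partialD_one, map_zero, smul_zero, add_zero]
    rw [taylor_cons, partialD_X, h, map_add, map_smul, map_smul, map_smul, map_smul,
      mul_one_series, taylor_X, taylor_X]
    simp only [smul_eq_mul, List.cons.injEq]
    congr 1
    · by_cases hc : c = a <;> simp [hc]
    · by_cases hc : c = b
      · simp [hc, mul_comm (ext p b)]
      · simp [hc]

/-- The recursion is obtained by taking Taylor coefficients in the differential equations for the
free energy. -/
lemma topologicalRecursion_taylor [CharZero K] (hL : IsSuperQuantumAiry p L)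
    (hcoeff : HasCoefficients p L A B C D) {F : Series K (ext p)} (hF : IsFreeEnergy p L F) :
    TopologicalRecursion p A B C D fun g l => taylor p K g l F := by
  classical
  intro g i Φ
  -- Outside the finite set `T` of indices, all the sums below have vanishing terms.
  obtain ⟨T₀, hT₀⟩ := exists_finset_partialD F (2 * g + Φ.length + 4)
  set T := T₀ ∪ Φ.toFinset with hT
  have hTD : ∀ b ∉ T, Ord (partialD K (ext p) b F) (2 * g + Φ.length + 4) := fun b hb =>
    hT₀ b fun h => hb (mem_union_left _ h)
  have hTΦ : ∀ b ∉ T, b ∉ Φ := fun b hb h => hb (mem_union_right _ (List.mem_toFinset.2 h))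
  have hΦT : ∀ k, Φ.get k ∈ T := fun k => by
    by_contra h
    exact hTΦ _ h (List.get_mem Φ k)
  have hA : ∀ ab ∉ T ×ˢ T, taylor p K g Φ
      (mul K (ext p) (X K (ext p) ab.1) (X K (ext p) ab.2)) = 0 := by
    rintro ⟨a, b⟩ hab
    rw [mem_product, not_and_or] at hab
    rcases hab with h | h
    · exact taylor_X_mul_of_notMem (hTΦ a h) _
    · rw [X_mul_X, map_smul, taylor_X_mul_of_notMem (hTΦ b h), smul_zero]
  have hB : ∀ ab ∉ T ×ˢ T, taylor p K g Φ
      (mul K (ext p) (X K (ext p) ab.1) (partialD K (ext p) ab.2 F)) = 0 := by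
    rintro ⟨a, b⟩ hab
    rw [mem_product, not_and_or] at hab
    rcases hab with h | h
    · exact taylor_X_mul_of_notMem (hTΦ a h) _
    · exact taylor_of_ord (((ord_X a).mul (hTD b h)).mono (by omega))
  have hC1' : ∀ ab ∉ T ×ˢ T, Ord (partialD K (ext p) ab.1 (partialD K (ext p) ab.2 F))
      (2 * g + Φ.length + 3) := by
    rintro ⟨a, b⟩ hab
    rw [mem_product, not_and_or] at hab
    rcases hab with h | h
    · rw [partialD_partialD]
      exact (((hTD a h).partialD b).mono (by omega)).smul _
    · exact ((hTD b h).partialD a).mono (by omega)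
  have hC1 : ∀ ab ∉ T ×ˢ T, taylor p K g Φ (mul K (ext p) (hbar K (ext p))
      (partialD K (ext p) ab.1 (partialD K (ext p) ab.2 F))) = 0 := fun ab hab =>
    taylor_of_ord ((ord_hbar.mul (hC1' ab hab)).mono (by omega))
  have hC2 : ∀ ab ∉ T ×ˢ T, taylor p K g Φ
      (mul K (ext p) (partialD K (ext p) ab.1 F) (partialD K (ext p) ab.2 F)) = 0 := by
    rintro ⟨a, b⟩ hab
    rw [mem_product, not_and_or] at hab
    rcases hab with h | h
    · exact taylor_of_ord (((hTD a h).mul (Ord.of_zero _)).mono (by omega))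
    · exact taylor_of_ord (((Ord.of_zero _).mul (hTD b h)).mono (by omega))
  have hterm : ∀ ab, taylor p K g Φ (ricTerm A B C F i ab) =
      1 / 2 * A i ab.1 ab.2 *
        taylor p K g Φ (mul K (ext p) (X K (ext p) ab.1) (X K (ext p) ab.2)) +
      B i ab.1 ab.2 * taylor p K g Φ
        (mul K (ext p) (X K (ext p) ab.1) (partialD K (ext p) ab.2 F)) +
      1 / 2 * (C i ab.1 ab.2 * taylor p K g Φ (mul K (ext p) (hbar K (ext p))
        (partialD K (ext p) ab.1 (partialD K (ext p) ab.2 F)))) +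
      1 / 2 * (C i ab.1 ab.2 * taylor p K g Φ
        (mul K (ext p) (partialD K (ext p) ab.1 F) (partialD K (ext p) ab.2 F))) := by
    intro ab
    simp only [ricTerm, map_add, map_smul, smul_eq_mul]
    ring
  have hsupp : (Function.support fun ab => taylor p K g Φ (ricTerm A B C F i ab)) ⊆
      ↑(T ×ˢ T) := by
    intro ab hab
    by_contra h
    rw [Function.mem_support, hterm, hA ab h, hB ab h, hC1 ab h, hC2 ab h] at hab
    simp at hab
  have hmain := (hF.riccati hL hcoeff i).map_functional (l := taylor p K g Φ)
    (N := 2 * g + Φ.length + 1) (fun f hf => taylor_of_ord hf)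
    ((T ×ˢ T).finite_toSet.subset hsupp)
  rw [finsum_eq_sum_of_support_subset _ hsupp, sum_congr rfl fun ab _ => hterm ab,
    sum_add_distrib, sum_add_distrib, sum_add_distrib, map_sub, map_smul, smul_eq_mul,
    taylor_hbar, sub_eq_iff_eq_add] at hmain
  have eA : ∑ ab ∈ T ×ˢ T, 1 / 2 * A i ab.1 ab.2 *
      taylor p K g Φ (mul K (ext p) (X K (ext p) ab.1) (X K (ext p) ab.2)) = termA A i g Φ := by
    by_cases hg : ∃ c d, g = 0 ∧ Φ = [c, d]
    · obtain ⟨c, d, rfl, rfl⟩ := hg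
      have hc : c ∈ T := hΦT ⟨0, by simp⟩
      have hd : d ∈ T := hΦT ⟨1, by simp⟩
      simp only [taylor_X_mul_X, true_and, List.cons.injEq, and_true, mul_add, sum_add_distrib]
      rw [sum_eq_single (c, d), sum_eq_single (d, c)]
      · simp only [and_self, if_true, mul_one, termA]
        have h1 := hcoeff.symm_A i c d
        rw [chi_eq] at h1
        rw [h1, mul_comm (ext p d), mul_assoc, ← mul_add, mul_comm (A i d c), ← two_mul,
          ← mul_assoc, one_div, inv_mul_cancel₀ two_ne_zero, one_mul]
      · rintro ⟨a, b⟩ _ hab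
        rw [if_neg, mul_zero, mul_zero]
        rintro ⟨rfl, rfl⟩
        exact hab rfl
      · intro h
        exact absurd (mem_product.2 ⟨hd, hc⟩) h
      · rintro ⟨a, b⟩ _ hab
        rw [if_neg, mul_zero]
        rintro ⟨rfl, rfl⟩
        exact hab rfl
      · intro h
        exact absurd (mem_product.2 ⟨hc, hd⟩) h
    · have h1 : termA A i g Φ = 0 := by
        unfold termA
        split
        · exact absurd ⟨_, _, rfl, rfl⟩ hg
        · rfl
      rw [h1]
      refine sum_eq_zero fun ab _ => ?_
      rw [taylor_X_mul_X, if_neg fun h => hg ⟨_, _, h⟩, if_neg fun h => hg ⟨_, _, h⟩]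
      ring
  have eB : ∑ ab ∈ T ×ˢ T, B i ab.1 ab.2 * taylor p K g Φ
        (mul K (ext p) (X K (ext p) ab.1) (partialD K (ext p) ab.2 F)) =
      ∑ k : Fin Φ.length, sigma p K Φ {k} *
        ∑ᶠ b : WithBot I, B i (Φ.get k) b * taylor p K g (b :: Φ.eraseIdx k) F := by
    simp only [taylor_X_mul, mul_sum]
    rw [sum_comm]
    refine sum_congr rfl fun k _ => ?_
    have hs : (Function.support fun b => B i (Φ.get k) b *
        taylor p K g (b :: Φ.eraseIdx k) F) ⊆ ↑T := by
      intro b hb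
      by_contra h
      refine right_ne_zero_of_mul hb (taylor_of_ord (f := partialD K (ext p) b F) ?_)
      refine (hTD b h).mono ?_
      have := List.length_eraseIdx_le Φ k
      omega
    rw [finsum_eq_sum_of_support_subset _ hs, sum_product, sum_eq_single (Φ.get k), mul_sum]
    · refine sum_congr rfl fun b _ => ?_
      rw [if_pos rfl, taylor_cons]
      ring
    · intro a _ ha
      refine sum_eq_zero fun b _ => ?_
      rw [if_neg ha, mul_zero, mul_zero]
    · intro h
      exact absurd (hΦT k) h
  have eC1 : ∑ ab ∈ T ×ˢ T, 1 / 2 * (C i ab.1 ab.2 * taylor p K g Φ (mul K (ext p) (hbar K (ext p))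
        (partialD K (ext p) ab.1 (partialD K (ext p) ab.2 F)))) =
      termLoop C (fun g l => taylor p K g l F) i g Φ := by
    rw [← mul_sum]
    cases g with
    | zero =>
      simp only [taylor_hbar_zero, mul_zero, sum_const_zero]
      rfl
    | succ g =>
      change _ = 1 / 2 * ∑ᶠ bc : WithBot I × WithBot I,
        C i bc.1 bc.2 * taylor p K g (bc.2 :: bc.1 :: Φ) F
      rw [finsum_eq_sum_of_support_subset (s := T ×ˢ T)]
      · simp only [taylor_hbar_succ, taylor_cons]
      · intro bc hbc
        by_contra h
        exact right_ne_zero_of_mul hbc (taylor_of_ord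
          (f := partialD K (ext p) bc.1 (partialD K (ext p) bc.2 F))
          ((hC1' bc h).mono (by omega)))
  have eC2 : ∑ ab ∈ T ×ˢ T, 1 / 2 * (C i ab.1 ab.2 * taylor p K g Φ
        (mul K (ext p) (partialD K (ext p) ab.1 F) (partialD K (ext p) ab.2 F))) =
      1 / 2 * ∑ᶠ bc : WithBot I × WithBot I, ∑ gg ∈ antidiagonal g,
        ∑ S : Finset (Fin Φ.length), sigma p K Φ S * C i bc.1 bc.2 *
          taylor p K gg.1 (bc.1 :: sub Φ S) F * taylor p K gg.2 (bc.2 :: sub Φ Sᶜ) F := by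
    have h1 : ∀ bc : WithBot I × WithBot I, ∑ gg ∈ antidiagonal g,
        ∑ S : Finset (Fin Φ.length), sigma p K Φ S * C i bc.1 bc.2 *
          taylor p K gg.1 (bc.1 :: sub Φ S) F * taylor p K gg.2 (bc.2 :: sub Φ Sᶜ) F =
        C i bc.1 bc.2 * taylor p K g Φ
          (mul K (ext p) (partialD K (ext p) bc.1 F) (partialD K (ext p) bc.2 F)) := by
      intro bc
      rw [taylor_mul, mul_sum]
      refine sum_congr rfl fun gg _ => ?_
      rw [mul_sum]
      refine sum_congr rfl fun S _ => ?_
      rw [taylor_cons, taylor_cons]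
      ring
    simp only [h1]
    rw [← mul_sum, finsum_eq_sum_of_support_subset (s := T ×ˢ T)]
    intro bc hbc
    by_contra h
    exact right_ne_zero_of_mul hbc (hC2 bc h)
  rw [eA, eB, eC1, eC2] at hmain
  change taylor p K g Φ (partialD K (ext p) (i : WithBot I) F) = _
  rw [hmain]
  ring

lemma GradedSymmetric.auxiliaryEquation {G : ℕ → List (WithBot I) → K}
    (hG : GradedSymmetric p G) : AuxiliaryEquation p G := by
  intro g a Φ
  have h := hG g [] ⊥ a Φ
  have e : ext p ⊥ * ext p a = ext p a := one_mul _
  rwa [e] at h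

lemma normalized_taylor {F : Series K (ext p)} (hF : IsFreeEnergy p L F) :
    Normalized fun g l => taylor p K g l F where
  nil g := hF.no_constant g
  unstable g l h := taylor_of_ord (hF.ord.mono (by omega))
  extra g := by
    rw [taylor_cons, taylor_nil]
    by_contra h
    have h1 := hF.even _ (right_ne_zero_of_mul h)
    rw [monoParity_add, monoParity_single, monoParity_zero, zero_add] at h1
    exact absurd h1 (one_ne_zero (α := ZMod 2))

/-- The recursive system has at most one solution. -/
lemma recursion_unique [CharZero K] {G G' : ℕ → List (WithBot I) → K}
    (hG : TopologicalRecursion p A B C D G) (hGa : AuxiliaryEquation p G) (hGn : Normalized G)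
    (hG' : TopologicalRecursion p A B C D G') (hGa' : AuxiliaryEquation p G')
    (hGn' : Normalized G') : G' = G := by
  have hbot : ∀ {H : ℕ → List (WithBot I) → K}, AuxiliaryEquation p H → ∀ g Φ,
      H g (⊥ :: ⊥ :: Φ) = 0 := by
    intro H hH g Φ
    have h := hH g ⊥ Φ
    have e : (-1 : K) ^ (ext p ⊥).val = -1 := chi_one
    rw [e, neg_one_mul, self_eq_neg] at h
    exact h
  have key : ∀ N g l, 2 * g + l.length = N → G' g l = G g l := by
    intro N
    induction N using Nat.strong_induction_on with
    | _ N ih =>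
      have hrec : ∀ g (i : I) Φ, 2 * g + Φ.length + 1 = N →
          G' g ((i : WithBot I) :: Φ) = G g ((i : WithBot I) :: Φ) := by
        intro g i Φ hN
        rw [hG g i Φ, hG' g i Φ]
        congr 1
        · congr 1
          · congr 1
            refine sum_congr rfl fun k _ => ?_
            congr 1
            refine finsum_congr fun b => ?_
            rw [ih (2 * g + (b :: Φ.eraseIdx k).length) _ _ _ rfl]
            rw [List.length_cons, List.length_eraseIdx_of_lt k.2]
            have := k.2
            omega
          · cases g with
            | zero => rfl
            | succ g =>
              change 1 / 2 * _ = 1 / 2 * _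
              congr 1
              refine finsum_congr fun bc => ?_
              rw [ih (2 * g + (bc.2 :: bc.1 :: Φ).length) _ _ _ rfl]
              simp only [List.length_cons]
              omega
        · congr 1
          refine finsum_congr fun bc => sum_congr rfl fun gg hgg => sum_congr rfl fun S _ => ?_
          rw [HasAntidiagonal.mem_antidiagonal] at hgg
          have h1 : (sub Φ S).length + (sub Φ Sᶜ).length = Φ.length := by
            rw [length_sub, length_sub, card_add_card_compl, Fintype.card_fin]
          by_cases h2 : 2 * gg.1 + (bc.1 :: sub Φ S).length < 3
          · rw [hGn.unstable _ _ h2, hGn'.unstable _ _ h2]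
            ring
          by_cases h3 : 2 * gg.2 + (bc.2 :: sub Φ Sᶜ).length < 3
          · rw [hGn.unstable _ _ h3, hGn'.unstable _ _ h3]
            ring
          simp only [List.length_cons] at h2 h3
          rw [ih (2 * gg.1 + (bc.1 :: sub Φ S).length) _ _ _ rfl,
            ih (2 * gg.2 + (bc.2 :: sub Φ Sᶜ).length) _ _ _ rfl]
          · simp only [List.length_cons]
            omega
          · simp only [List.length_cons]
            omega
      intro g l hN
      cases l with
      | nil => rw [hGn.nil, hGn'.nil]
      | cons a Φ =>
        rw [List.length_cons] at hN
        induction a using WithBot.recBotCoe with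
        | coe i => exact hrec g i Φ (by omega)
        | bot =>
          cases Φ with
          | nil => rw [hGn.extra, hGn'.extra]
          | cons b Ψ =>
            induction b using WithBot.recBotCoe with
            | bot => rw [hbot hGa, hbot hGa']
            | coe j =>
              rw [hGa, hGa', hrec g j (⊥ :: Ψ)]
              simp only [List.length_cons] at hN ⊢
              omega
  funext g l
  exact key _ g l rfl

/-! ### Words and the expansion of the free energy -/

lemma word_cons (g : ℕ) (a : WithBot I) (l : List (WithBot I)) :
    word (K := K) p g (a :: l) = mul K (ext p) (X K (ext p) a) (word p g l) := by
  have h : ∀ (g : ℕ) (f : Series K (ext p)),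
      (mul K (ext p) (hbar K (ext p)) ^ g) (mul K (ext p) (X K (ext p) a) f) =
        mul K (ext p) (X K (ext p) a) ((mul K (ext p) (hbar K (ext p)) ^ g) f) := by
    intro g f
    induction g with
    | zero => rfl
    | succ g ih => rw [pow_succ', Module.End.mul_apply, ih, hbar_X, Module.End.mul_apply]
  exact h g _

lemma word_nil (g : ℕ) : word (K := K) p g [] = mon K (ext p) g 0 := by
  induction g with
  | zero => exact one_eq
  | succ g ih =>
    rw [← hbar_mon, ← ih, word, pow_succ', Module.End.mul_apply]
    rfl

/-- The exponents of the monomial `x ^ {a_1} ⋯ x ^ {a_n}`. -/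
def content (l : List (WithBot I)) : WithBot I →₀ ℕ := (l.map fun a => Finsupp.single a 1).sum

lemma content_cons (a : WithBot I) (l : List (WithBot I)) :
    content (a :: l) = Finsupp.single a 1 + content l := by
  simp [content]

lemma content_apply [DecidableEq I] (l : List (WithBot I)) (a : WithBot I) :
    content l a = l.count a := by
  induction l with
  | nil => simp [content]
  | cons b l ih =>
    rw [content_cons, Finsupp.add_apply, ih, List.count_cons, Finsupp.single_apply, add_comm]
    simp

lemma degree_content (l : List (WithBot I)) : (content l).degree = l.length := by
  induction l with
  | nil => simp [content]
  | cons b l ih => rw [content_cons, map_add, ih, Finsupp.degree_single, List.length_cons, add_comm]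

lemma word_eq (g : ℕ) (l : List (WithBot I)) :
    ∃ c : K, c * c = 1 ∧ word p g l = c • mon K (ext p) g (content l) := by
  induction l with
  | nil => exact ⟨1, one_mul 1, by rw [word_nil, one_smul]; rfl⟩
  | cons a l ih =>
    obtain ⟨c, hc, h⟩ := ih
    refine ⟨c * (-1) ^ cr (ext p) (Finsupp.single a 1) (content l), ?_, ?_⟩
    · rw [mul_mul_mul_comm, hc, sign_mul_self, one_mul]
    · rw [word_cons, h, map_smul, X_mon, smul_smul, content_cons, add_comm]

lemma coe_word_ne_zero {g : ℕ} {l : List (WithBot I)} {m : Mono (WithBot I)}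
    (h : (word (K := K) p g l).1 m ≠ 0) : m = (g, content l) := by
  classical
  obtain ⟨c, -, hw⟩ := word_eq (K := K) (p := p) g l
  rw [hw, coe_smul, coe_mon] at h
  by_contra hc
  exact h (by rw [if_neg fun h' => hc h'.2, mul_zero])

/-- The words of length `n` in the alphabet `T`. -/
def wordsOver (T : Finset (WithBot I)) : ℕ → Finset (List (WithBot I))
  | 0 => {[]}
  | n + 1 => (T ×ˢ wordsOver T n).map
      ⟨fun al => al.1 :: al.2, fun _ _ h => Prod.ext (List.cons.inj h).1 (List.cons.inj h).2⟩

lemma mem_wordsOver {T : Finset (WithBot I)} {n : ℕ} {l : List (WithBot I)} :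
    l ∈ wordsOver T n ↔ l.length = n ∧ ∀ a ∈ l, a ∈ T := by
  induction n generalizing l with
  | zero =>
    rw [wordsOver, mem_singleton, List.length_eq_zero_iff]
    constructor
    · rintro rfl
      simp
    · exact fun h => h.1
  | succ n ih =>
    rw [wordsOver, mem_map]
    cases l with
    | nil => simp
    | cons a l =>
      simp only [mem_product, Prod.exists, List.length_cons, Nat.add_right_cancel_iff,
        List.forall_mem_cons]
      constructor
      · rintro ⟨b, l', ⟨hb, hl⟩, heq⟩
        obtain ⟨rfl, rfl⟩ := List.cons.inj heq
        exact ⟨(ih.1 hl).1, hb, (ih.1 hl).2⟩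
      · rintro ⟨h1, h2, h3⟩
        exact ⟨a, l, ⟨h2, ih.2 ⟨h1, h3⟩⟩, rfl⟩

/-- Taylor's formula, a consequence of Euler's identity `∑ₐ x ^ a ∂ₐ f = n f` for `f` of degree `n`
in the variables. -/
lemma taylor_formula (f : Series K (ext p)) (g : ℕ) (T : Finset (WithBot I))
    {e : WithBot I →₀ ℕ} {n : ℕ} (hn : e.degree = n) (he : e.support ⊆ T) :
    ∑ l ∈ wordsOver T n, taylor p K g l f * (word (K := K) p g l).1 (g, e) =
      (n.factorial : K) * f.1 (g, e) := by
  classical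
  induction n generalizing f e with
  | zero =>
    rw [Finsupp.degree_eq_zero_iff] at hn
    subst hn
    rw [wordsOver, sum_singleton, taylor_nil, word_nil, coe_mon, if_pos ⟨admissible_zero, rfl⟩]
    simp
  | succ n ih =>
    rw [wordsOver, sum_map, sum_product]
    have h1 : ∀ a ∈ T, ∑ l ∈ wordsOver T n, taylor p K g (a :: l) f *
        (word (K := K) p g (a :: l)).1 (g, e) = (n.factorial : K) * ((e a : K) * f.1 (g, e)) := by
      intro a _
      have h2 : (mul K (ext p) (X K (ext p) a) (∑ l ∈ wordsOver T n,
          taylor p K g (a :: l) f • word p g l - (n.factorial : K) • partialD K (ext p) a f)).1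
          (g, e) = 0 := by
        refine coe_X_mul_eq_zero fun e' he' => ?_
        rw [coe_sub, coe_sum, coe_smul, sub_eq_zero]
        refine ih (partialD K (ext p) a f) ?_ ?_
        · rw [← he', map_add, Finsupp.degree_single] at hn
          omega
        · refine subset_trans (fun b hb => ?_) he
          rw [Finsupp.mem_support_iff] at hb ⊢
          rw [← he', Finsupp.add_apply]
          omega
      rw [map_sub, map_sum, map_smul, coe_sub, coe_sum, coe_smul, sub_eq_zero,
        coe_X_partialD] at h2
      rw [← h2]
      refine sum_congr rfl fun l _ => ?_
      rw [map_smul, coe_smul, word_cons]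
    change ∑ a ∈ T, ∑ l ∈ wordsOver T n, taylor p K g (a :: l) f *
        (word (K := K) p g (a :: l)).1 (g, e) = _
    rw [sum_congr rfl h1, ← mul_sum, ← sum_mul, ← Nat.cast_sum, Nat.factorial_succ]
    have h3 : ∑ a ∈ T, e a = n + 1 := by
      rw [← hn, Finsupp.degree_apply]
      exact (sum_subset he fun a _ ha => Finsupp.notMem_support_iff.1 ha).symm
    rw [h3]
    push_cast
    ring

lemma isExpansion_taylor [CharZero K] {F : Series K (ext p)} (hF : ∀ k, F.1 (k, 0) = 0) :
    IsExpansion p F fun g l => taylor p K g l F where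
  nil g := hF g
  graded_symmetric := gradedSymmetric_taylor F
  expansion := by
    classical
    intro N
    have hfin : (⋃ g ∈ Set.Iio N, ⋃ n ∈ Set.Iio N, (fun l => (g, l)) ''
        {l : List (WithBot I) | l.length = n ∧ taylor p K g l F ≠ 0}).Finite :=
      (Set.finite_Iio N).biUnion fun g _ => (Set.finite_Iio N).biUnion fun n _ =>
        (finite_taylor F g n).image _
    refine ⟨hfin.toFinset, fun J hJ m hm => ?_⟩
    obtain ⟨g, e⟩ := m
    rw [deg] at hm
    simp only at hm
    have hW := taylor_formula F g e.support rfl (subset_refl e.support)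
    have h1 : ∀ gl ∉ (wordsOver e.support e.degree).map
        ⟨fun l => (g, l), Prod.mk_right_injective g⟩,
        (word (K := K) p gl.1 gl.2).1 (g, e) = 0 := by
      rintro ⟨g', l⟩ hgl
      by_contra h
      have h2 := coe_word_ne_zero h
      rw [Prod.mk.injEq] at h2
      refine hgl (mem_map.2 ⟨l, mem_wordsOver.2 ⟨?_, fun a ha => ?_⟩, by rw [h2.1]; rfl⟩)
      · rw [h2.2, degree_content]
      · rw [Finsupp.mem_support_iff, h2.2, content_apply]
        exact (List.count_pos_iff.2 ha).ne'
    have hn : (e.degree.factorial : K) ≠ 0 := Nat.cast_ne_zero.2 (Nat.factorial_ne_zero _)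
    have h2 : F.1 (g, e) = ∑ gl ∈ (wordsOver e.support e.degree).map
        ⟨fun l => (g, l), Prod.mk_right_injective g⟩, (gl.2.length.factorial : K)⁻¹ *
          taylor p K gl.1 gl.2 F * (word (K := K) p gl.1 gl.2).1 (g, e) := by
      rw [sum_map]
      have h3 : ∀ l ∈ wordsOver e.support e.degree, (l.length.factorial : K)⁻¹ *
          taylor p K g l F * (word (K := K) p g l).1 (g, e) = (e.degree.factorial : K)⁻¹ *
            (taylor p K g l F * (word (K := K) p g l).1 (g, e)) := fun l hl => by
        rw [(mem_wordsOver.1 hl).1, mul_assoc]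
      refine Eq.trans ?_ (sum_congr rfl h3).symm
      rw [← mul_sum, hW, inv_mul_cancel_left₀ hn]
    rw [h2, coe_sum]
    simp only [coe_smul]
    refine Eq.trans (sum_subset (subset_union_left (s₂ := (wordsOver e.support e.degree).map
      ⟨fun l => (g, l), Prod.mk_right_injective g⟩)) ?_)
      (sum_subset (subset_union_right (s₁ := J)) ?_).symm
    · rintro ⟨g', l⟩ hgl hJ'
      rw [mem_union, or_iff_right hJ', mem_map] at hgl
      obtain ⟨l', hl', heq⟩ := hgl
      obtain ⟨rfl, rfl⟩ := Prod.mk.inj heq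
      have h3 : taylor p K g l' F = 0 := by
        by_contra h
        refine hJ' (hJ (hfin.mem_toFinset.2 ?_))
        simp only [Set.mem_iUnion]
        refine ⟨g, Set.mem_Iio.2 (by omega), l'.length, Set.mem_Iio.2 ?_, l', ⟨rfl, h⟩, rfl⟩
        rw [(mem_wordsOver.1 hl').1]
        omega
      simp only [h3, mul_zero, zero_mul]
    · intro gl _ hgl
      rw [h1 gl hgl, mul_zero]

/-- Under a permutation of the letters, words and graded-symmetric families change by the same
sign. -/
lemma exists_sign_of_perm {l l' : List (WithBot I)} (h : l.Perm l') (pre : List (WithBot I)) :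
    ∃ c : K, c * c = 1 ∧ (∀ G : ℕ → List (WithBot I) → K, GradedSymmetric p G → ∀ g,
      G g (pre ++ l) = c * G g (pre ++ l')) ∧
      ∀ g, word (K := K) p g (pre ++ l) = c • word p g (pre ++ l') := by
  induction h generalizing pre with
  | nil => exact ⟨1, one_mul 1, fun _ _ _ => (one_mul _).symm, fun _ => (one_smul K _).symm⟩
  | cons a _ ih => simpa using ih (pre ++ [a])
  | swap a b l =>
    refine ⟨chi K (ext p b * ext p a), chi_mul_self _, fun G hG g => hG g pre b a l, fun g => ?_⟩
    induction pre with
    | nil => simp only [List.nil_append, word_cons, X_X b a]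
    | cons c pre ih => rw [List.cons_append, List.cons_append, word_cons, word_cons, ih, map_smul]
  | trans _ _ ih ih' =>
    obtain ⟨c, hc, h1, h2⟩ := ih pre
    obtain ⟨d, hd, h3, h4⟩ := ih' pre
    refine ⟨c * d, by rw [mul_mul_mul_comm, hc, hd, one_mul], fun G hG g => ?_, fun g => ?_⟩
    · rw [h1 G hG, h3 G hG, mul_assoc]
    · rw [h2, h4, smul_smul]

/-- A graded-symmetric family vanishes on words in which an odd letter is repeated. -/
lemma GradedSymmetric.eq_zero [CharZero K] {G : ℕ → List (WithBot I) → K}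
    (hG : GradedSymmetric p G) (g : ℕ) {l : List (WithBot I)}
    (hl : ¬ Admissible (ext p) (content l)) : G g l = 0 := by
  classical
  simp only [Admissible, not_forall, not_le] at hl
  obtain ⟨a, ha, h⟩ := hl
  rw [content_apply] at h
  have h1 : a ∈ l := List.count_pos_iff.1 (by omega)
  have h2 : a ∈ l.erase a := List.count_pos_iff.1 (by rw [List.count_erase_self]; omega)
  have hperm : l.Perm (a :: a :: (l.erase a).erase a) :=
    (List.perm_cons_erase h1).trans ((List.perm_cons_erase h2).cons a)
  obtain ⟨c, -, hc, -⟩ := exists_sign_of_perm (K := K) (p := p) hperm []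
  have h3 := hG g [] a a ((l.erase a).erase a)
  rw [ha, mul_one, chi_eq, chi_one, neg_one_mul, self_eq_neg] at h3
  have h4 := hc G hG g
  rwa [h3, mul_zero] at h4

lemma isExpansion_unique [CharZero K] {F : Series K (ext p)} {G G' : ℕ → List (WithBot I) → K}
    (hG : IsExpansion p F G) (hG' : IsExpansion p F G') : G = G' := by
  classical
  funext g l
  rw [← sub_eq_zero]
  set H : ℕ → List (WithBot I) → K := fun g l => G g l - G' g l with hH
  have hHs : GradedSymmetric p H := fun g l a b l' => by
    simp only [hH]
    rw [hG.graded_symmetric, hG'.graded_symmetric]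
    ring
  change H g l = 0
  by_cases hl : Admissible (ext p) (content l)
  swap
  · exact hHs.eq_zero g hl
  obtain ⟨J, hJ⟩ := (hG.expansion.sub hG'.expansion) (deg (g, content l) + 1)
  -- All terms that contribute to the coefficient of `ħ ^ g x ^ l` are permutations of `l`.
  set P : Finset (ℕ × List (WithBot I)) :=
    l.permutations.toFinset.map ⟨fun l => (g, l), Prod.mk_right_injective g⟩ with hP
  have h1 := hJ (J ∪ P) subset_union_left (g, content l) (by omega)
  rw [sub_self, coe_zero, coe_sum] at h1
  have h2 : ∀ gl ∈ J ∪ P, gl ∉ P → ((((gl.2.length.factorial : K)⁻¹ * G gl.1 gl.2) •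
      word p gl.1 gl.2 - ((gl.2.length.factorial : K)⁻¹ * G' gl.1 gl.2) •
      word p gl.1 gl.2 : Series K (ext p))).1 (g, content l) = 0 := by
    rintro ⟨g', l'⟩ _ hP'
    by_contra h
    have h3 : (word (K := K) p g' l').1 (g, content l) ≠ 0 := fun h3 => h (by
      rw [coe_sub, coe_smul, coe_smul, h3, mul_zero, mul_zero, sub_zero])
    have h4 := coe_word_ne_zero h3
    rw [Prod.mk.injEq] at h4
    refine hP' (mem_map.2 ⟨l', ?_, by rw [h4.1]; rfl⟩)
    rw [List.mem_toFinset, List.mem_permutations, List.perm_iff_count]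
    intro a
    rw [← content_apply, ← content_apply, h4.2]
  rw [← sum_subset subset_union_right h2, hP, sum_map] at h1
  have h3 : ∀ l' ∈ l.permutations.toFinset, ((((l'.length.factorial : K)⁻¹ * G g l') •
      word p g l' - ((l'.length.factorial : K)⁻¹ * G' g l') • word p g l' :
          Series K (ext p))).1 (g, content l) =
      (l.length.factorial : K)⁻¹ * (H g l * (word (K := K) p g l).1 (g, content l)) := by
    intro l' hl'
    rw [List.mem_toFinset, List.mem_permutations] at hl'
    obtain ⟨c, hc, h5, h6⟩ := exists_sign_of_perm (K := K) (p := p) hl' []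
    have h7 := h5 H hHs g
    have h8 := h6 g
    simp only [List.nil_append] at h7 h8
    have h9 : H g l' * (word (K := K) p g l').1 (g, content l) =
        H g l * (word (K := K) p g l).1 (g, content l) := by
      rw [h7, h8, coe_smul]
      linear_combination H g l * (word (K := K) p g l).1 (g, content l) * hc
    rw [← h9, coe_sub, coe_smul, coe_smul, hl'.length_eq]
    simp only [hH]
    ring
  have h4 : ∑ l' ∈ l.permutations.toFinset, (l.length.factorial : K)⁻¹ *
      (H g l * (word (K := K) p g l).1 (g, content l)) = 0 :=
    (sum_congr rfl h3).symm.trans h1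
  rw [sum_const, nsmul_eq_mul] at h4
  have h5 : ((#l.permutations.toFinset : ℕ) : K) ≠ 0 := by
    rw [Nat.cast_ne_zero, card_ne_zero]
    exact ⟨l, List.mem_toFinset.2 (List.mem_permutations.2 (List.Perm.refl l))⟩
  have h6 : ((l.length.factorial : ℕ) : K)⁻¹ ≠ 0 :=
    inv_ne_zero (Nat.cast_ne_zero.2 (Nat.factorial_ne_zero _))
  obtain ⟨c, hc, hw⟩ := word_eq (K := K) (p := p) g l
  have h7 : (word (K := K) p g l).1 (g, content l) = c := by
    rw [hw, coe_smul, coe_mon, if_pos ⟨hl, rfl⟩, mul_one]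
  have h8 : c ≠ 0 := fun h => by simp [h] at hc
  rw [h7] at h4
  simpa [h5, h6, h8] using h4

end Recursion

end SuperAiry
end

theorem mainTheorem2 {K : Type*} [Field K] [CharZero K] {I : Type*} [LinearOrder I]
    (p : I → ZMod 2)
    (L : (I → K) →ₗ[K] Module.End K (SuperAiry.Series K (SuperAiry.ext p)))
    (hL : SuperAiry.IsSuperQuantumAiry p L) (hquad : SuperAiry.IsQuadratic p L)
    (A B C : I → WithBot I → WithBot I → K) (D : I → K)
    (hcoeff : SuperAiry.HasCoefficients p L A B C D) :
    (∃! F : SuperAiry.Series K (SuperAiry.ext p), SuperAiry.IsFreeEnergy p L F) ∧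
    ∀ F : SuperAiry.Series K (SuperAiry.ext p), SuperAiry.IsFreeEnergy p L F →
      (∃! G : ℕ → List (WithBot I) → K, SuperAiry.IsExpansion p F G) ∧
      ∀ G : ℕ → List (WithBot I) → K, SuperAiry.IsExpansion p F G →
        (∀ g n, {l : List (WithBot I) | l.length = n ∧ G g l ≠ 0}.Finite) ∧
        SuperAiry.TopologicalRecursion p A B C D G ∧
        SuperAiry.AuxiliaryEquation p G ∧
        SuperAiry.Normalized G ∧
        ∀ G' : ℕ → List (WithBot I) → K,
          SuperAiry.TopologicalRecursion p A B C D G' → SuperAiry.AuxiliaryEquation p G' →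
          SuperAiry.Normalized G' → SuperAiry.GradedSymmetric p G' ∧ G' = G := by
  open SuperAiry in
  have hexp : ∀ F, IsFreeEnergy p L F → IsExpansion p F fun g l => taylor p K g l F :=
    fun F hF => isExpansion_taylor hF.no_constant
  have hrec : ∀ F, IsFreeEnergy p L F → ∀ G',
      TopologicalRecursion p A B C D G' → AuxiliaryEquation p G' → Normalized G' →
      G' = fun g l => taylor p K g l F := fun F hF G' h1 h2 h3 =>
    recursion_unique (topologicalRecursion_taylor hL hcoeff hF)
      (gradedSymmetric_taylor F).auxiliaryEquation (normalized_taylor hF) h1 h2 h3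
  refine ⟨?_, fun F hF => ⟨⟨_, hexp F hF, fun G hG => isExpansion_unique hG (hexp F hF)⟩, ?_⟩⟩
  · obtain ⟨F, hF⟩ := exists_freeEnergy hL hcoeff
    refine ⟨F, hF, fun F' hF' => ?_⟩
    have h := hrec F hF _ (topologicalRecursion_taylor hL hcoeff hF')
      (gradedSymmetric_taylor F').auxiliaryEquation (normalized_taylor hF')
    have h1 := (hexp F' hF').expansion
    simp only [show ∀ g l, taylor p K g l F' = taylor p K g l F from
      fun g l => congrFun (congrFun h g) l] at h1
    exact h1.unique (hexp F hF).expansion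
  · intro G hG
    obtain rfl := isExpansion_unique hG (hexp F hF)
    refine ⟨fun g n => finite_taylor F g n, topologicalRecursion_taylor hL hcoeff hF,
      (gradedSymmetric_taylor F).auxiliaryEquation, normalized_taylor hF, fun G' h1 h2 h3 => ?_⟩
    obtain rfl := hrec F hF G' h1 h2 h3
    exact ⟨gradedSymmetric_taylor F, rfl⟩
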